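/- A \emph{BY forest} $(T,S,\epsilon F)$ consists of a finite graph-theoretic forest $T$ whose edges $e$ carry positive integer lengths $l(e)$, a subgraph $S\subseteq T$, and a signed automorphism $\epsilon F=(F,\epsilon)$ of $(T,S)$, that is, a length-preserving graph automorphism $F$ of $T$ with $F(S)=S$ together with a sign function $\epsilon\colon\pi_0(T\setminus S)\to\{\pm1\}$, where $T\setminus S$ is the complement of $S$ in the topological space underlying $T$. Signed automorphisms of $(T,S)$ form a group under $(F',\epsilon')\circ(F,\epsilon)=(F'F,\ C\mapsto\epsilon(C)\,\epsilon'(FC))$. The relative homology lattice $\Lambda_T=\mathrm H_1(T,S,\mathbb Z)$ carries the positive-definite intersection length pairing, the restriction of the pairing on relative $1$-chains given by $\langle c,c'\rangle=\sum_e l(e)\,c_e\,c'_e$ (sum over the edges $e$ of $T$ not in $S$), and an isometric action of signed automorphisms, in which $\epsilon F$ sends the class of a path $\gamma$ in the closure of a component $C$ of $T\setminus S$ to $\epsilon(C)[F\gamma]$. Let $\Lambda_T^\vee=\mathrm{Hom}(\Lambda_T,\mathbb Z)$, into which $\Lambda_T$ embeds via the pairing. The \emph{Tamagawa number} of $(T,S,\epsilon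 F)$ is the order $\#(\Lambda_T^\vee/\Lambda_T)^{\epsilon F}$ of the group of $\epsilon F$-invariants. Let $(T,S,\epsilon F)$ be a BY forest satisfying parity condition (B): no iterate of $F$ inverts (interchanges the two endpoints of) an edge of $T$ of odd length. Then there are positive integers $(a_d)_{d\geq1}$, with $a_d=1$ whenever $d$ does not divide the order of $\epsilon F$ in the group of signed automorphisms of $(T,S)$, such that for every integer $f\geq1$ the Tamagawa number of the BY forest $(T,S,(\epsilon F)^f)$ equals \[ \prod_{d\mid f}a_d^{\varphi(d)}, \] where $\varphi$ is Euler's totient function. -/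

import Mathlib

noncomputable section

/-- A pair `(T, S)`: a graph-theoretic forest `T` with vertex set `V`, an integral metric
(a positive integer length for every edge), and a subgraph `S`. -/
structure BYPair (V : Type*) where
  graph : SimpleGraph V
  isAcyclic : graph.IsAcyclic
  len : graph.edgeSet → ℕ
  len_pos : ∀ e, 0 < len e
  S : graph.Subgraph

namespace BYPair

variable {V : Type*} (P : BYPair V)

/-- `T ∖ S`, the complement in the underlying topological space, is the disjoint union of
the vertices of `T` not in `S` and of the open edges of `T` not in `S`. -/
def IsCell : V ⊕ Sym2 V → Prop
  | .inl v => v ∉ P.S.verts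
  | .inr e => e ∈ P.graph.edgeSet ∧ e ∉ P.S.edgeSet

/-- The vertices and open edges making up `T ∖ S`. -/
abbrev Cell : Type _ := {c : V ⊕ Sym2 V // P.IsCell c}

/-- Two cells of `T ∖ S` are adjacent when one is a vertex and the other is an open edge
having this vertex as an endpoint. -/
def cellGraph : SimpleGraph P.Cell :=
  SimpleGraph.fromRel fun c d => ∃ v e, c.1 = .inl v ∧ d.1 = .inr e ∧ v ∈ e

/-- `π₀(T ∖ S)`. -/
abbrev Comp : Type _ := P.cellGraph.ConnectedComponent

end BYPair

/-- A signed automorphism `εF` of a pair `(T, S)`: an isometric automorphism `F` of `T`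
preserving `S` and a sign for every component of `T ∖ S`. -/
@[ext]
structure SignedAut {V : Type*} (P : BYPair V) where
  F : P.graph ≃g P.graph
  isometric : ∀ e, P.len (F.mapEdgeSet e) = P.len e
  mem_S : ∀ v, F v ∈ P.S.verts ↔ v ∈ P.S.verts
  adj_S : ∀ u v, P.S.Adj (F u) (F v) ↔ P.S.Adj u v
  ε : P.Comp → ℤˣ

namespace SignedAut

variable {V : Type*} {P : BYPair V}

theorem isCell_edge_iff (u v : V) :
    P.IsCell (.inr s(u, v)) ↔ P.graph.Adj u v ∧ ¬ P.S.Adj u v := Iff.rfl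

theorem isCell_map_edge (g : SignedAut P) (u v : V) :
    P.IsCell (.inr s(g.F u, g.F v)) ↔ P.IsCell (.inr s(u, v)) := by
  rw [isCell_edge_iff, isCell_edge_iff, g.adj_S, g.F.map_adj_iff]

theorem isCell_map (g : SignedAut P) (c : P.Cell) :
    P.IsCell (Sum.map g.F (Sym2.map g.F) c.1) := by
  obtain ⟨v | e, h⟩ := c
  · exact fun h' => h ((g.mem_S v).1 h')
  · induction e with
    | h u v => exact (g.isCell_map_edge u v).2 h

/-- The action of `F` on the cells of `T ∖ S`. -/
def cellMap (g : SignedAut P) (c : P.Cell) : P.Cell :=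
  ⟨Sum.map g.F (Sym2.map g.F) c.1, g.isCell_map c⟩

theorem cellMap_adj (g : SignedAut P) {c d : P.Cell} (h : P.cellGraph.Adj c d) :
    P.cellGraph.Adj (g.cellMap c) (g.cellMap d) := by
  have key : ∀ c d : P.Cell, (∃ v e, c.1 = .inl v ∧ d.1 = .inr e ∧ v ∈ e) →
      ∃ v e, (g.cellMap c).1 = .inl v ∧ (g.cellMap d).1 = .inr e ∧ v ∈ e := by
    rintro c d ⟨v, e, hc, hd, hv⟩
    exact ⟨g.F v, Sym2.map g.F e, by simp [cellMap, hc], by simp [cellMap, hd],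
      Sym2.mem_map.2 ⟨v, hv, rfl⟩⟩
  have ne : ∀ c d : P.Cell, (∃ v e, c.1 = .inl v ∧ d.1 = .inr e ∧ v ∈ e) → c ≠ d := by
    rintro c d ⟨v, e, hc, hd, -⟩ rfl
    simp [hc] at hd
  rw [BYPair.cellGraph, SimpleGraph.fromRel_adj] at h ⊢
  rcases h with ⟨-, h | h⟩
  · exact ⟨ne _ _ (key _ _ h), .inl (key _ _ h)⟩
  · exact ⟨(ne _ _ (key _ _ h)).symm, .inr (key _ _ h)⟩

/-- The action of `F` on `π₀(T ∖ S)`. -/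
def compMap (g : SignedAut P) : P.Comp → P.Comp :=
  SimpleGraph.ConnectedComponent.map ⟨g.cellMap, g.cellMap_adj⟩

theorem compMap_mk (g : SignedAut P) (c : P.Cell) :
    g.compMap (P.cellGraph.connectedComponentMk c)
      = P.cellGraph.connectedComponentMk (g.cellMap c) := rfl

/-- The identity, with all signs `+1`. -/
instance : One (SignedAut P) where
  one :=
    { F := SimpleGraph.Iso.refl
      isometric := fun e => by
        congr 1
        obtain ⟨e, he⟩ := e
        induction e with
        | h u v => rfl
      mem_S := fun _ => Iff.rfl
      adj_S := fun _ _ => Iff.rfl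
      ε := fun _ => 1 }

/-- The composite `ε'F' ∘ εF` has underlying isomorphism `F'F` and
sign function `C ↦ ε(C) ε'(F C)`. -/
instance : Mul (SignedAut P) where
  mul g h :=
    { F := h.F.trans g.F
      isometric := fun e => by
        rw [← h.isometric e, ← g.isometric (h.F.mapEdgeSet e)]
        congr 1
        obtain ⟨e, he⟩ := e
        induction e with
        | h u v => rfl
      mem_S := fun v => (g.mem_S _).trans (h.mem_S v)
      adj_S := fun u v => (g.adj_S _ _).trans (h.adj_S u v)
      ε := fun C => h.ε C * g.ε (h.compMap C) }

theorem one_F (v : V) : (1 : SignedAut P).F v = v := rfl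

theorem mul_F (g h : SignedAut P) (v : V) : (g * h).F v = g.F (h.F v) := rfl

theorem one_ε (C : P.Comp) : (1 : SignedAut P).ε C = 1 := rfl

theorem mul_ε (g h : SignedAut P) (C : P.Comp) :
    (g * h).ε C = h.ε C * g.ε (h.compMap C) := rfl

theorem compMap_one (C : P.Comp) : (1 : SignedAut P).compMap C = C := by
  induction C using SimpleGraph.ConnectedComponent.ind with
  | h c =>
    rw [compMap_mk]
    congr 1
    obtain ⟨v | e, h⟩ := c
    · rfl
    · induction e with
      | h u v => rfl

theorem compMap_mul (g h : SignedAut P) (C : P.Comp) :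
    (g * h).compMap C = g.compMap (h.compMap C) := by
  induction C using SimpleGraph.ConnectedComponent.ind with
  | h c =>
    rw [compMap_mk, compMap_mk, compMap_mk]
    congr 1
    obtain ⟨v | e, h⟩ := c
    · rfl
    · induction e with
      | h u v => rfl

theorem ext' {g h : SignedAut P} (hF : ∀ v, g.F v = h.F v) (hε : ∀ C, g.ε C = h.ε C) :
    g = h :=
  SignedAut.ext (RelIso.ext hF) (funext hε)

/-- The underlying unsigned automorphism of the inverse (with all signs `+1`). -/
def invAux (g : SignedAut P) : SignedAut P where
  F := g.F.symm
  isometric e := by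
    rw [← g.isometric]
    congr 1
    exact g.F.mapEdgeSet.apply_symm_apply e
  mem_S v := by rw [← g.mem_S, RelIso.apply_symm_apply]
  adj_S u v := by rw [← g.adj_S, RelIso.apply_symm_apply, RelIso.apply_symm_apply]
  ε _ := 1

instance : Inv (SignedAut P) where
  inv g := { g.invAux with ε := fun C => (g.ε (g.invAux.compMap C))⁻¹ }

theorem inv_F (g : SignedAut P) (v : V) : g⁻¹.F v = g.F.symm v := rfl

theorem inv_ε (g : SignedAut P) (C : P.Comp) :
    g⁻¹.ε C = (g.ε (g⁻¹.compMap C))⁻¹ := rfl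

theorem compMap_inv_compMap (g : SignedAut P) (C : P.Comp) :
    g⁻¹.compMap (g.compMap C) = C := by
  induction C using SimpleGraph.ConnectedComponent.ind with
  | h c =>
    rw [compMap_mk, compMap_mk]
    congr 1
    obtain ⟨v | e, h⟩ := c
    · exact Subtype.ext (congrArg Sum.inl (g.F.symm_apply_apply v))
    · induction e with
      | h u v =>
        refine Subtype.ext (congrArg Sum.inr ?_)
        change s(g.F.symm (g.F u), g.F.symm (g.F v)) = s(u, v)
        rw [RelIso.symm_apply_apply, RelIso.symm_apply_apply]

/-- The group of signed automorphisms of `(T, S)`. -/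
instance : Group (SignedAut P) :=
  Group.ofLeftAxioms
    (fun a b c => ext' (fun _ => rfl) fun C => by
      rw [mul_ε, mul_ε, mul_ε, mul_ε, compMap_mul, mul_assoc])
    (fun a => ext' (fun _ => rfl) fun C => by rw [mul_ε, one_ε, mul_one])
    (fun a => ext' (fun v => a.F.symm_apply_apply v) fun C => by
      rw [mul_ε, inv_ε, compMap_inv_compMap, mul_inv_cancel, one_ε])

open Classical in
/-- The sign `ε(C)` of the component `C` of `T ∖ S` containing the open edge `uv`
(and, as a dummy value, `1` if `uv` is not an edge of `T ∖ S`). -/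
def edgeSign (g : SignedAut P) (u v : V) : ℤ :=
  if h : P.IsCell (.inr s(u, v)) then
    (g.ε (P.cellGraph.connectedComponentMk ⟨.inr s(u, v), h⟩) : ℤ) else 1

theorem edgeSign_comm (g : SignedAut P) (u v : V) : g.edgeSign u v = g.edgeSign v u := by
  unfold edgeSign
  rw [Sym2.eq_swap]

theorem edgeSign_mul_self (g : SignedAut P) (u v : V) :
    g.edgeSign u v * g.edgeSign u v = 1 := by
  unfold edgeSign
  split_ifs
  · rw [← Units.val_mul, Int.units_mul_self, Units.val_one]
  · rfl

theorem edgeSign_one (u v : V) : (1 : SignedAut P).edgeSign u v = 1 := by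
  unfold edgeSign
  split_ifs <;> rfl

theorem edgeSign_mul (g h : SignedAut P) (u v : V) :
    (g * h).edgeSign u v = h.edgeSign u v * g.edgeSign (h.F u) (h.F v) := by
  unfold edgeSign
  by_cases H : P.IsCell (.inr s(u, v))
  · rw [dif_pos H, dif_pos H, dif_pos ((h.isCell_map_edge u v).2 H), mul_ε, Units.val_mul]
    rfl
  · rw [dif_neg H, dif_neg H, dif_neg (fun H' => H ((h.isCell_map_edge u v).1 H')), mul_one]

/-- Edges of `T ∖ S` sharing an endpoint outside `S` lie in the same component. -/
theorem edgeSign_eq (g : SignedAut P) {u v w : V} (hu : u ∉ P.S.verts)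
    (hv : P.IsCell (.inr s(u, v))) (hw : P.IsCell (.inr s(u, w))) :
    g.edgeSign u v = g.edgeSign u w := by
  have key : ∀ z (hz : P.IsCell (.inr s(u, z))),
      P.cellGraph.connectedComponentMk ⟨.inr s(u, z), hz⟩
        = P.cellGraph.connectedComponentMk ⟨.inl u, hu⟩ := by
    intro z hz
    apply SimpleGraph.ConnectedComponent.sound
    apply SimpleGraph.Adj.reachable
    rw [BYPair.cellGraph, SimpleGraph.fromRel_adj]
    exact ⟨fun H => Sum.inr_ne_inl (congrArg Subtype.val H),
      .inr ⟨u, s(u, z), rfl, rfl, Sym2.mem_mk_left u z⟩⟩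
  rw [edgeSign, edgeSign, dif_pos hv, dif_pos hw, key v hv, key w hw]

end SignedAut

namespace BYPair

variable {V : Type*} [Fintype V] (P : BYPair V)

/-- The relative homology lattice `Λ = H₁(T, S, ℤ)`, computed by the relative cellular chain
complex (which has no `2`-chains), i.e. as the kernel of `∂ : C₁(T, S) → C₀(T, S)`.
A relative `1`-chain is an antisymmetric function `c` on oriented edges vanishing on the edges
of `S`; `c u v` is the coefficient of the edge oriented from `u` to `v`, and `∂ c` is determined
up to sign by the net outflow of `c` at the vertices outside `S`. -/
def homology : Submodule ℤ (V → V → ℤ) where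
  carrier := {c | (∀ u v, c v u = - c u v) ∧ (∀ u v, ¬ P.IsCell (.inr s(u, v)) → c u v = 0) ∧
    ∀ v, v ∉ P.S.verts → ∑ w, c v w = 0}
  zero_mem' := by simp
  add_mem' := by
    rintro a b ⟨ha1, ha2, ha3⟩ ⟨hb1, hb2, hb3⟩
    refine ⟨fun u v => ?_, fun u v h => ?_, fun v h => ?_⟩
    · simp only [Pi.add_apply, ha1 u v, hb1 u v]; ring
    · simp only [Pi.add_apply, ha2 u v h, hb2 u v h, add_zero]
    · simp only [Pi.add_apply, Finset.sum_add_distrib, ha3 v h, hb3 v h, add_zero]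
  smul_mem' := by
    rintro n a ⟨ha1, ha2, ha3⟩
    refine ⟨fun u v => ?_, fun u v h => ?_, fun v h => ?_⟩
    · simp only [Pi.smul_apply, smul_eq_mul, ha1 u v]; ring
    · simp only [Pi.smul_apply, smul_eq_mul, ha2 u v h, mul_zero]
    · simp only [Pi.smul_apply, smul_eq_mul, ← Finset.mul_sum, ha3 v h, mul_zero]

variable {P} in
/-- The product of the coefficients of two chains at an edge, for either orientation. -/
def edgeProd (x y : P.homology) : Sym2 V → ℤ :=
  Sym2.lift ⟨fun u v => x.1 u v * y.1 u v, fun u v => by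
    change x.1 u v * y.1 u v = x.1 v u * y.1 v u
    rw [x.2.1 u v, y.2.1 u v, neg_mul_neg]⟩

open Classical in
/-- The intersection length pairing `⟨x, y⟩ = ∑ₑ l(e) xₑ yₑ` on `H₁(T, S, ℤ)`. -/
def pairing : P.homology →ₗ[ℤ] Module.Dual ℤ P.homology :=
  LinearMap.mk₂ ℤ (fun x y => ∑ e : P.graph.edgeSet, (P.len e : ℤ) * edgeProd x y e.1)
    (fun x x' y => by
      rw [← Finset.sum_add_distrib]
      refine Finset.sum_congr rfl fun e _ => ?_
      obtain ⟨e, he⟩ := e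
      induction e with
      | h u v => simp only [edgeProd, Sym2.lift_mk, Submodule.coe_add, Pi.add_apply]; ring)
    (fun n x y => by
      rw [Finset.smul_sum]
      refine Finset.sum_congr rfl fun e _ => ?_
      obtain ⟨e, he⟩ := e
      induction e with
      | h u v => simp only [edgeProd, Sym2.lift_mk, Submodule.coe_smul, Pi.smul_apply,
          smul_eq_mul]; ring)
    (fun x y y' => by
      rw [← Finset.sum_add_distrib]
      refine Finset.sum_congr rfl fun e _ => ?_
      obtain ⟨e, he⟩ := e
      induction e with
      | h u v => simp only [edgeProd, Sym2.lift_mk, Submodule.coe_add, Pi.add_apply]; ring)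
    (fun n x y => by
      rw [Finset.smul_sum]
      refine Finset.sum_congr rfl fun e _ => ?_
      obtain ⟨e, he⟩ := e
      induction e with
      | h u v => simp only [edgeProd, Sym2.lift_mk, Submodule.coe_smul, Pi.smul_apply,
          smul_eq_mul]; ring)

/-- The geometric Néron component group `Λ^∨ / Λ`. -/
abbrev geomComponentGroup : Type _ :=
  Module.Dual ℤ P.homology ⧸ LinearMap.range P.pairing

end BYPair

namespace SignedAut

variable {V : Type*} {P : BYPair V}

/-- `εF` on chains: the coefficient of an oriented edge `e` of a component `C` is multiplied
by `ε(C)` and becomes the coefficient of `F e`. -/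
def chainMap (g : SignedAut P) (c : V → V → ℤ) : V → V → ℤ := fun u v =>
  g.edgeSign (g.F.symm u) (g.F.symm v) * c (g.F.symm u) (g.F.symm v)

theorem chainMap_apply_F (g : SignedAut P) (c : V → V → ℤ) (u v : V) :
    g.chainMap c (g.F u) (g.F v) = g.edgeSign u v * c u v := by
  simp only [chainMap, RelIso.symm_apply_apply]

variable [Fintype V]

theorem chainMap_mem (g : SignedAut P) {c : V → V → ℤ} (hc : c ∈ P.homology) :
    g.chainMap c ∈ P.homology := by
  obtain ⟨h1, h2, h3⟩ := hc
  refine ⟨fun u v => ?_, fun u v h => ?_, fun v h => ?_⟩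
  · obtain ⟨u, rfl⟩ := g.F.surjective u
    obtain ⟨v, rfl⟩ := g.F.surjective v
    rw [chainMap_apply_F, chainMap_apply_F, g.edgeSign_comm v u, h1 u v, mul_neg]
  · obtain ⟨u, rfl⟩ := g.F.surjective u
    obtain ⟨v, rfl⟩ := g.F.surjective v
    rw [chainMap_apply_F, h2 u v (fun H => h ((g.isCell_map_edge u v).2 H)), mul_zero]
  · obtain ⟨v, rfl⟩ := g.F.surjective v
    have hv : v ∉ P.S.verts := fun H => h ((g.mem_S v).2 H)
    rw [← g.F.toEquiv.sum_comp]
    change ∑ w, g.chainMap c (g.F v) (g.F w) = 0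
    simp only [chainMap_apply_F]
    by_cases H : ∃ w₀, P.IsCell (.inr s(v, w₀))
    · obtain ⟨w₀, hw₀⟩ := H
      have : ∀ w, g.edgeSign v w * c v w = g.edgeSign v w₀ * c v w := by
        intro w
        by_cases hw : P.IsCell (.inr s(v, w))
        · rw [g.edgeSign_eq hv hw hw₀]
        · rw [h2 v w hw, mul_zero, mul_zero]
      rw [Finset.sum_congr rfl fun w _ => this w, ← Finset.mul_sum, h3 v hv, mul_zero]
    · exact Finset.sum_eq_zero fun w _ => by rw [h2 v w fun hw => H ⟨w, hw⟩, mul_zero]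

variable (P) in
/-- The action of signed automorphisms on `H₁(T, S, ℤ)`. -/
def homologyRep : Representation ℤ (SignedAut P) P.homology where
  toFun g :=
    { toFun := fun c => ⟨g.chainMap c.1, g.chainMap_mem c.2⟩
      map_add' := fun a b => Subtype.ext <| funext fun u => funext fun v => by
        simp only [chainMap, Submodule.coe_add, Pi.add_apply, mul_add]
      map_smul' := fun n a => Subtype.ext <| funext fun u => funext fun v => by
        simp only [chainMap, Submodule.coe_smul, Pi.smul_apply, smul_eq_mul, RingHom.id_apply]
        ring }
  map_one' := LinearMap.ext fun c => Subtype.ext <| funext fun u => funext fun v => by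
    change (1 : SignedAut P).chainMap c.1 u v = c.1 u v
    rw [← one_F (P := P) u, ← one_F (P := P) v, chainMap_apply_F, edgeSign_one, one_mul]
    rfl
  map_mul' g h := LinearMap.ext fun c => Subtype.ext <| funext fun u => funext fun v => by
    change (g * h).chainMap c.1 u v = g.chainMap (h.chainMap c.1) u v
    obtain ⟨u, rfl⟩ := (g * h).F.surjective u
    obtain ⟨v, rfl⟩ := (g * h).F.surjective v
    rw [chainMap_apply_F, mul_F, mul_F, chainMap_apply_F, chainMap_apply_F, edgeSign_mul]
    ring

theorem homologyRep_apply (g : SignedAut P) (x : P.homology) :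
    (homologyRep P g x).1 = g.chainMap x.1 := rfl

/-- Signed automorphisms are isometries for the intersection length pairing. -/
theorem pairing_isometric (g : SignedAut P) (x y : P.homology) :
    P.pairing (homologyRep P g x) (homologyRep P g y) = P.pairing x y := by
  classical
  change ∑ e : P.graph.edgeSet, _ = ∑ e : P.graph.edgeSet, _
  rw [← g.F.mapEdgeSet.sum_comp]
  refine Finset.sum_congr rfl fun e _ => ?_
  rw [g.isometric]
  congr 1
  obtain ⟨e, he⟩ := e
  induction e with
  | h u v =>
    change g.chainMap x.1 (g.F u) (g.F v) * g.chainMap y.1 (g.F u) (g.F v)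
      = x.1 u v * y.1 u v
    rw [chainMap_apply_F, chainMap_apply_F, mul_mul_mul_comm, edgeSign_mul_self, one_mul]

theorem range_pairing_le (g : SignedAut P) :
    LinearMap.range P.pairing
      ≤ (LinearMap.range P.pairing).comap ((homologyRep P).dual g) := by
  rintro _ ⟨x, rfl⟩
  refine ⟨homologyRep P g x, LinearMap.ext fun y => ?_⟩
  have hy : homologyRep P g (homologyRep P g⁻¹ y) = y := by
    rw [← Module.End.mul_apply, ← map_mul, mul_inv_cancel, map_one, Module.End.one_apply]
  rw [Representation.dual_apply]
  change P.pairing (homologyRep P g x) y = P.pairing x (homologyRep P g⁻¹ y)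
  rw [← pairing_isometric g x, hy]

variable (P) in
/-- The action of signed automorphisms on the geometric Néron component group `Λ^∨ / Λ`,
induced by the contragredient action on `Λ^∨`. -/
def geomComponentRep : Representation ℤ (SignedAut P) P.geomComponentGroup :=
  (homologyRep P).dual.quotient (LinearMap.range P.pairing) range_pairing_le

end SignedAut

/-- A BY forest `(T, S, εF)` with vertex set `V`. -/
structure BYForest (V : Type*) extends BYPair V where
  εF : SignedAut toBYPair

namespace BYForest

variable {V : Type*}

/-- Parity condition (B): no iterate of `F` inverts (i.e. swaps the endpoints of) an edge of `T`
of odd length. -/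
def ParityB (T : BYForest V) : Prop :=
  ∀ (k : ℕ) (u v : V) (h : T.graph.Adj u v), Odd (T.len ⟨s(u, v), h⟩) →
    ¬ ((T.εF.F)^[k] u = v ∧ (T.εF.F)^[k] v = u)

/-- `T_{1,f} = (T, S, (εF)^f)`. -/
def unramified (T : BYForest V) (f : ℕ) : BYForest V where
  toBYPair := T.toBYPair
  εF := T.εF ^ f

/-- The Néron component group: the `εF`-invariants of the geometric Néron component group. -/
def componentGroup [Fintype V] (T : BYForest V) :
    Submodule ℤ T.toBYPair.geomComponentGroup :=
  LinearMap.eqLocus (SignedAut.geomComponentRep T.toBYPair T.εF) LinearMap.id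

/-- The Tamagawa number: the order of the Néron component group. -/
def tamagawa [Fintype V] (T : BYForest V) : ℕ := Nat.card T.componentGroup

end BYForest

end

/-! The group `Λ^∨ / Λ` is the cokernel of an integral matrix supported on a forest, and its
invariants are counted on orbits. Subdivide every edge of even length at its midpoint and orient
both halves towards it. Condition (B) says exactly that the edges of odd length can be oriented
`F`-equivariantly (`exists_isOrientation`, `oriented`). If `L` is the diagonal matrix of lengths and
`∂` the boundary relative to `S`, then `Λ = ker ∂`, and the block matrix `B = (L, ∂ᵀ; ∂, 0)` has
cokernel `Λ^∨ / Λ` (`card_invariants`). It lives on the forest joining edges to their free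
endpoints. Inverting `B` over `ℚ` identifies the cokernel with the functions `h` with values in
`ℚ/ℤ` and `B h = 0`, so the Tamagawa number for `f` counts such `h` with `h (F^f x) = sgn_f(x) h x`
(`numSolutions`).

For a single signed automorphism, call a point positive if its stabilizer acts by `+1`, and negative
otherwise. An invariant `h` is 2-torsion at negative points. Signs and eigenvalues can be absorbed
into locally constant functions because no iterate of `F` inverts an edge
(`exists_locally_constant`). Thus `B` descends to integral matrices on orbits, and the count is
`|det|` on the positive orbits times `2` to the nullity mod 2 on the negative ones
(`card_solutions`).

Now let `f` vary. Over `ℂ` the invariants of the `f`-th power split into eigenfunctions for the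
`f`-th roots of unity. For a root of order `d` these live on `rootSet d` and give an integral orbit
matrix depending only on `d`; hence a factor `r_d = |det|` with exponent `φ(d)`
(`det_quot_pow_pos`). Mod 2, for `f = 2^s f'` with `f'` odd, only the odd part can be diagonalized,
and the exponent of `2` is the sum of `φ(d) 2^s m(2^s d)` over `d ∣ f'`, where `m(e)` is the nullity
on `negSet e` (`nullity_compl_pos_pow`). With `h(d)` the nullity on `halfSet d`, the relation `m(e)
= h(2e) + m(2e)` rewrites this exponent as the sum of `φ(d) (m(d) - h(d))` over `d ∣ f`
(`sum_totient_two_pow_mul`). Negative terms do no harm, since `2^h(d)` divides `r_d`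
(`two_pow_nullity_halfSet_dvd`). So `a_d = r_d 2^(m(d) - h(d))` works. Finally, invariants depend
only on the gcd of `f` with the order of `εF`, so the other `a_d` may be replaced by `1`. -/

/-! ### Fixed vertices of endomorphisms of trees and forests -/

/-- An endomorphism of a finite tree that inverts no edge has a fixed vertex. -/
theorem SimpleGraph.IsTree.exists_fixed_vertex {K : Type*} [Finite K] {G : SimpleGraph K}
    (hG : G.IsTree) (τ : K → K) (hτ : ∀ a b, G.Adj a b → G.Adj (τ a) (τ b))
    (hinv : ∀ a b, G.Adj a b → ¬ (τ a = b ∧ τ b = a)) : ∃ z, τ z = z := by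
  classical
  cases nonempty_fintype K
  by_contra! hfix
  have hnext : ∀ v, ∃ w, G.Adj v w ∧ (G.deleteEdges {s(v, w)}).Reachable w (τ v) := by
    intro v
    obtain ⟨p, hp⟩ := hG.connected.exists_isPath v (τ v)
    generalize hw : τ v = w at p
    cases p with
    | nil => exact absurd hw (hfix v)
    | cons h q =>
      rename_i y
      refine ⟨y, h, SimpleGraph.reachable_deleteEdges_iff_exists_walk.2 ⟨q, fun hmem => ?_⟩⟩
      rw [SimpleGraph.Walk.cons_isPath_iff] at hp
      exact hp.2 (q.fst_mem_support_of_mem_edges hmem)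
  choose n hadj hreach using hnext
  -- `n v` is the first step from `v` towards `τ v`. A tree has one edge fewer than vertices, so two
  -- vertices step along the same edge, towards each other.
  have hni : ¬ Function.Injective (fun v => (⟨s(v, n v), hadj v⟩ : G.edgeSet)) := by
    intro hinj
    have h1 := Fintype.card_le_of_injective _ hinj
    have h2 := hG.card_edgeFinset
    rw [← SimpleGraph.edgeFinset_card] at h1
    omega
  simp only [Function.Injective, not_forall] at hni
  obtain ⟨v, w, hvw, hne⟩ := hni
  have hvw' : s(v, n v) = s(w, n w) := congrArg Subtype.val hvw
  rw [Sym2.eq_iff] at hvw'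
  obtain ⟨h, -⟩ | ⟨hv, hw⟩ := hvw'
  · exact hne h
  have rv := hreach v
  have rw' := hreach w
  have av := hadj v
  rw [hw] at rv av
  rw [← hv, Sym2.eq_swap] at rw'
  have hbr := SimpleGraph.isAcyclic_iff_forall_adj_isBridge.1 hG.isAcyclic av
  rw [SimpleGraph.isBridge_iff] at hbr
  -- `τ v` lies on the side of `w` and `τ w` on the side of `v`, yet they are adjacent; only the
  -- bridge `vw` itself can join them, so it is inverted.
  by_cases he : s(τ v, τ w) = s(v, w)
  · rw [Sym2.eq_iff] at he
    obtain ⟨h, -⟩ | ⟨h1, h2⟩ := he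
    · exact hfix v h
    · exact hinv v w av ⟨h1, h2⟩
  · have hadj' : (G.deleteEdges {s(v, w)}).Adj (τ v) (τ w) := by
      rw [SimpleGraph.deleteEdges_adj]
      exact ⟨hτ _ _ av, he⟩
    exact hbr (rw'.trans (hadj'.reachable.symm.trans rv.symm))

/-- An endomorphism of a finite forest that inverts no edge and maps some component to itself has
a fixed vertex in this component. -/
theorem SimpleGraph.IsAcyclic.exists_fixed_vertex {X : Type*} [Finite X] {G : SimpleGraph X}
    (hG : G.IsAcyclic) (τ : X → X) (hτ : ∀ a b, G.Adj a b → G.Adj (τ a) (τ b))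
    (hinv : ∀ a b, G.Adj a b → ¬ (τ a = b ∧ τ b = a)) {x : X} (hx : G.Reachable x (τ x)) :
    ∃ z, G.Reachable x z ∧ τ z = z := by
  classical
  let c := G.connectedComponentMk x
  have hmem : ∀ z, z ∈ c.supp ↔ G.Reachable z x := fun z => by
    rw [SimpleGraph.ConnectedComponent.mem_supp_iff, SimpleGraph.ConnectedComponent.eq]
  have hreach : ∀ z w, G.Reachable z w → G.Reachable (τ z) (τ w) := fun z w h =>
    h.map (⟨τ, hτ _ _⟩ : G →g G)
  let τ' : c.supp → c.supp := fun z =>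
    ⟨τ z.1, (hmem _).2 ((hreach _ _ ((hmem _).1 z.2)).trans hx.symm)⟩
  obtain ⟨z, hz⟩ := (hG.isTree_connectedComponent c).exists_fixed_vertex τ'
    (fun a b h => hτ _ _ h) (fun a b h h' =>
      hinv a.1 b.1 h ⟨congrArg Subtype.val h'.1, congrArg Subtype.val h'.2⟩)
  exact ⟨z.1, ((hmem _).1 z.2).symm, congrArg Subtype.val hz⟩

/-! ### Orbit products and locally constant coboundaries -/

/-- The product of the values of `c` at the first `k` points of the orbit of `x`. -/
def orbitProd {X H : Type*} [CommMonoid H] (F : Equiv.Perm X) (c : X → H) (k : ℕ) (x : X) : H :=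
  ∏ i ∈ Finset.range k, c ((F ^ i) x)

section orbitProd

variable {X H : Type*} [CommMonoid H] (F : Equiv.Perm X) (c : X → H)

@[simp] theorem orbitProd_zero (x : X) : orbitProd F c 0 x = 1 := rfl

@[simp] theorem orbitProd_one (x : X) : orbitProd F c 1 x = c x := by simp [orbitProd]

theorem orbitProd_succ (k : ℕ) (x : X) :
    orbitProd F c (k + 1) x = orbitProd F c k x * c ((F ^ k) x) :=
  Finset.prod_range_succ _ _

theorem orbitProd_add (j k : ℕ) (x : X) :
    orbitProd F c (j + k) x = orbitProd F c j x * orbitProd F c k ((F ^ j) x) := by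
  simp only [orbitProd, Finset.prod_range_add]
  congr 1
  refine Finset.prod_congr rfl fun i _ => ?_
  rw [add_comm j i, pow_add, Equiv.Perm.mul_apply]

theorem orbitProd_mul_pow (j k : ℕ) (x : X) :
    orbitProd F c (j * k) x = orbitProd (F ^ j) (orbitProd F c j) k x := by
  induction k with
  | zero => simp
  | succ k ih => rw [Nat.mul_succ, orbitProd_add, ih, orbitProd_succ, pow_mul]

theorem orbitProd_mul (c' : X → H) (k : ℕ) (x : X) :
    orbitProd F (fun x => c x * c' x) k x = orbitProd F c k x * orbitProd F c' k x :=
  Finset.prod_mul_distrib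

theorem orbitProd_const (a : H) (k : ℕ) (x : X) : orbitProd F (fun _ => a) k x = a ^ k := by
  simp [orbitProd]

theorem map_orbitProd {H' : Type*} [CommMonoid H'] (φ : H →* H') (k : ℕ) (x : X) :
    φ (orbitProd F c k x) = orbitProd F (fun x => φ (c x)) k x :=
  map_prod φ _ _

theorem pow_apply_mul_eq {q : ℕ} {x : X} (hx : (F ^ q) x = x) (j : ℕ) : (F ^ (q * j)) x = x := by
  induction j with
  | zero => simp
  | succ j ih => rw [Nat.mul_succ, pow_add, Equiv.Perm.mul_apply, hx, ih]

theorem orbitProd_mul_of_fixed {q : ℕ} {x : X} (hx : (F ^ q) x = x) (j : ℕ) :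
    orbitProd F c (q * j) x = orbitProd F c q x ^ j := by
  induction j with
  | zero => simp
  | succ j ih => rw [Nat.mul_succ, orbitProd_add, ih, pow_apply_mul_eq F hx, pow_succ]

end orbitProd

/-- On a finite forest with an automorphism `F` no iterate of which inverts an edge, a locally
constant function `c` on an `F`-stable set `Y` of vertices is the coboundary of a locally constant
function as soon as its product over every `F`-orbit in `Y` is trivial. -/
theorem SimpleGraph.IsAcyclic.exists_locally_constant {X H : Type*} [Finite X] [CommGroup H]
    {G : SimpleGraph X} (hG : G.IsAcyclic) (F : Equiv.Perm X)
    (hF : ∀ a b, G.Adj a b → G.Adj (F a) (F b))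
    (hinv : ∀ (k : ℕ) a b, G.Adj a b → ¬ ((F ^ k) a = b ∧ (F ^ k) b = a))
    (Y : Set X) (hY : ∀ x ∈ Y, F x ∈ Y) (c : X → H)
    (hc : ∀ x ∈ Y, ∀ y ∈ Y, G.Adj x y → c x = c y)
    (hc1 : ∀ x ∈ Y, ∀ k, (F ^ k) x = x → orbitProd F c k x = 1) :
    ∃ χ : X → H, (∀ x ∈ Y, χ (F x) = c x * χ x) ∧
      ∀ x ∈ Y, ∀ y ∈ Y, G.Adj x y → χ x = χ y := by
  classical
  let GY : SimpleGraph X :=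
    { Adj := fun a b => G.Adj a b ∧ a ∈ Y ∧ b ∈ Y
      symm := ⟨fun a b h => ⟨h.1.symm, h.2.2, h.2.1⟩⟩
      loopless := ⟨fun a h => G.loopless.irrefl a h.1⟩ }
  have hGY : GY.IsAcyclic := hG.anti fun a b h => h.1
  have hYk : ∀ (k : ℕ), ∀ x ∈ Y, (F ^ k) x ∈ Y := by
    intro k
    induction k with
    | zero => simp
    | succ k ih => intro x hx; rw [pow_succ']; exact hY _ (ih x hx)
  have hFk : ∀ (k : ℕ) a b, GY.Adj a b → GY.Adj ((F ^ k) a) ((F ^ k) b) := by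
    intro k a b h
    refine ⟨?_, hYk k _ h.2.1, hYk k _ h.2.2⟩
    induction k with
    | zero => simpa using h.1
    | succ k ih => rw [pow_succ']; exact hF _ _ ih
  have hRk : ∀ (k : ℕ) {a b}, GY.Reachable a b → GY.Reachable ((F ^ k) a) ((F ^ k) b) :=
    fun k a b h => h.map (⟨_, hFk k _ _⟩ : GY →g GY)
  have hcR : ∀ k a b, GY.Reachable a b → orbitProd F c k a = orbitProd F c k b := by
    intro k a b h
    rw [SimpleGraph.reachable_iff_reflTransGen] at h
    induction h with
    | refl => rfl
    | tail _ h ih =>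
      rw [ih]
      exact Finset.prod_congr rfl fun i _ =>
        hc _ (hYk i _ h.2.1) _ (hYk i _ h.2.2) (hFk i _ _ h).1
  have hRY : ∀ a b, GY.Reachable a b → a ∈ Y → b ∈ Y := by
    intro a b h ha
    rw [SimpleGraph.reachable_iff_reflTransGen] at h
    induction h with
    | refl => exact ha
    | tail _ h ih => exact h.2.2
  -- Only the component of `x`, not `x` itself, need return under `F ^ k`. A vertex of this
  -- component fixed by `F ^ k` supplies the hypothesis `hc1`, and orbit products are constant on
  -- components.
  have hc1' : ∀ x ∈ Y, ∀ k, GY.Reachable x ((F ^ k) x) → orbitProd F c k x = 1 := by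
    intro x hx k h
    obtain ⟨z, hz, hzk⟩ := hGY.exists_fixed_vertex (⇑(F ^ k)) (hFk k)
      (fun a b hab => hinv k a b hab.1) h
    rw [hcR k x z hz]
    exact hc1 z (hRY _ _ hz hx) k hzk
  have huniq : ∀ x ∈ Y, ∀ y j k, GY.Reachable ((F ^ j) x) y → GY.Reachable ((F ^ k) x) y →
      orbitProd F c j x = orbitProd F c k x := by
    intro x hx y
    have key : ∀ j k, GY.Reachable ((F ^ j) x) y → GY.Reachable ((F ^ k) x) y → j ≤ k →
        orbitProd F c j x = orbitProd F c k x := by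
      intro j k hj hk hjk
      obtain ⟨i, rfl⟩ := Nat.exists_eq_add_of_le hjk
      rw [orbitProd_add, hc1' _ (hYk j x hx) i, mul_one]
      rw [add_comm, pow_add, Equiv.Perm.mul_apply] at hk
      exact hj.trans hk.symm
    intro j k hj hk
    rcases le_total j k with h | h
    · exact key j k hj hk h
    · exact (key k j hk hj h).symm
  -- The classes are the `F`-orbits of components. The function `χ` accumulates `c` along the way
  -- from a representative; by `huniq` the number of steps chosen does not matter.
  let S : Setoid X :=
    { r := fun x y => ∃ k : ℕ, GY.Reachable ((F ^ k) x) y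
      iseqv :=
        { refl := fun x => ⟨0, by simp⟩
          symm := by
            rintro x y ⟨k, h⟩
            have hpos := orderOf_pos F
            refine ⟨k * (orderOf F - 1), ?_⟩
            have h' := (hRk (k * (orderOf F - 1)) h).symm
            rwa [← Equiv.Perm.mul_apply, ← pow_add,
              show k * (orderOf F - 1) + k = orderOf F * k by
                conv_lhs => rw [← Nat.mul_succ, Nat.succ_eq_add_one, Nat.sub_add_cancel hpos]
                exact mul_comm _ _, pow_mul F (orderOf F), pow_orderOf_eq_one, one_pow] at h'
          trans := by
            rintro x y z ⟨j, hj⟩ ⟨k, hk⟩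
            refine ⟨k + j, ?_⟩
            rw [pow_add, Equiv.Perm.mul_apply]
            exact (hRk k hj).trans hk } }
  have hout : ∀ y, ∃ k : ℕ, GY.Reachable ((F ^ k) (Quotient.mk S y).out) y := fun y =>
    Quotient.exact (Quotient.out_eq (Quotient.mk S y))
  choose k hk using hout
  have houtY : ∀ y ∈ Y, (Quotient.mk S y).out ∈ Y := by
    intro y hy
    have h := hRY _ _ (hk y).symm hy
    obtain ⟨j, hj⟩ := S.symm (Quotient.exact (Quotient.out_eq (Quotient.mk S y)))
    exact hRY _ _ hj (hYk j y hy)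
  have hval : ∀ y ∈ Y, ∀ y' j, Quotient.mk S y' = Quotient.mk S y →
      GY.Reachable ((F ^ j) (Quotient.mk S y).out) y' →
      orbitProd F c (k y') (Quotient.mk S y').out = orbitProd F c j (Quotient.mk S y).out := by
    intro y hy y' j he hj
    have h := hk y'
    rw [he] at h ⊢
    exact huniq _ (houtY y hy) y' _ _ h hj
  refine ⟨fun y => orbitProd F c (k y) (Quotient.mk S y).out, fun y hy => ?_,
    fun x hx y hy h => ?_⟩
  · have h1 : GY.Reachable ((F ^ (k y + 1)) (Quotient.mk S y).out) (F y) := by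
      rw [add_comm, pow_add, Equiv.Perm.mul_apply]
      simpa using hRk 1 (hk y)
    change orbitProd F c (k (F y)) (Quotient.mk S (F y)).out = _
    rw [hval y hy (F y) (k y + 1)
      (Quotient.sound (S.symm ⟨1, by simp⟩)) h1, orbitProd_succ, mul_comm]
    congr 1
    have := hcR 1 _ _ (hk y)
    simpa using this
  · have hR : GY.Reachable x y := SimpleGraph.Adj.reachable ⟨h, hx, hy⟩
    exact (hval x hx y (k x) (Quotient.sound (S.symm ⟨0, by simpa using hR⟩))
      ((hk x).trans hR)).symm

/-! ### Signed forests, orbit matrices and twists -/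

noncomputable section

/-- An integral matrix `B` supported on a finite forest, commuting with the permutation of the
vertices given by an automorphism `F` of this forest, no iterate of which inverts an edge, together
with a locally constant sign. -/
structure SignedForest (X : Type*) where
  graph : SimpleGraph X
  isAcyclic : graph.IsAcyclic
  F : Equiv.Perm X
  F_adj : ∀ x y, graph.Adj x y → graph.Adj (F x) (F y)
  no_inversion : ∀ (k : ℕ) x y, graph.Adj x y → ¬ ((F ^ k) x = y ∧ (F ^ k) y = x)
  s : X → ℤˣ
  s_adj : ∀ x y, graph.Adj x y → s x = s y
  B : Matrix X X ℤ
  B_F : ∀ x y, B (F x) (F y) = B x y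
  B_adj : ∀ x y, B x y ≠ 0 → x = y ∨ graph.Adj x y

/-- An integral matrix acting on vectors with entries in a module. -/
def Matrix.intMulVec {m n : Type*} [Fintype n] (A : Matrix m n ℤ) (R M : Type*) [CommRing R]
    [AddCommGroup M] [Module R M] : (n → M) →ₗ[R] (m → M) where
  toFun h i := ∑ j, A i j • h j
  map_add' a b := funext fun i => by
    simp only [Pi.add_apply, smul_add, Finset.sum_add_distrib]
  map_smul' r a := funext fun i => by
    simp only [Pi.smul_apply, RingHom.id_apply, Finset.smul_sum]
    exact Finset.sum_congr rfl fun j _ => smul_comm _ _ _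

theorem Matrix.intMulVec_apply {m n : Type*} [Fintype n] (A : Matrix m n ℤ) (R M : Type*)
    [CommRing R] [AddCommGroup M] [Module R M] (h : n → M) (i : m) :
    A.intMulVec R M h i = ∑ j, A i j • h j := rfl

namespace SignedForest

variable {X : Type*} (D : SignedForest X)

theorem F_pow_adj (k : ℕ) (x y : X) (h : D.graph.Adj x y) :
    D.graph.Adj ((D.F ^ k) x) ((D.F ^ k) y) := by
  induction k with
  | zero => simpa using h
  | succ k ih => rw [pow_succ']; exact D.F_adj _ _ ih

theorem B_F_pow (k : ℕ) (x y : X) : D.B ((D.F ^ k) x) ((D.F ^ k) y) = D.B x y := by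
  induction k with
  | zero => simp
  | succ k ih => rw [pow_succ']; exact (D.B_F _ _).trans ih

/-- The sign of the `k`-th iterate. -/
def sgn (k : ℕ) (x : X) : ℤˣ := orbitProd D.F D.s k x

theorem sgn_adj (k : ℕ) (x y : X) (h : D.graph.Adj x y) : D.sgn k x = D.sgn k y := by
  unfold sgn orbitProd
  exact Finset.prod_congr rfl fun i _ => D.s_adj _ _ (D.F_pow_adj i _ _ h)

theorem sgn_succ (k : ℕ) (x : X) : D.sgn (k + 1) x = D.sgn k x * D.s ((D.F ^ k) x) :=
  orbitProd_succ _ _ _ _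

theorem sgn_B (k : ℕ) (x y : X) (h : D.B x y ≠ 0) : D.sgn k x = D.sgn k y := by
  rcases D.B_adj x y h with rfl | h
  · rfl
  · exact D.sgn_adj k x y h

/-- The `f`-th power of the signed automorphism. -/
def pow (f : ℕ) : SignedForest X where
  graph := D.graph
  isAcyclic := D.isAcyclic
  F := D.F ^ f
  F_adj := D.F_pow_adj f
  no_inversion k x y h := by rw [← pow_mul]; exact D.no_inversion _ x y h
  s := D.sgn f
  s_adj := D.sgn_adj f
  B := D.B
  B_F := D.B_F_pow f
  B_adj := D.B_adj

theorem sgn_pow (f k : ℕ) (x : X) : (D.pow f).sgn k x = D.sgn (f * k) x :=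
  (orbitProd_mul_pow D.F D.s f k x).symm

theorem pow_F_pow (f k : ℕ) : (D.pow f).F ^ k = D.F ^ (f * k) := (pow_mul _ _ _).symm

/-- The set of orbits. -/
abbrev Orbit : Type _ := Quotient (Equiv.Perm.SameCycle.setoid D.F)

/-- The orbit of a point. -/
abbrev orbit (x : X) : D.Orbit := Quotient.mk _ x

theorem orbit_F (x : X) : D.orbit (D.F x) = D.orbit x :=
  Quotient.sound (Equiv.Perm.sameCycle_apply_left.2 (Equiv.Perm.SameCycle.refl _ _))

theorem orbit_F_pow (k : ℕ) (x : X) : D.orbit ((D.F ^ k) x) = D.orbit x :=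
  Quotient.sound (Equiv.Perm.sameCycle_pow_left.2 (Equiv.Perm.SameCycle.refl _ _))

theorem exists_pow_out [Finite X] (x : X) : ∃ k : ℕ, (D.F ^ k) (D.orbit x).out = x := by
  obtain ⟨k, h⟩ := Equiv.Perm.SameCycle.exists_nat_pow_eq (f := D.F)
    (Quotient.exact (Quotient.out_eq (D.orbit x)))
  exact ⟨k, h⟩

theorem exists_pow_eq_out [Finite X] (x : X) : ∃ k : ℕ, (D.F ^ k) x = (D.orbit x).out := by
  obtain ⟨k, h⟩ := Equiv.Perm.SameCycle.exists_nat_pow_eq (f := D.F)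
    (Equiv.Perm.SameCycle.symm (Quotient.exact (Quotient.out_eq (D.orbit x))))
  exact ⟨k, h⟩

/-- Stability of a set of points under the automorphism and its inverse. -/
def Stable (Y : Set X) : Prop := ∀ x, D.F x ∈ Y ↔ x ∈ Y

variable {D} in
theorem Stable.pow {Y : Set X} (hY : D.Stable Y) (k : ℕ) (x : X) : (D.F ^ k) x ∈ Y ↔ x ∈ Y := by
  induction k with
  | zero => simp
  | succ k ih => rw [pow_succ']; exact (hY _).trans ih

variable {D} in
theorem Stable.out_mem [Finite X] {Y : Set X} (hY : D.Stable Y) (x : X) :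
    (D.orbit x).out ∈ Y ↔ x ∈ Y := by
  obtain ⟨k, hk⟩ := D.exists_pow_out x
  conv_rhs => rw [← hk]
  exact (hY.pow k _).symm

/-- The set of orbits in `Y`. -/
abbrev OrbitIn (Y : Set X) : Type _ := {O : D.Orbit // O.out ∈ Y}

open Classical in
instance [Fintype X] : Fintype D.Orbit :=
  Fintype.ofSurjective D.orbit Quotient.mk_surjective

open Classical in
instance [Fintype X] (Y : Set X) : Fintype (D.OrbitIn Y) := inferInstance

open Classical in
instance (Y : Set X) : DecidableEq (D.OrbitIn Y) := Classical.decEq _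

section matrix

variable [Fintype X]

open Classical in
/-- The sum of the entries of a row of `B` in an orbit. -/
def rowSum (x : X) (O : D.Orbit) : ℤ := ∑ y with D.orbit y = O, D.B x y

theorem rowSum_F (x : X) (O : D.Orbit) : D.rowSum (D.F x) O = D.rowSum x O := by
  classical
  unfold rowSum
  rw [Finset.sum_filter, Finset.sum_filter, ← Equiv.sum_comp D.F]
  refine Finset.sum_congr rfl fun y _ => ?_
  rw [D.orbit_F, D.B_F]

theorem rowSum_out (x : X) (O : D.Orbit) : D.rowSum (D.orbit x).out O = D.rowSum x O := by
  obtain ⟨k, hk⟩ := D.exists_pow_out x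
  conv_rhs => rw [← hk]
  clear hk
  induction k with
  | zero => simp
  | succ k ih => rw [ih, pow_succ']; exact (D.rowSum_F _ _).symm

/-- The matrix of `B` on invariant functions on `Y`. -/
def quot (Y : Set X) : Matrix (D.OrbitIn Y) (D.OrbitIn Y) ℤ := fun O O' => D.rowSum O.1.out O'.1

theorem sum_B_smul {M : Type*} [AddCommGroup M] (x : X) (u : D.Orbit → M) :
    ∑ y, D.B x y • u (D.orbit y) = ∑ O, D.rowSum x O • u O := by
  classical
  rw [← Finset.sum_fiberwise Finset.univ D.orbit]
  refine Finset.sum_congr rfl fun O _ => ?_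
  rw [rowSum, Finset.sum_smul]
  refine Finset.sum_congr rfl fun y hy => ?_
  rw [(Finset.mem_filter.1 hy).2]

end matrix

section twist

variable {R : Type*} [CommRing R] {M : Type*} [AddCommGroup M] [Module R M]

variable (R) in
/-- The sign as a unit of `R`. -/
def unitSign : ℤˣ →* Rˣ := Units.map (Int.castRingHom R).toMonoidHom

/-- A locally constant unit-valued function on `Z` transforming by `ζ` and the sign. -/
structure IsTwist (Z : Set X) (ζ : Rˣ) (χ : X → Rˣ) : Prop where
  stable : D.Stable Z
  map_F : ∀ x ∈ Z, χ (D.F x) = ζ * unitSign R (D.s x) * χ x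
  loc : ∀ x ∈ Z, ∀ y ∈ Z, D.B x y ≠ 0 → χ x = χ y

/-- The hypothesis says that the orbit products of `ζ s` are trivial, which is the only obstruction
to solving for `χ` on a forest. -/
theorem exists_isTwist [Finite X] (Z : Set X) (hZ : D.Stable Z) (ζ : Rˣ)
    (h1 : ∀ x ∈ Z, ∀ k, (D.F ^ k) x = x → ζ ^ k * unitSign R (D.sgn k x) = 1) :
    ∃ χ, D.IsTwist Z ζ χ := by
  obtain ⟨χ, h2, h3⟩ := D.isAcyclic.exists_locally_constant D.F D.F_adj D.no_inversion Z
    (fun x hx => (hZ x).2 hx) (fun x => ζ * unitSign R (D.s x))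
    (fun x _ y _ h => by rw [D.s_adj x y h]) (fun x hx k hk => by
      rw [orbitProd_mul, orbitProd_const, ← map_orbitProd]
      exact h1 x hx k hk)
  refine ⟨χ, hZ, h2, fun x hx y hy h => ?_⟩
  rcases D.B_adj x y h with rfl | h
  · rfl
  · exact h3 x hx y hy h

open Classical in
/-- The function on `X` supported on `Z` given by a function on the orbits in `Z` and a twist. -/
def twist (Z : Set X) (χ : X → Rˣ) : (D.OrbitIn Z → M) →ₗ[R] (X → M) where
  toFun u x := if h : (D.orbit x).out ∈ Z then (χ x : R) • u ⟨D.orbit x, h⟩ else 0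
  map_add' a b := funext fun x => by
    simp only [Pi.add_apply]
    split_ifs <;> simp
  map_smul' r a := funext fun x => by
    simp only [Pi.smul_apply, RingHom.id_apply]
    split_ifs
    · rw [smul_comm]
    · simp

variable {D} {Z : Set X} {ζ : Rˣ} {χ : X → Rˣ}

theorem twist_apply (u : D.OrbitIn Z → M) {x : X} (h : (D.orbit x).out ∈ Z) :
    D.twist Z χ u x = (χ x : R) • u ⟨D.orbit x, h⟩ := dif_pos h

theorem IsTwist.pow (hχ : D.IsTwist Z ζ χ) (k : ℕ) {x : X} (hx : x ∈ Z) :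
    χ ((D.F ^ k) x) = ζ ^ k * unitSign R (D.sgn k x) * χ x := by
  induction k with
  | zero => simp [sgn]
  | succ k ih =>
    rw [pow_succ', Equiv.Perm.mul_apply, hχ.map_F _ ((hχ.stable.pow k x).2 hx), ih,
      sgn_succ, map_mul, pow_succ]
    ac_rfl

theorem twist_out (u : D.OrbitIn Z → M) (O : D.OrbitIn Z) :
    D.twist Z χ u O.1.out = (χ O.1.out : R) • u O := by
  have h : D.orbit O.1.out = O.1 := Quotient.out_eq O.1
  have h' : (D.orbit O.1.out).out ∈ Z := by rw [h]; exact O.2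
  rw [twist_apply u h']
  congr 2
  exact Subtype.ext h

theorem twist_injective : Function.Injective (D.twist (M := M) Z χ) := by
  intro u u' h
  funext O
  have := congrFun h O.1.out
  rw [twist_out, twist_out, ← Units.smul_def, ← Units.smul_def] at this
  exact smul_left_cancel _ this

theorem twist_eq_zero [Finite X] (hZ : D.Stable Z) (u : D.OrbitIn Z → M) {x : X} (hx : x ∉ Z) :
    D.twist Z χ u x = 0 :=
  dif_neg fun h => hx ((hZ.out_mem x).1 h)

theorem IsTwist.twist_F [Finite X] (hχ : D.IsTwist Z ζ χ) (u : D.OrbitIn Z → M) (x : X) :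
    D.twist Z χ u (D.F x) = ((ζ * unitSign R (D.s x) : Rˣ) : R) • D.twist Z χ u x := by
  by_cases hx : x ∈ Z
  · have h1 : (D.orbit x).out ∈ Z := (hχ.stable.out_mem x).2 hx
    have h2 : (D.orbit (D.F x)).out ∈ Z := by rwa [D.orbit_F]
    rw [twist_apply u h1, twist_apply u h2, hχ.map_F x hx, Units.val_mul _ (χ x), mul_smul]
    congr 3
    exact Subtype.ext (D.orbit_F x)
  · rw [twist_eq_zero hχ.stable u hx, twist_eq_zero hχ.stable u (fun h => hx ((hχ.stable x).1 h)),
      smul_zero]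

theorem map_F_pow {h : X → M}
    (hF : ∀ x, h (D.F x) = ((ζ * unitSign R (D.s x) : Rˣ) : R) • h x) (k : ℕ) (x : X) :
    h ((D.F ^ k) x) = ((ζ ^ k * unitSign R (D.sgn k x) : Rˣ) : R) • h x := by
  induction k with
  | zero => simp [sgn]
  | succ k ih =>
    rw [pow_succ', Equiv.Perm.mul_apply, hF, ih, smul_smul, ← Units.val_mul]
    congr 2
    rw [sgn_succ, map_mul, pow_succ]
    ac_rfl

/-- The quotient `h / χ` is `F`-invariant on `Z`, hence a function on orbits. -/
theorem IsTwist.exists_twist_eq [Finite X] (hχ : D.IsTwist Z ζ χ) {h : X → M}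
    (hF : ∀ x, h (D.F x) = ((ζ * unitSign R (D.s x) : Rˣ) : R) • h x)
    (hs : ∀ x ∉ Z, h x = 0) : ∃ u, D.twist Z χ u = h := by
  refine ⟨fun O => (((χ O.1.out)⁻¹ : Rˣ) : R) • h O.1.out, funext fun x => ?_⟩
  by_cases hx : x ∈ Z
  · have h1 : (D.orbit x).out ∈ Z := (hχ.stable.out_mem x).2 hx
    rw [twist_apply _ h1]
    obtain ⟨k, hk⟩ := D.exists_pow_out x
    conv_rhs => rw [← hk]
    nth_rw 1 [← hk]
    rw [map_F_pow hF, hχ.pow k h1, smul_smul, ← Units.val_mul]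
    simp
  · rw [twist_eq_zero hχ.stable _ hx, hs x hx]

/-- On the support of a row of `B` in `Z` the function `χ` is constant and factors out, leaving row
sums over orbits. This is why the induced matrix is integral and independent of `ζ`, apart from the
set `Z`. -/
theorem sum_B_twist [Fintype X] (hZ : D.Stable Z)
    (hχ : ∀ x ∈ Z, ∀ y ∈ Z, D.B x y ≠ 0 → χ x = χ y) (u : D.OrbitIn Z → M) {x : X} (hx : x ∈ Z) :
    ∑ y, D.B x y • D.twist Z χ u y = D.twist Z χ ((D.quot Z).intMulVec R M u) x := by
  classical
  have h1 : (D.orbit x).out ∈ Z := (hZ.out_mem x).2 hx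
  let v : D.Orbit → M := fun O => if h : O.out ∈ Z then u ⟨O, h⟩ else 0
  have hv : ∀ y, D.B x y • D.twist Z χ u y = (χ x : R) • (D.B x y • v (D.orbit y)) := by
    intro y
    by_cases hB : D.B x y = 0
    · simp [hB]
    by_cases hy : y ∈ Z
    · have h2 : (D.orbit y).out ∈ Z := (hZ.out_mem y).2 hy
      have e1 : D.twist Z χ u y = (χ y : R) • u ⟨D.orbit y, h2⟩ := twist_apply u h2
      have e2 : v (D.orbit y) = u ⟨D.orbit y, h2⟩ := dif_pos h2
      rw [e1, e2, hχ x hx y hy hB, smul_comm]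
    · have h2 : (D.orbit y).out ∉ Z := fun h => hy ((hZ.out_mem y).1 h)
      have e2 : v (D.orbit y) = 0 := dif_neg h2
      rw [twist_eq_zero hZ u hy, e2]
      simp
  rw [Finset.sum_congr rfl fun y _ => hv y, ← Finset.smul_sum, D.sum_B_smul]
  rw [twist_apply _ h1]
  congr 1
  rw [Matrix.intMulVec_apply]
  symm
  have e3 : ∀ O : D.OrbitIn Z, D.quot Z ⟨D.orbit x, h1⟩ O • u O = D.rowSum x O.1 • v O.1 := by
    intro O
    rw [quot, D.rowSum_out]
    have e4 : v O.1 = u O := dif_pos O.2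
    rw [e4]
  rw [Finset.sum_congr rfl fun O _ => e3 O,
    ← Finset.sum_subtype (Finset.univ.filter fun O : D.Orbit => O.out ∈ Z) (by simp)
      (fun O => D.rowSum x O • v O), Finset.sum_filter]
  refine Finset.sum_congr rfl fun O _ => ?_
  split_ifs with h
  · rfl
  · have e4 : v O = 0 := dif_neg h
    rw [e4, smul_zero]

theorem IsTwist.sum_B_twist [Fintype X] (hχ : D.IsTwist Z ζ χ) (u : D.OrbitIn Z → M) {x : X}
    (hx : x ∈ Z) :
    ∑ y, D.B x y • D.twist Z χ u y = D.twist Z χ ((D.quot Z).intMulVec R M u) x :=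
  SignedForest.sum_B_twist hχ.stable hχ.loc u hx

end twist

end SignedForest

/-! ### Eigenfunctions of a signed automorphism -/

namespace SignedForest

variable {X : Type*} (D : SignedForest X)

theorem sgn_F (k : ℕ) (x : X) : D.s x * D.sgn k (D.F x) = D.sgn k x * D.s ((D.F ^ k) x) := by
  rw [← sgn_succ, add_comm, sgn, sgn, orbitProd_add, orbitProd_one]
  rfl

theorem sgn_of_fixed_F {k : ℕ} {x : X} (h : (D.F ^ k) x = x) : D.sgn k (D.F x) = D.sgn k x := by
  have := D.sgn_F k x
  rw [h, mul_comm] at this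
  exact mul_right_cancel this

theorem F_pow_F_iff (k : ℕ) (x : X) : (D.F ^ k) (D.F x) = D.F x ↔ (D.F ^ k) x = x := by
  rw [← Equiv.Perm.mul_apply, ← pow_succ, pow_succ', Equiv.Perm.mul_apply,
    D.F.injective.eq_iff]

section ring

variable {R : Type*} [CommRing R] {M : Type*} [AddCommGroup M] [Module R M]

/-- The points of `Y` at which an eigenfunction of eigenvalue `ζ` may take the value `1`. -/
def eigenSet (Y : Set X) (ζ : Rˣ) : Set X :=
  {x | x ∈ Y ∧ ∀ k, (D.F ^ k) x = x → ζ ^ k * unitSign R (D.sgn k x) = 1}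

variable {D} in
theorem Stable.eigenSet {Y : Set X} (hY : D.Stable Y) (ζ : Rˣ) : D.Stable (D.eigenSet Y ζ) := by
  intro x
  refine and_congr (hY x) (forall_congr' fun k => ?_)
  rw [D.F_pow_F_iff]
  refine forall_congr' fun h => ?_
  rw [D.sgn_of_fixed_F h]

theorem exists_isTwist_eigenSet [Finite X] {Y : Set X} (hY : D.Stable Y) (ζ : Rˣ) :
    ∃ χ, D.IsTwist (D.eigenSet Y ζ) ζ χ :=
  D.exists_isTwist _ (hY.eigenSet ζ) ζ fun _ hx => hx.2

theorem sum_B_F [Fintype X] {ζ : Rˣ} {h : X → M}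
    (hF : ∀ x, h (D.F x) = ((ζ * unitSign R (D.s x) : Rˣ) : R) • h x) (x : X) :
    ∑ y, D.B (D.F x) y • h y = ((ζ * unitSign R (D.s x) : Rˣ) : R) • ∑ y, D.B x y • h y := by
  rw [← Equiv.sum_comp D.F, Finset.smul_sum]
  refine Finset.sum_congr rfl fun y _ => ?_
  rw [D.B_F, hF, smul_comm]
  by_cases hB : D.B x y = 0
  · simp [hB]
  · have : D.s x = D.s y := by simpa [sgn] using D.sgn_B 1 x y hB
    rw [this]

end ring

section field

variable {K : Type*} [Field K] {D} {Y : Set X} {ζ : Kˣ}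

/-- Going around the orbit multiplies `h x` by a scalar different from `1`, while returning to `x`.
-/
theorem eq_zero_of_notMem_eigenSet {h : X → K}
    (hF : ∀ x, h (D.F x) = ((ζ * unitSign K (D.s x) : Kˣ) : K) • h x) {x : X} (hx : x ∈ Y)
    (hx' : x ∉ D.eigenSet Y ζ) : h x = 0 := by
  simp only [eigenSet, Set.mem_ofPred_eq, not_and, not_forall] at hx'
  obtain ⟨k, hk, hne⟩ := hx' hx
  have h1 := map_F_pow hF k x
  rw [hk] at h1
  by_contra h0
  refine hne (Units.ext ?_)
  rw [smul_eq_mul] at h1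
  exact mul_right_cancel₀ h0 (by rw [Units.val_one, one_mul]; exact h1.symm)

/-- Outside the eigenset the left side vanishes too: `B` commutes with the signed action, so it
produces another eigenfunction. -/
theorem sum_B_twist_eigenSet [Fintype X] {χ : X → Kˣ}
    (hχ : D.IsTwist (D.eigenSet Y ζ) ζ χ) (u : D.OrbitIn (D.eigenSet Y ζ) → K) {x : X}
    (hx : x ∈ Y) :
    ∑ y, D.B x y • D.twist _ χ u y = D.twist _ χ ((D.quot _).intMulVec K K u) x := by
  by_cases hx' : x ∈ D.eigenSet Y ζ
  · exact hχ.sum_B_twist u hx'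
  · rw [twist_eq_zero hχ.stable _ hx']
    exact eq_zero_of_notMem_eigenSet (h := fun x => ∑ y, D.B x y • D.twist _ χ u y)
      (fun x => D.sum_B_F (hχ.twist_F u) x) hx hx'

/-- The power sums of the `n`-th roots of unity. -/
theorem sum_pow_root {n : ℕ} {ω : Kˣ} (hω : IsPrimitiveRoot ω n) (k : ℕ) :
    ∑ t : Fin n, ((ω ^ (t : ℕ) : Kˣ) : K)⁻¹ ^ k = if n ∣ k then (n : K) else 0 := by
  have e : ∀ t : Fin n, ((ω ^ (t : ℕ) : Kˣ) : K)⁻¹ ^ k = ((ω : K)⁻¹ ^ k) ^ (t : ℕ) := by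
    intro t
    rw [Units.val_pow_eq_pow_val, inv_pow, inv_pow, inv_pow, ← pow_mul, ← pow_mul, mul_comm]
  rw [Finset.sum_congr rfl fun t _ => e t, Fin.sum_univ_eq_sum_range (fun t => ((ω : K)⁻¹ ^ k) ^ t)]
  have hω' : IsPrimitiveRoot (ω : K)⁻¹ n := (IsPrimitiveRoot.coe_units_iff.2 hω).inv
  split_ifs with h
  · rw [(hω'.pow_eq_one_iff_dvd k).2 h]
    simp
  · have h1 : (ω : K)⁻¹ ^ k ≠ 1 := fun h' => h ((hω'.pow_eq_one_iff_dvd k).1 h')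
    have h2 := mul_geom_sum ((ω : K)⁻¹ ^ k) n
    rw [← pow_mul, mul_comm k n, pow_mul, hω'.pow_eq_one, one_pow, sub_self] at h2
    exact (mul_eq_zero.1 h2).resolve_left (sub_ne_zero.2 h1)

end field

/-- The functions on `Y` invariant under the `r n`-th power of a signed automorphism decompose into
eigenfunctions for the `n`-th roots of unity, if `Y` is fibred equivariantly over `ℤ/r` for `r`
prime to `n`. -/
theorem exists_eigen_equiv [Fintype X] {K : Type*} [Field K] {r n : ℕ} [NeZero r] [NeZero n]
    (hn : (n : K) ≠ 0)
    (hrn : r.Coprime n) {ω : Kˣ} (hω : IsPrimitiveRoot ω n) {Y : Set X} (hY : D.Stable Y)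
    (θ : X → ZMod r) (hθF : ∀ x ∈ Y, θ (D.F x) = θ x + 1)
    (hθ : ∀ x ∈ Y, ∀ y ∈ Y, D.B x y ≠ 0 → θ x = θ y) :
    ∃ e : ((D.pow (r * n)).OrbitIn ((D.pow (r * n)).eigenSet Y (1 : Kˣ)) → K) ≃ₗ[K]
        ((i : ZMod r × Fin n) → D.OrbitIn (D.eigenSet Y (ω ^ (i.2 : ℕ))) → K),
      ∀ u i, e (((D.pow (r * n)).quot _).intMulVec K K u) i
        = (D.quot _).intMulVec K K (e u i) := by
  classical
  set f := r * n with hf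
  have hYf : (D.pow f).Stable Y := fun x => hY.pow f x
  obtain ⟨χf, hχf⟩ := (D.pow f).exists_isTwist_eigenSet hYf (1 : Kˣ)
  have hχ : ∀ t : Fin n, ∃ χ, D.IsTwist (D.eigenSet Y (ω ^ (t : ℕ))) (ω ^ (t : ℕ)) χ :=
    fun t => D.exists_isTwist_eigenSet hY _
  choose χ hχ using hχ
  have hθk : ∀ (k : ℕ), ∀ x ∈ Y, θ ((D.F ^ k) x) = θ x + k := by
    intro k x hx
    induction k with
    | zero => simp
    | succ k ih =>
      rw [pow_succ', Equiv.Perm.mul_apply, hθF _ ((hY.pow k x).2 hx), ih]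
      push_cast
      ring
  let T := (D.pow f).twist (M := K) ((D.pow f).eigenSet Y (1 : Kˣ)) χf
  let t' := fun t : Fin n => D.twist (M := K) (D.eigenSet Y (ω ^ (t : ℕ))) (χ t)
  have ht0 : ∀ t u x, x ∉ Y → t' t u x = 0 := fun t u x hx =>
    twist_eq_zero (hχ t).stable u fun h => hx h.1
  have hT0 : ∀ u x, x ∉ Y → T u x = 0 := fun u x hx =>
    twist_eq_zero hχf.stable u fun h => hx h.1
  have htF : ∀ t u k x, t' t u ((D.F ^ k) x)
      = ((ω ^ (t : ℕ) : Kˣ) : K) ^ k * (unitSign K (D.sgn k x) : K) * t' t u x := by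
    intro t u k x
    refine (map_F_pow ((hχ t).twist_F u) k x).trans ?_
    rw [Units.val_mul, Units.val_pow_eq_pow_val _ k, smul_eq_mul]
  -- Gluing: for each `j : ZMod r` an independent family of eigenfunctions is used on the fibre `θ =
  -- j`. The part `r` of the exponent is thus handled without `r`-th roots of unity, which matters
  -- in characteristic dividing `r`.
  let S : ((i : ZMod r × Fin n) → D.OrbitIn (D.eigenSet Y (ω ^ (i.2 : ℕ))) → K) →ₗ[K] (X → K) :=
    { toFun := fun w x => ∑ t, t' t (w (θ x, t)) x
      map_add' := fun a b => funext fun x => by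
        simp only [Pi.add_apply, map_add, Finset.sum_add_distrib]
      map_smul' := fun c a => funext fun x => by
        simp only [Pi.smul_apply, map_smul, RingHom.id_apply, Finset.smul_sum] }
  have hS : ∀ w x, S w x = ∑ t, t' t (w (θ x, t)) x := fun _ _ => rfl
  have hS0 : ∀ w x, x ∉ Y → S w x = 0 := fun w x hx => by
    rw [hS]
    exact Finset.sum_eq_zero fun t _ => ht0 t _ x hx
  have hωf : ∀ t : Fin n, ((ω ^ (t : ℕ) : Kˣ) : K) ^ f = 1 := by
    intro t
    rw [← Units.val_pow_eq_pow_val, ← pow_mul, hf,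
      show (t : ℕ) * (r * n) = n * (t * r) by ring, pow_mul, hω.pow_eq_one, one_pow, Units.val_one]
  have hSinj : Function.Injective S := by
    rw [← LinearMap.ker_eq_bot, LinearMap.ker_eq_bot']
    intro w hw
    funext i O
    obtain ⟨j, t₀⟩ := i
    let x := (D.F ^ (j - θ O.1.out).val) O.1.out
    have hxY : x ∈ Y := (hY.pow _ _).2 O.2.1
    have hxθ : θ x = j := by
      rw [hθk _ _ O.2.1, ZMod.natCast_zmod_val]
      ring
    -- The iterates `F ^ (r k)` stay in the fibre and scale the summands by powers of `(ω ^ r) ^ t`.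
    -- These are distinct since `r` is prime to `n`, so a Vandermonde argument separates the
    -- summands.
    have hvan : (fun t => t' t (w (j, t)) x) = 0 := by
      refine Matrix.eq_zero_of_forall_pow_sum_mul_pow_eq_zero
        (f := fun t : Fin n => ((ω : K) ^ r) ^ (t : ℕ)) ?_ fun k => ?_
      · intro a b hab
        have hp : IsPrimitiveRoot ((ω : K) ^ r) n :=
          (IsPrimitiveRoot.coe_units_iff.2 hω).pow_of_coprime r hrn
        exact Fin.ext (hp.pow_inj a.2 b.2 hab)
      · have h1 : S w ((D.F ^ (r * (k : ℕ))) x) = 0 := congrFun hw _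
        rw [hS, hθk _ _ hxY, hxθ] at h1
        have h2 : ((r * (k : ℕ) : ℕ) : ZMod r) = 0 := by simp
        rw [h2, add_zero] at h1
        have h3 : (unitSign K (D.sgn (r * (k : ℕ)) x) : K)
            * ∑ t, t' t (w (j, t)) x * (((ω : K) ^ r) ^ (t : ℕ)) ^ (k : ℕ) = 0 := by
          rw [← h1, Finset.mul_sum]
          refine Finset.sum_congr rfl fun t _ => ?_
          rw [htF t _ (r * k) x, Units.val_pow_eq_pow_val, ← pow_mul, ← pow_mul, ← pow_mul,
            show (t : ℕ) * (r * (k : ℕ)) = r * (t * k) by ring]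
          ring
        exact (mul_eq_zero.1 h3).resolve_left (Units.ne_zero _)
    have h4 : t' t₀ (w (j, t₀)) x = 0 := congrFun hvan t₀
    rw [htF] at h4
    have h5 := (mul_eq_zero.1 h4).resolve_left
      (mul_ne_zero (pow_ne_zero _ (Units.ne_zero _)) (Units.ne_zero _))
    change D.twist _ (χ t₀) _ O.1.out = 0 at h5
    rw [twist_out, smul_eq_mul] at h5
    exact (mul_eq_zero.1 h5).resolve_left (Units.ne_zero _)
  have hTinj : Function.Injective T := twist_injective
  have hrange : LinearMap.range T = LinearMap.range S := by
    apply le_antisymm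
    · rintro _ ⟨u, rfl⟩
      set h := T u with hh
      have hhF : ∀ x, h ((D.F ^ f) x) = (unitSign K (D.sgn f x) : K) * h x := fun x => by
        refine (hχf.twist_F u x).trans ?_
        rw [one_mul]
        rfl
      let E : ZMod r → Fin n → ℕ → X → K := fun j t k x =>
        if θ x + k = j then ((ω ^ (t : ℕ) : Kˣ) : K)⁻¹ ^ k * (unitSign K (D.sgn k x) : K)
          * h ((D.F ^ k) x) else 0
      have hE1 : ∀ j t k, ∀ x ∈ Y, E j t k (D.F x)
          = ((ω ^ (t : ℕ) * unitSign K (D.s x) : Kˣ) : K) * E j t (k + 1) x := by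
        intro j t k x hx
        simp only [E, hθF x hx]
        rw [show θ x + 1 + (k : ZMod r) = θ x + ((k + 1 : ℕ) : ZMod r) by push_cast; ring]
        split_ifs
        · have h1 : unitSign K (D.s x) * unitSign K (D.sgn (k + 1) x)
              = unitSign K (D.sgn k (D.F x)) := by
            rw [← map_mul]
            congr 1
            have h2 : D.sgn (k + 1) x = D.s x * D.sgn k (D.F x) := by rw [sgn_succ, sgn_F]
            rw [h2, ← mul_assoc, Int.units_mul_self, one_mul]
          rw [← h1, pow_succ _ k, ← Equiv.Perm.mul_apply (D.F ^ k), ← pow_succ D.F k]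
          push_cast
          have h3 : (ω : K) ^ (t : ℕ) ≠ 0 := pow_ne_zero _ (Units.ne_zero _)
          field_simp
        · rw [mul_zero]
      have hE2 : ∀ j t x, E j t f x = E j t 0 x := by
        intro j t x
        simp only [E]
        have h2 : ((f : ℕ) : ZMod r) = 0 := by simp [hf]
        rw [h2, Nat.cast_zero, inv_pow, hωf, hhF]
        congr 1
        rw [inv_one, one_mul, ← mul_assoc, ← Units.val_mul, ← map_mul, Int.units_mul_self]
        simp [sgn]
      have hE0 : ∀ j t k, ∀ x ∉ Y, E j t k x = 0 := by
        intro j t k x hx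
        simp only [E]
        rw [hh, hT0 u _ (fun h' => hx ((hY.pow k x).1 h')), mul_zero, ite_self]
      -- Averaging over `k < r n` projects onto the eigenvalue `ω ^ t`, starting from the
      -- restriction of `h` to the fibre `j`.
      let H : ZMod r → Fin n → X → K := fun j t x => (n : K)⁻¹ * ∑ k ∈ Finset.range f, E j t k x
      have hH0 : ∀ j t, ∀ x ∉ Y, H j t x = 0 := fun j t x hx => by
        simp only [H]
        rw [Finset.sum_eq_zero fun k _ => hE0 j t k x hx, mul_zero]
      have hHF : ∀ j t x, H j t (D.F x)
          = ((ω ^ (t : ℕ) * unitSign K (D.s x) : Kˣ) : K) • H j t x := by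
        intro j t x
        by_cases hx : x ∈ Y
        · simp only [H]
          rw [Finset.sum_congr rfl fun k _ => hE1 j t k x hx, ← Finset.mul_sum, smul_eq_mul,
            mul_left_comm]
          congr 2
          have h1 := Finset.sum_range_succ (fun k => E j t k x) f
          rw [Finset.sum_range_succ', hE2 j t x] at h1
          exact add_right_cancel h1
        · rw [hH0 j t x hx, hH0 j t _ (fun h' => hx ((hY x).1 h')), smul_zero]
      have hex : ∀ i : ZMod r × Fin n, ∃ v, t' i.2 v = H i.1 i.2 := fun i =>
        (hχ i.2).exists_twist_eq (hHF i.1 i.2) fun x hx => by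
          by_cases hxY : x ∈ Y
          · exact eq_zero_of_notMem_eigenSet (hHF i.1 i.2) hxY hx
          · exact hH0 _ _ x hxY
      choose w hw using hex
      refine ⟨w, funext fun x => ?_⟩
      rw [hS, Finset.sum_congr rfl fun t _ => congrFun (hw (θ x, t)) x]
      simp only [H]
      rw [← Finset.mul_sum, Finset.sum_comm]
      have hfpos : 0 < f := Nat.mul_pos (NeZero.pos r) (NeZero.pos n)
      -- Summing over `t` kills all `k` not divisible by `n`, and the fibre condition kills all `k`
      -- not divisible by `r`. By coprimality only `k = 0` survives below `r n`.
      rw [Finset.sum_eq_single_of_mem 0 (Finset.mem_range.2 hfpos)]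
      · simp only [E]
        have : ∀ k : Fin n, (if θ x + ((0 : ℕ) : ZMod r) = θ x then
            ((ω ^ (k : ℕ) : Kˣ) : K)⁻¹ ^ 0 * (unitSign K (D.sgn 0 x) : K) * h ((D.F ^ 0) x)
            else 0) = h x := by
          intro k
          simp [sgn]
        rw [Finset.sum_congr rfl fun t _ => this t]
        simp only [Finset.sum_const, Finset.card_univ, Fintype.card_fin, nsmul_eq_mul]
        rw [inv_mul_cancel_left₀ hn]
      · intro k hk hk0
        have h1 : ∀ t : Fin n, E (θ x) t k x = ((ω ^ (t : ℕ) : Kˣ) : K)⁻¹ ^ k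
            * (if θ x + (k : ZMod r) = θ x then (unitSign K (D.sgn k x) : K) * h ((D.F ^ k) x)
              else 0) := by
          intro t
          simp only [E]
          split_ifs
          · ring
          · rw [mul_zero]
        rw [Finset.sum_congr rfl fun t _ => h1 t, ← Finset.sum_mul, sum_pow_root hω]
        split_ifs with h2 h3
        · have h4 : r ∣ k := (ZMod.natCast_eq_zero_iff k r).1 (add_eq_left.1 h3)
          exact absurd (Nat.le_of_dvd (Nat.pos_of_ne_zero hk0)
            (hrn.mul_dvd_of_dvd_of_dvd h4 h2)) (not_le.2 (Finset.mem_range.1 hk))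
        · rw [mul_zero]
        · rw [zero_mul]
        · rw [zero_mul]
    · rintro _ ⟨w, rfl⟩
      have hSF : ∀ x, S w ((D.pow f).F x)
          = (((1 : Kˣ) * unitSign K ((D.pow f).s x) : Kˣ) : K) • S w x := by
        intro x
        by_cases hx : x ∈ Y
        · change S w ((D.F ^ f) x) = (((1 : Kˣ) * unitSign K (D.sgn f x) : Kˣ) : K) • _
          rw [hS, hS, hθk _ _ hx, one_mul, smul_eq_mul, Finset.mul_sum]
          have h2 : ((f : ℕ) : ZMod r) = 0 := by simp [hf]
          refine Finset.sum_congr rfl fun t _ => ?_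
          rw [h2, add_zero, htF, hωf, one_mul]
        · rw [hS0 w x hx, hS0 w _ (fun h => hx ((hYf x).1 h)), smul_zero]
      obtain ⟨u, hu⟩ := hχf.exists_twist_eq hSF (fun x hx => by
        by_cases hxY : x ∈ Y
        · exact eq_zero_of_notMem_eigenSet hSF hxY hx
        · exact hS0 w x hxY)
      exact ⟨u, hu⟩
  let e := (LinearEquiv.ofInjective T hTinj).trans
    ((LinearEquiv.ofEq _ _ hrange).trans (LinearEquiv.ofInjective S hSinj).symm)
  have he : ∀ u, S (e u) = T u := by
    intro u
    have := LinearEquiv.apply_symm_apply (LinearEquiv.ofInjective S hSinj)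
      (LinearEquiv.ofEq _ _ hrange (LinearEquiv.ofInjective T hTinj u))
    exact congrArg Subtype.val this
  refine ⟨e, fun u => congrFun (hSinj (funext fun x => ?_) : _ = fun i => _)⟩
  by_cases hx : x ∈ Y
  · rw [he]
    have h1 := sum_B_twist_eigenSet hχf u hx
    refine h1.symm.trans ?_
    change ∑ y, D.B x y • T u y = _
    rw [hS, ← he]
    -- `B` does not mix the fibres of `θ`, so the family at `θ y` may be replaced by the one at `θ
    -- x`.
    have h2 : ∀ y, D.B x y • S (e u) y = ∑ t, D.B x y • t' t (e u (θ x, t)) y := by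
      intro y
      by_cases hB : D.B x y = 0
      · simp [hB]
      by_cases hy : y ∈ Y
      · rw [hS, hθ x hx y hy hB, Finset.smul_sum]
      · rw [hS0 _ y hy, Finset.sum_eq_zero fun t _ => by rw [ht0 t _ y hy, smul_zero], smul_zero]
    rw [Finset.sum_congr rfl fun y _ => h2 y, Finset.sum_comm]
    exact Finset.sum_congr rfl fun t _ => sum_B_twist_eigenSet (hχ t) _ hx
  · rw [hS0 _ x hx, hS0 _ x hx]

end SignedForest

/-! ### Cokernels of integral matrices and `ℚ/ℤ` -/

section lattice

variable {n : Type*} [Fintype n]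

theorem Matrix.intMulVec_mul {m l : Type*} [Fintype m] (A : Matrix l m ℤ) (B : Matrix m n ℤ)
    (R M : Type*) [CommRing R] [AddCommGroup M] [Module R M] (h : n → M) :
    (A * B).intMulVec R M h = A.intMulVec R M (B.intMulVec R M h) := by
  funext i
  simp only [intMulVec_apply, Matrix.mul_apply, Finset.sum_smul, Finset.smul_sum, smul_smul]
  exact Finset.sum_comm

theorem Matrix.intMulVec_smul_one [DecidableEq n] (d : ℤ) (R M : Type*) [CommRing R]
    [AddCommGroup M] [Module R M] (h : n → M) :
    (d • (1 : Matrix n n ℤ)).intMulVec R M h = d • h := by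
  funext i
  rw [intMulVec_apply, Finset.sum_eq_single i]
  · simp
  · intro j _ hj
    simp [Matrix.one_apply_ne' hj]
  · simp

theorem Matrix.exists_intMulVec_rat [DecidableEq n] (A : Matrix n n ℤ) (hA : A.det ≠ 0)
    (m : n → ℚ) : ∃ q, A.intMulVec ℚ ℚ q = m := by
  refine ⟨A.adjugate.intMulVec ℚ ℚ ((A.det : ℚ)⁻¹ • m), ?_⟩
  rw [← Matrix.intMulVec_mul, Matrix.mul_adjugate, Matrix.intMulVec_smul_one]
  funext i
  simp only [Pi.smul_apply, smul_eq_mul, zsmul_eq_mul]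
  rw [mul_inv_cancel_left₀ (Int.cast_ne_zero.2 hA)]

theorem Matrix.intMulVec_injective [DecidableEq n] (A : Matrix n n ℤ) (hA : A.det ≠ 0)
    (R M : Type*) [CommRing R] [AddCommGroup M] [Module R M] [IsAddTorsionFree M] :
    Function.Injective (A.intMulVec R M) := by
  rw [← LinearMap.ker_eq_bot, LinearMap.ker_eq_bot']
  intro h hh
  have h1 := congrArg (A.adjugate.intMulVec R M) hh
  rw [← Matrix.intMulVec_mul, Matrix.adjugate_mul, Matrix.intMulVec_smul_one, map_zero] at h1
  exact (smul_eq_zero.1 h1).resolve_left hA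

/-- `ℚ/ℤ` is divisible, so one may divide by the determinant and apply the adjugate. -/
theorem Matrix.intMulVec_surjective [DecidableEq n] (A : Matrix n n ℤ) (hA : A.det ≠ 0) :
    Function.Surjective (A.intMulVec ℤ (AddCircle (1 : ℚ))) := by
  intro t
  have hdiv : ∀ a : AddCircle (1 : ℚ), ∃ b, A.det • b = a := by
    intro a
    induction a using QuotientAddGroup.induction_on with
    | H q =>
      refine ⟨((A.det : ℚ)⁻¹ * q : ℚ), ?_⟩
      rw [← AddCircle.coe_zsmul, zsmul_eq_mul, mul_inv_cancel_left₀ (Int.cast_ne_zero.2 hA)]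
  choose b hb using hdiv
  refine ⟨A.adjugate.intMulVec ℤ _ fun i => b (t i), ?_⟩
  rw [← Matrix.intMulVec_mul, Matrix.mul_adjugate, Matrix.intMulVec_smul_one]
  exact funext fun i => hb (t i)

theorem AddCircle.coe_rat_eq_zero_iff (q : ℚ) : (q : AddCircle (1 : ℚ)) = 0 ↔ ∃ z : ℤ, (z : ℚ) = q := by
  rw [AddCircle.coe_eq_zero_iff]
  simp

/-- The cokernel of a nonsingular integral matrix `A` is the kernel of `A` on `(ℚ/ℤ)ⁿ`. -/
theorem Matrix.exists_coker_hom [DecidableEq n] (A : Matrix n n ℤ) (hA : A.det ≠ 0) :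
    ∃ Θ : (n → ℤ) →+ (n → AddCircle (1 : ℚ)),
      (∀ m (q : n → ℚ), A.intMulVec ℚ ℚ q = (fun i => (m i : ℚ)) →
        Θ m = fun i => (q i : AddCircle (1 : ℚ))) ∧
      (∀ h, A.intMulVec ℤ _ h = 0 ↔ ∃ m, Θ m = h) ∧
      ∀ m, Θ m = 0 ↔ ∃ z, A.intMulVec ℤ ℤ z = m := by
  have hinj := A.intMulVec_injective hA ℚ ℚ
  -- `r m` is `A⁻¹ m`, and `Θ` is its reduction modulo `ℤⁿ`.
  choose r hr using fun m : n → ℤ => A.exists_intMulVec_rat hA (fun i => (m i : ℚ))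
  have hadd : ∀ m m', r (m + m') = r m + r m' := fun m m' => hinj (by
    rw [map_add, hr, hr, hr]
    funext i
    simp)
  have hcoe : ∀ (q : n → ℚ) i, ((A.intMulVec ℚ ℚ q i : ℚ) : AddCircle (1 : ℚ))
      = A.intMulVec ℤ (AddCircle (1 : ℚ)) (fun i => (q i : AddCircle (1 : ℚ))) i := by
    intro q i
    rw [intMulVec_apply, intMulVec_apply]
    exact (map_sum (QuotientAddGroup.mk' (AddSubgroup.zmultiples (1 : ℚ))) _ _).trans
      (Finset.sum_congr rfl fun j _ => map_zsmul (QuotientAddGroup.mk' _) _ _)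
  refine ⟨AddMonoidHom.mk' (fun m i => (r m i : AddCircle (1 : ℚ))) fun m m' => ?_, ?_, ?_, ?_⟩
  · funext i
    rw [hadd]
    rfl
  · intro m q hq
    have : r m = q := hinj ((hr m).trans hq.symm)
    rw [← this]
    rfl
  · intro h
    constructor
    · intro hh
      choose q hq using fun i => QuotientAddGroup.mk_surjective (h i)
      have h1 : ∀ i, ∃ z : ℤ, (z : ℚ) = A.intMulVec ℚ ℚ q i := by
        intro i
        rw [← AddCircle.coe_rat_eq_zero_iff, hcoe]
        refine Eq.trans ?_ (congrFun hh i)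
        rw [show (fun i => (q i : AddCircle (1 : ℚ))) = h from funext hq]
      choose m hm using h1
      refine ⟨m, ?_⟩
      have : r m = q := hinj ((hr m).trans (funext hm))
      funext i
      change ((r m i : ℚ) : AddCircle (1 : ℚ)) = h i
      rw [this]
      exact hq i
    · rintro ⟨m, rfl⟩
      funext i
      refine (hcoe (r m) i).symm.trans ?_
      rw [hr]
      exact (AddCircle.coe_rat_eq_zero_iff _).2 ⟨m i, rfl⟩
  · intro m
    constructor
    · intro h
      have h1 : ∀ i, ∃ z : ℤ, (z : ℚ) = r m i := fun i =>
        (AddCircle.coe_rat_eq_zero_iff _).1 (congrFun h i)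
      choose z hz using h1
      refine ⟨z, funext fun i => ?_⟩
      have h2 := congrFun (hr m) i
      rw [intMulVec_apply] at h2 ⊢
      have h3 : ((∑ j, A i j • z j : ℤ) : ℚ) = m i := by
        rw [← h2]
        push_cast
        refine Finset.sum_congr rfl fun j _ => ?_
        rw [← hz, zsmul_eq_mul]
        simp
      exact_mod_cast h3
    · rintro ⟨z, rfl⟩
      funext i
      change ((r _ i : ℚ) : AddCircle (1 : ℚ)) = 0
      rw [AddCircle.coe_rat_eq_zero_iff]
      refine ⟨z i, ?_⟩
      have : r (A.intMulVec ℤ ℤ z) = fun i => (z i : ℚ) := hinj ((hr _).trans (by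
        funext i
        simp [intMulVec_apply]))
      rw [this]

theorem Matrix.card_coker [DecidableEq n] (A : Matrix n n ℤ) (hA : A.det ≠ 0) :
    Nat.card ((n → ℤ) ⧸ LinearMap.range (A.intMulVec ℤ ℤ)) = A.det.natAbs := by
  rw [← Submodule.natAbs_det_equiv _
    (LinearEquiv.ofInjective _ (A.intMulVec_injective hA ℤ ℤ))]
  have : (LinearMap.range (A.intMulVec ℤ ℤ)).subtype ∘ₗ AddMonoidHom.toIntLinearMap
      ((LinearEquiv.ofInjective _ (A.intMulVec_injective hA ℤ ℤ) :
        (n → ℤ) ≃ₗ[ℤ] LinearMap.range (A.intMulVec ℤ ℤ)) : (n → ℤ) →+ _) = Matrix.toLin' A := by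
    refine LinearMap.ext fun h => funext fun i => ?_
    rw [Matrix.toLin'_apply]
    rfl
  rw [this, LinearMap.det_toLin']

theorem Matrix.card_ker_intMulVec [DecidableEq n] (A : Matrix n n ℤ) (hA : A.det ≠ 0) :
    Nat.card {h : n → AddCircle (1 : ℚ) // A.intMulVec ℤ _ h = 0} = A.det.natAbs := by
  obtain ⟨Θ, -, h2, h3⟩ := A.exists_coker_hom hA
  rw [← A.card_coker hA]
  symm
  refine Nat.card_eq_of_bijective (fun c => Quotient.liftOn' c
    (fun m => (⟨Θ m, (h2 _).2 ⟨m, rfl⟩⟩ : {h // A.intMulVec ℤ _ h = 0})) fun m m' h => ?_) ⟨?_, ?_⟩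
  · refine Subtype.ext ?_
    change Θ m = Θ m'
    have := (Submodule.quotientRel_def _).1 h
    rw [← sub_eq_zero, ← map_sub]
    exact (h3 _).2 this
  · intro a b
    induction a using Quotient.inductionOn'
    induction b using Quotient.inductionOn'
    intro h
    have h' := congrArg Subtype.val h
    change Θ _ = Θ _ at h'
    rw [← sub_eq_zero, ← map_sub, h3] at h'
    exact (Submodule.Quotient.eq _).2 h'
  · rintro ⟨h, hh⟩
    obtain ⟨m, rfl⟩ := (h2 h).1 hh
    exact ⟨Submodule.Quotient.mk m, rfl⟩

end lattice

/-- The `2`-torsion of `ℚ/ℤ`. -/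
theorem AddCircle.exists_two_torsion_hom :
    ∃ ι : ZMod 2 →+ AddCircle (1 : ℚ), Function.Injective ι ∧ ∀ t, (2 : ℤ) • t = 0 ↔ ∃ a, ι a = t := by
  let a : AddCircle (1 : ℚ) := ((1 / 2 : ℚ) : AddCircle (1 : ℚ))
  have h2 : (2 : ℕ) • a = 0 := by
    refine (AddCircle.coe_nsmul 1).symm.trans ((AddCircle.coe_rat_eq_zero_iff _).2 ⟨1, by norm_num⟩)
  have h2' : zmultiplesHom (AddCircle (1 : ℚ)) a (2 : ℕ) = 0 := by
    rw [zmultiplesHom_apply, natCast_zsmul]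
    exact h2
  let ι : ZMod 2 →+ AddCircle (1 : ℚ) := ZMod.lift 2 ⟨zmultiplesHom (AddCircle (1 : ℚ)) a, h2'⟩
  have hι : ι 1 = a := by
    have := ZMod.lift_coe 2 (⟨zmultiplesHom (AddCircle (1 : ℚ)) a, h2'⟩ :
      {f : ℤ →+ AddCircle (1 : ℚ) // f (2 : ℕ) = 0}) 1
    rw [Int.cast_one] at this
    exact this.trans (one_zsmul a)
  have hne : a ≠ 0 := by
    intro h
    obtain ⟨z, hz⟩ := (AddCircle.coe_rat_eq_zero_iff _).1 h
    have h3 : ((2 * z : ℤ) : ℚ) = (1 : ℤ) := by push_cast; rw [hz]; norm_num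
    have h4 : 2 * z = 1 := by exact_mod_cast h3
    omega
  refine ⟨ι, ?_, fun t => ⟨fun ht => ?_, ?_⟩⟩
  · rw [injective_iff_map_eq_zero]
    intro a ha
    fin_cases a
    · rfl
    · exact absurd (hι.symm.trans ha) hne
  · induction t using QuotientAddGroup.induction_on with
    | H q =>
      have h3 : (((2 : ℤ) • q : ℚ) : AddCircle (1 : ℚ)) = 0 := by
        rw [AddCircle.coe_zsmul]; exact ht
      rw [AddCircle.coe_rat_eq_zero_iff] at h3
      obtain ⟨z, hz⟩ := h3
      rw [zsmul_eq_mul] at hz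
      push_cast at hz
      rcases Int.even_or_odd' z with ⟨w, rfl | rfl⟩
      · refine ⟨0, ?_⟩
        rw [map_zero]
        symm
        exact (AddCircle.coe_rat_eq_zero_iff q).2 ⟨w, by push_cast at hz; linarith⟩
      · refine ⟨1, ?_⟩
        rw [hι, ← sub_eq_zero]
        exact (AddCircle.coe_rat_eq_zero_iff (1 / 2 - q)).2
          ⟨-w, by push_cast at hz ⊢; linarith⟩
  · rintro ⟨b, rfl⟩
    rw [← map_zsmul, show (2 : ℤ) • b = 0 by revert b; decide, map_zero]

/-! ### Counting invariant solutions for one signed automorphism -/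

namespace SignedForest

variable {X : Type*} (D : SignedForest X)

/-- The points whose stabilizer acts by the sign `1`. -/
def pos : Set X := {x | ∀ k, (D.F ^ k) x = x → D.sgn k x = 1}

theorem stable_pos : D.Stable D.pos := by
  intro x
  refine forall_congr' fun k => ?_
  rw [D.F_pow_F_iff]
  refine forall_congr' fun h => ?_
  rw [D.sgn_of_fixed_F h]

variable {D} in
theorem Stable.compl {Y : Set X} (hY : D.Stable Y) : D.Stable Yᶜ := fun x => not_congr (hY x)

theorem exists_of_notMem_pos {x : X} (hx : x ∉ D.pos) :
    ∃ k, (D.F ^ k) x = x ∧ D.sgn k x = -1 := by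
  simp only [pos, Set.mem_ofPred_eq, not_forall] at hx
  obtain ⟨k, hk, h⟩ := hx
  exact ⟨k, hk, (Int.units_eq_one_or _).resolve_left h⟩

theorem unitSign_int (a : ℤˣ) : unitSign ℤ a = a := Units.ext (by simp [unitSign])

theorem exists_isTwist_pos [Finite X] : ∃ χ, D.IsTwist D.pos (1 : ℤˣ) χ :=
  D.exists_isTwist _ D.stable_pos 1 fun x hx k hk => by
    rw [hx k hk, one_pow, one_mul, map_one]

variable {D} [Fintype X]

open Classical in
/-- The entries of a row of `B` of negative sign cancel on orbits of positive sign. -/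
theorem IsTwist.rowSum_pos_eq_zero {χ : X → ℤˣ} (hχ : D.IsTwist D.pos (1 : ℤˣ) χ) {x : X}
    (hx : x ∉ D.pos) (O : D.Orbit) :
    ∑ y with D.orbit y = O, (if y ∈ D.pos then D.B x y * (χ y : ℤ) else 0) = 0 := by
  obtain ⟨k, hk, hs⟩ := D.exists_of_notMem_pos hx
  -- Here `F ^ k` fixes `x` with sign `-1`. Substituting `F ^ k y` for `y` preserves the entry at
  -- `y` and, where that entry is nonzero, reverses `χ y`; the sum equals its own negative.
  have h1 : ∀ y, (if (D.F ^ k) y ∈ D.pos then D.B x ((D.F ^ k) y) * (χ ((D.F ^ k) y) : ℤ) else 0)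
      = -(if y ∈ D.pos then D.B x y * (χ y : ℤ) else 0) := by
    intro y
    have hB : D.B x ((D.F ^ k) y) = D.B x y := by
      conv_lhs => rw [← hk]
      exact D.B_F_pow k x y
    rw [hB, if_congr (D.stable_pos.pow k y) rfl rfl]
    split_ifs with hy
    · by_cases h0 : D.B x y = 0
      · simp [h0]
      · rw [hχ.pow k hy, ← D.sgn_B k x y h0, hs, unitSign_int]
        simp
    · rfl
  have h2 : ∑ y with D.orbit y = O, (if y ∈ D.pos then D.B x y * (χ y : ℤ) else 0)
      = ∑ y with D.orbit y = O, -(if y ∈ D.pos then D.B x y * (χ y : ℤ) else 0) := by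
    conv_lhs => rw [Finset.sum_filter, ← Equiv.sum_comp (D.F ^ k)]
    rw [Finset.sum_filter]
    refine Finset.sum_congr rfl fun y _ => ?_
    rw [D.orbit_F_pow, h1]
  rw [Finset.sum_neg_distrib] at h2
  omega

theorem IsTwist.sum_B_twist_pos_eq_zero {M : Type*} [AddCommGroup M] {χ : X → ℤˣ}
    (hχ : D.IsTwist D.pos (1 : ℤˣ) χ) {x : X} (hx : x ∉ D.pos) (u : D.OrbitIn D.pos → M) :
    ∑ y, D.B x y • D.twist (R := ℤ) D.pos χ u y = 0 := by
  classical
  rw [← Finset.sum_fiberwise Finset.univ D.orbit]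
  refine Finset.sum_eq_zero fun O _ => ?_
  let v : M := if h : O.out ∈ D.pos then u ⟨O, h⟩ else 0
  have h1 : ∀ y ∈ Finset.univ.filter (fun y => D.orbit y = O),
      D.B x y • D.twist (R := ℤ) D.pos χ u y
        = (if y ∈ D.pos then D.B x y * (χ y : ℤ) else 0) • v := by
    intro y hy
    have hyO := (Finset.mem_filter.1 hy).2
    subst hyO
    split_ifs with h
    · have h2 := (D.stable_pos.out_mem y).2 h
      have hv : v = u ⟨D.orbit y, h2⟩ := dif_pos h2
      rw [twist_apply u h2, hv, smul_smul]
    · rw [twist_eq_zero D.stable_pos u h, smul_zero, zero_smul]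
  rw [Finset.sum_congr rfl h1, ← Finset.sum_smul, hχ.rowSum_pos_eq_zero hx O, zero_smul]

/-- A vector in the kernel of the orbit matrix twists to a vector in the kernel of `B`: rows at
positive points see the orbit matrix, and rows at negative points cancel. -/
theorem det_quot_pos_ne_zero [DecidableEq X] (hB : D.B.det ≠ 0) : (D.quot D.pos).det ≠ 0 := by
  intro h0
  obtain ⟨u, hu, hu0⟩ := Matrix.exists_mulVec_eq_zero_iff.2 h0
  obtain ⟨χ, hχ⟩ := D.exists_isTwist_pos
  have h1 : D.B.intMulVec ℤ ℤ (D.twist (R := ℤ) D.pos χ u) = 0 := by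
    funext x
    by_cases hx : x ∈ D.pos
    · refine (hχ.sum_B_twist u hx).trans ?_
      have : (D.quot D.pos).intMulVec ℤ ℤ u = 0 := hu0
      rw [this, map_zero]
    · exact hχ.sum_B_twist_pos_eq_zero hx u
  rw [← map_zero (D.B.intMulVec ℤ ℤ)] at h1
  have h2 := D.B.intMulVec_injective hB ℤ ℤ h1
  rw [← map_zero (D.twist (R := ℤ) (M := ℤ) D.pos χ)] at h2
  exact hu (twist_injective h2)

theorem units_smul_of_two_torsion {G : Type*} [AddCommGroup G] {t : G} (ht : (2 : ℤ) • t = 0)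
    (a : ℤˣ) : (a : ℤ) • t = t := by
  rcases Int.units_eq_one_or a with rfl | rfl
  · simp
  · have : t + t = 0 := by rw [← two_zsmul]; exact ht
    simpa using (eq_neg_of_add_eq_zero_left this).symm

/-- The number of invariant elements in the kernel of `B` on functions with values in `ℚ/ℤ`. -/
theorem card_solutions [DecidableEq X] (hB : D.B.det ≠ 0) :
    Nat.card {h : X → AddCircle (1 : ℚ) // D.B.intMulVec ℤ _ h = 0 ∧
        ∀ x, h (D.F x) = (D.s x : ℤ) • h x}
      = (D.quot D.pos).det.natAbs *
        2 ^ Module.finrank (ZMod 2)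
          (LinearMap.ker ((D.quot D.posᶜ).intMulVec (ZMod 2) (ZMod 2))) := by
  classical
  let G := AddCircle (1 : ℚ)
  obtain ⟨χ, hχ⟩ := D.exists_isTwist_pos
  let TP := D.twist (R := ℤ) (M := G) D.pos χ
  -- No sign is needed on the negative points: the values there are 2-torsion, where `-1` acts
  -- trivially.
  let TN := D.twist (R := ℤ) (M := G) D.posᶜ (fun _ => 1)
  have hN := D.stable_pos.compl
  let QP := (D.quot D.pos).intMulVec ℤ G
  let QN := (D.quot D.posᶜ).intMulVec ℤ G
  have hTP0 : ∀ u x, x ∉ D.pos → TP u x = 0 := fun u x hx => twist_eq_zero D.stable_pos u hx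
  have hTN0 : ∀ u x, x ∈ D.pos → TN u x = 0 := fun u x hx =>
    twist_eq_zero hN u (fun h => h hx)
  let C : (D.OrbitIn D.posᶜ → G) → X → G := fun v x => ∑ y, D.B x y • TN v y
  have hTNout : ∀ v x, TN v x = TN v (D.orbit x).out := by
    intro v x
    by_cases hx : x ∈ D.pos
    · rw [hTN0 v x hx, hTN0 v _ ((D.stable_pos.out_mem x).2 hx)]
    · have h1 := (hN.out_mem x).2 hx
      have h2 := twist_out (χ := fun _ => (1 : ℤˣ)) v ⟨D.orbit x, h1⟩
      have h3 := twist_apply (χ := fun _ => (1 : ℤˣ)) v h1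
      exact h3.trans h2.symm
  have hC : ∀ v x, C v (D.orbit x).out = C v x := by
    intro v x
    have h1 : ∀ x, C v x = ∑ O, D.rowSum x O • TN v O.out := by
      intro x
      rw [← D.sum_B_smul x (fun O => TN v O.out)]
      exact Finset.sum_congr rfl fun y _ => by rw [← hTNout]
    rw [h1, h1]
    simp only [D.rowSum_out]
  have hTN2 : ∀ v, (∀ O, (2 : ℤ) • v O = 0) → ∀ x, (2 : ℤ) • TN v x = 0 := by
    intro v hv x
    rw [← Pi.smul_apply, ← map_smul, show (2 : ℤ) • v = 0 from funext hv, map_zero]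
    rfl
  have hC2 : ∀ v, (∀ O, (2 : ℤ) • v O = 0) → ∀ x, (2 : ℤ) • C v x = 0 := by
    intro v hv x
    simp only [C]
    rw [Finset.smul_sum]
    exact Finset.sum_eq_zero fun y _ => by rw [smul_comm, hTN2 v hv, smul_zero]
  -- The system is block triangular: rows at negative points involve only the negative values `p.2`,
  -- whereas rows at positive points involve both, `C` being the contribution of `p.2`.
  let T := {p : (D.OrbitIn D.pos → G) × (D.OrbitIn D.posᶜ → G) //
    ((∀ O, (2 : ℤ) • p.2 O = 0) ∧ QN p.2 = 0) ∧ QP p.1 = fun O => - C p.2 O.1.out}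
  have hcount : Nat.card T = Nat.card {h : X → G // D.B.intMulVec ℤ _ h = 0 ∧
        ∀ x, h (D.F x) = (D.s x : ℤ) • h x} := by
    refine Nat.card_eq_of_bijective (fun p => ⟨TP p.1.1 + TN p.1.2, ?_, ?_⟩) ⟨?_, ?_⟩
    · obtain ⟨⟨u, v⟩, ⟨hv, hQN⟩, hQP⟩ := p
      funext x
      rw [map_add, Pi.add_apply]
      by_cases hx : x ∈ D.pos
      · have h1 := hχ.sum_B_twist u hx
        have h2 := (D.stable_pos.out_mem x).2 hx
        rw [twist_apply _ h2] at h1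
        refine (congrArg₂ (· + ·) h1 rfl).trans ?_
        change (χ x : ℤ) • QP u _ + C v x = 0
        rw [hQP]
        change (χ x : ℤ) • (- C v (D.orbit x).out) + C v x = 0
        rw [hC, units_smul_of_two_torsion (by rw [smul_neg, hC2 v hv, neg_zero]), neg_add_cancel]
      · have h1 := hχ.sum_B_twist_pos_eq_zero hx u
        have h2 := sum_B_twist hN (χ := fun _ => (1 : ℤˣ)) (fun _ _ _ _ _ => rfl) v hx
        refine (congrArg₂ (· + ·) h1 h2).trans ?_
        have h3 : (D.quot D.posᶜ).intMulVec ℤ G v = 0 := hQN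
        rw [h3, map_zero]
        exact add_zero _
    · intro x
      obtain ⟨⟨u, v⟩, ⟨hv, hQN⟩, hQP⟩ := p
      have h1 := hχ.twist_F u x
      rw [one_mul, unitSign_int] at h1
      have h2 : TN v (D.F x) = (D.s x : ℤ) • TN v x := by
        rw [units_smul_of_two_torsion (hTN2 v hv x), hTNout, hTNout v x, D.orbit_F]
      rw [Pi.add_apply, Pi.add_apply, smul_add, ← h2]
      exact congrArg₂ (· + ·) h1 rfl
    · rintro ⟨⟨u, v⟩, hp⟩ ⟨⟨u', v'⟩, hp'⟩ h
      have h' : TP u + TN v = TP u' + TN v' := congrArg Subtype.val h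
      have hu : TP u = TP u' := by
        funext x
        by_cases hx : x ∈ D.pos
        · have := congrFun h' x
          simpa only [Pi.add_apply, hTN0 _ x hx, add_zero] using this
        · rw [hTP0 u x hx, hTP0 u' x hx]
      have hv : TN v = TN v' := by rw [hu] at h'; exact add_left_cancel h'
      have hu' : u = u' := twist_injective hu
      have hv' : v = v' := twist_injective hv
      subst hu' hv'
      rfl
    · rintro ⟨h, hBh, hF⟩
      have hF' : ∀ x, h (D.F x) = (((1 : ℤˣ) * unitSign ℤ (D.s x) : ℤˣ) : ℤ) • h x := by
        intro x
        rw [one_mul, unitSign_int, hF]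
      have h2 : ∀ x ∉ D.pos, (2 : ℤ) • h x = 0 := by
        intro x hx
        obtain ⟨k, hk, hs⟩ := D.exists_of_notMem_pos hx
        have h3 := map_F_pow hF' k x
        rw [hk, hs, unitSign_int, one_pow, one_mul] at h3
        rw [two_zsmul]
        nth_rw 1 [h3]
        simp
      obtain ⟨u, hu⟩ := hχ.exists_twist_eq (h := fun x => if x ∈ D.pos then h x else 0)
        (fun x => by
          rw [if_congr (D.stable_pos x) rfl rfl, hF']
          split_ifs
          · rfl
          · rw [smul_zero]) (fun x hx => if_neg hx)
      have hout : ∀ x ∉ D.pos, h x = h (D.orbit x).out := by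
        intro x hx
        obtain ⟨k, hk⟩ := D.exists_pow_eq_out x
        rw [← hk, map_F_pow hF', one_pow, one_mul, unitSign_int, units_smul_of_two_torsion (h2 x hx)]
      let v : D.OrbitIn D.posᶜ → G := fun O => h O.1.out
      have hv : ∀ x ∉ D.pos, TN v x = h x := by
        intro x hx
        have h1 := (hN.out_mem x).2 hx
        refine (twist_apply (χ := fun _ => (1 : ℤˣ)) v h1).trans ?_
        rw [Units.val_one, one_smul, hout x hx]
      have hsum : TP u + TN v = h := by
        funext x
        have hux : TP u x = if x ∈ D.pos then h x else 0 := congrFun hu x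
        rw [Pi.add_apply, hux]
        split_ifs with hx
        · rw [hTN0 _ x hx, add_zero]
        · rw [hv x hx, zero_add]
      have hv2 : ∀ O, (2 : ℤ) • v O = 0 := fun O => h2 _ O.2
      have hBx : ∀ x, ∑ y, D.B x y • TP u y + C v x = 0 := by
        intro x
        refine Eq.trans ?_ (congrFun hBh x)
        rw [← hsum, map_add]
        rfl
      refine ⟨⟨(u, v), ⟨hv2, ?_⟩, ?_⟩, Subtype.ext hsum⟩
      · funext O
        have h3 := hBx O.1.out
        rw [hχ.sum_B_twist_pos_eq_zero O.2 u, zero_add] at h3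
        have h4 := sum_B_twist hN (χ := fun _ => (1 : ℤˣ)) (fun _ _ _ _ _ => rfl) v O.2
        rw [twist_out, Units.val_one, one_smul] at h4
        exact h4.symm.trans h3
      · funext O
        have h3 := hBx O.1.out
        rw [hχ.sum_B_twist u O.2, twist_out] at h3
        have h4 := eq_neg_of_add_eq_zero_left h3
        have h5 : (2 : ℤ) • - C v O.1.out = 0 := by rw [smul_neg, hC2 v hv2, neg_zero]
        have h6 := congrArg (fun t => (χ O.1.out : ℤ) • t) h4
        simp only [smul_smul] at h6
        rw [← Units.val_mul, Int.units_mul_self, Units.val_one, one_smul,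
          units_smul_of_two_torsion h5] at h6
        exact h6
  rw [← hcount]
  have hdet := det_quot_pos_ne_zero hB
  have hsurj := (D.quot D.pos).intMulVec_surjective hdet
  have hsol : ∀ v : D.OrbitIn D.posᶜ → G, ∃ u, QP u = fun O => - C v O.1.out := fun v => hsurj _
  choose u₀ hu₀ using hsol
  let K1 := {u : D.OrbitIn D.pos → G // QP u = 0}
  let K2 := {v : D.OrbitIn D.posᶜ → G // (∀ O, (2 : ℤ) • v O = 0) ∧ QN v = 0}
  have e1 : Nat.card T = Nat.card (K1 × K2) := by
    -- Surjectivity of `QP` makes the solutions over each `v` a translate by `u₀ v` of the kernel of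
    -- `QP`, so the count is a product.
    refine Nat.card_congr
      { toFun := fun p => (⟨p.1.1 - u₀ p.1.2, by rw [map_sub, hu₀, p.2.2, sub_self]⟩, ⟨p.1.2, p.2.1⟩)
        invFun := fun p => ⟨(p.1.1 + u₀ p.2.1, p.2.1), p.2.2, by
          rw [map_add, p.1.2, hu₀, zero_add]⟩
        left_inv := fun p => by simp
        right_inv := fun p => by simp }
  rw [e1, Nat.card_prod]
  congr 1
  · exact (D.quot D.pos).card_ker_intMulVec hdet
  · obtain ⟨ι, hι, hι2⟩ := AddCircle.exists_two_torsion_hom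
    have hQι : ∀ w : D.OrbitIn D.posᶜ → ZMod 2, QN (fun O => ι (w O))
        = fun O => ι ((D.quot D.posᶜ).intMulVec (ZMod 2) (ZMod 2) w O) := by
      intro w
      funext O
      refine Eq.symm ((map_sum ι _ _).trans (Finset.sum_congr rfl fun j _ => map_zsmul ι _ _))
    have e2 : Nat.card (LinearMap.ker ((D.quot D.posᶜ).intMulVec (ZMod 2) (ZMod 2)))
        = Nat.card K2 := by
      refine Nat.card_eq_of_bijective (fun w => ⟨fun O => ι (w.1 O), fun O => (hι2 _).2 ⟨_, rfl⟩, ?_⟩)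
        ⟨?_, ?_⟩
      · rw [hQι, LinearMap.mem_ker.1 w.2]
        funext O
        exact map_zero ι
      · intro w w' h
        exact Subtype.ext (funext fun O => hι (congrFun (congrArg Subtype.val h) O))
      · rintro ⟨v, hv, hQ⟩
        choose w hw using fun O => (hι2 (v O)).1 (hv O)
        have hw' : (fun O => ι (w O)) = v := funext hw
        refine ⟨⟨w, ?_⟩, Subtype.ext hw'⟩
        rw [LinearMap.mem_ker]
        funext O
        apply hι
        rw [← hw', hQι] at hQ
        exact (congrFun hQ O).trans (map_zero ι).symm
    rw [← e2, Nat.card_eq_fintype_card, Module.card_eq_pow_finrank (K := ZMod 2), ZMod.card]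

end SignedForest

/-! ### Determinants and nullities under decompositions and field extensions -/

/-- The dimension over `K` of the kernel of an integral matrix. -/
def Matrix.nullity {m : Type*} [Fintype m] (A : Matrix m m ℤ) (K : Type*) [Field K] : ℕ :=
  Module.finrank K (LinearMap.ker (A.intMulVec K K))

section linear_algebra

variable {m : Type*} [Fintype m] [DecidableEq m]

theorem Matrix.intMulVec_eq_toLin' (A : Matrix m m ℤ) (K : Type*) [CommRing K] :
    A.intMulVec K K = Matrix.toLin' (A.map (Int.castRingHom K)) := by
  refine LinearMap.ext fun h => funext fun i => ?_
  rw [Matrix.intMulVec_apply, Matrix.toLin'_apply]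
  simp [Matrix.mulVec, dotProduct]

theorem Matrix.det_intMulVec (A : Matrix m m ℤ) (K : Type*) [CommRing K] :
    LinearMap.det (A.intMulVec K K) = (A.det : K) := by
  rw [intMulVec_eq_toLin', LinearMap.det_toLin']
  exact ((Int.castRingHom K).map_det A).symm

theorem Matrix.det_blockDiagonal_sigma {ι R : Type*} [CommRing R] [Fintype ι] [DecidableEq ι]
    {l : ι → Type*} [∀ i, Fintype (l i)] [∀ i, DecidableEq (l i)] (A : ∀ i, Matrix (l i) (l i) R) :
    (Matrix.blockDiagonal' A).det = ∏ i, (A i).det := by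
  -- The order is arbitrary; it only serves to regard a block diagonal matrix as block triangular.
  let _ : LinearOrder ι := LinearOrder.lift' (Fintype.equivFin ι) (Fintype.equivFin ι).injective
  have hb : (Matrix.blockDiagonal' A).BlockTriangular Sigma.fst := by
    rintro ⟨i, a⟩ ⟨j, b⟩ h
    exact Matrix.blockDiagonal'_apply_ne _ _ _ (ne_of_gt h)
  rw [hb.det_fintype]
  refine Finset.prod_congr rfl fun i _ => ?_
  let e : l i ≃ {a : Σ i, l i // a.1 = i} :=
    { toFun := fun a => ⟨⟨i, a⟩, rfl⟩
      invFun := fun a => a.2 ▸ a.1.2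
      left_inv := fun a => rfl
      right_inv := by rintro ⟨⟨j, a⟩, rfl⟩; rfl }
  rw [← Matrix.det_submatrix_equiv_self e]
  congr 1
  ext a b
  exact Matrix.blockDiagonal'_apply_eq _ _ _ _

theorem Matrix.det_eq_prod_of_equiv {ι : Type*} [Fintype ι] [DecidableEq ι] {l : ι → Type*}
    [∀ i, Fintype (l i)] [∀ i, DecidableEq (l i)] {K : Type*} [Field K] {A : Matrix m m ℤ}
    {A' : ∀ i, Matrix (l i) (l i) ℤ} (e : (m → K) ≃ₗ[K] (∀ i, l i → K))
    (he : ∀ u i, e (A.intMulVec K K u) i = (A' i).intMulVec K K (e u i)) :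
    (A.det : K) = ∏ i, ((A' i).det : K) := by
  let c : ((i : ι) → l i → K) ≃ₗ[K] ((Σ i, l i) → K) :=
    (LinearEquiv.piCurry K (fun (i : ι) (_ : l i) => K)).symm
  let E := e.trans c
  have h1 := LinearMap.det_conj (A.intMulVec K K) E
  have h2 : (E : (m → K) →ₗ[K] _) ∘ₗ A.intMulVec K K ∘ₗ (E.symm : _ →ₗ[K] (m → K))
      = (Matrix.blockDiagonal' A').intMulVec K K := by
    refine LinearMap.ext fun w => funext fun ⟨i, a⟩ => ?_
    change e (A.intMulVec K K (E.symm w)) i a = _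
    rw [he]
    have h3 : e (E.symm w) = c.symm w := by
      change e (e.symm (c.symm w)) = _
      rw [LinearEquiv.apply_symm_apply]
    rw [h3, intMulVec_apply, intMulVec_apply, Fintype.sum_sigma, Finset.sum_eq_single i]
    · refine Finset.sum_congr rfl fun b _ => ?_
      rw [Matrix.blockDiagonal'_apply_eq]
      rfl
    · intro j _ hj
      refine Finset.sum_eq_zero fun b _ => ?_
      rw [Matrix.blockDiagonal'_apply_ne _ _ _ hj.symm, zero_smul]
    · simp
  rw [h2, Matrix.det_intMulVec, Matrix.det_intMulVec, Matrix.det_blockDiagonal_sigma] at h1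
  rw [← h1]
  push_cast
  rfl

end linear_algebra

section nullity

variable {m : Type*} [Fintype m]

theorem Matrix.nullity_eq_sum_of_equiv {ι : Type*} [Fintype ι] {l : ι → Type*}
    [∀ i, Fintype (l i)] {K : Type*} [Field K] {A : Matrix m m ℤ}
    {A' : ∀ i, Matrix (l i) (l i) ℤ} (e : (m → K) ≃ₗ[K] (∀ i, l i → K))
    (he : ∀ u i, e (A.intMulVec K K u) i = (A' i).intMulVec K K (e u i)) :
    A.nullity K = ∑ i, (A' i).nullity K := by
  unfold nullity
  rw [← Module.finrank_pi_fintype K]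
  refine LinearEquiv.finrank_eq
    { toFun := fun u i => ⟨e u.1 i, by
        rw [LinearMap.mem_ker, ← he, LinearMap.mem_ker.1 u.2, map_zero]; rfl⟩
      invFun := fun w => ⟨e.symm fun i => (w i).1, by
        rw [LinearMap.mem_ker]
        apply e.injective
        funext i
        rw [he, LinearEquiv.apply_symm_apply, LinearMap.mem_ker.1 (w i).2, map_zero]
        rfl⟩
      left_inv := fun u => Subtype.ext (e.symm_apply_apply _)
      right_inv := fun w => funext fun i => Subtype.ext (by
        change e (e.symm _) i = _
        rw [LinearEquiv.apply_symm_apply])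
      map_add' := fun a b => funext fun i => Subtype.ext (by
        change e (a.1 + b.1) i = _
        rw [map_add]; rfl)
      map_smul' := fun a b => funext fun i => Subtype.ext (by
        change e (a • b.1) i = _
        rw [map_smul]; rfl) }

/-- In coordinates with respect to a `k`-basis of `K`, the kernel over `K` is `[K : k]` copies of
the kernel over `k`. This brings nullities from a cyclotomic extension back to `ZMod 2`. -/
theorem Matrix.nullity_extension (A : Matrix m m ℤ) (k K : Type*) [Field k] [Field K] [Algebra k K]
    [FiniteDimensional k K] : A.nullity K = A.nullity k := by
  let b := Module.finBasis k K
  have hpos : 0 < Module.finrank k K := Module.finrank_pos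
  apply Nat.eq_of_mul_eq_mul_left hpos
  have h1 : Module.finrank k K * A.nullity K
      = Module.finrank k (LinearMap.ker (A.intMulVec K K)) := Module.finrank_mul_finrank k K _
  rw [h1]
  have hA : ∀ (u : m → K) i j, b.repr (A.intMulVec K K u i) j
      = A.intMulVec k k (fun i => b.repr (u i) j) i := by
    intro u i j
    rw [intMulVec_apply, map_sum, Finsupp.finsetSum_apply, intMulVec_apply]
    refine Finset.sum_congr rfl fun _ _ => ?_
    rw [map_zsmul]
    rfl
  let e : LinearMap.ker (A.intMulVec K K) ≃ₗ[k]
      (Fin (Module.finrank k K) → LinearMap.ker (A.intMulVec k k)) :=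
    { toFun := fun u j => ⟨fun i => b.repr (u.1 i) j, by
        rw [LinearMap.mem_ker]
        funext i
        rw [← hA, LinearMap.mem_ker.1 u.2]
        simp⟩
      invFun := fun w => ⟨fun i => b.equivFun.symm fun j => (w j).1 i, by
        rw [LinearMap.mem_ker]
        funext i
        apply b.repr.injective
        ext j
        rw [hA]
        have : (fun i => b.repr (b.equivFun.symm fun j => (w j).1 i) j) = (w j).1 := by
          funext i
          rw [← Module.Basis.equivFun_apply, LinearEquiv.apply_symm_apply]
        rw [this, LinearMap.mem_ker.1 (w j).2]
        simp⟩
      left_inv := fun u => Subtype.ext (funext fun i => b.equivFun.symm_apply_apply _)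
      right_inv := fun w => funext fun j => Subtype.ext (funext fun i =>
        congrFun (b.equivFun.apply_symm_apply _) j)
      map_add' := fun x y => funext fun j => Subtype.ext (funext fun i => by
        change b.repr (x.1 i + y.1 i) j = _
        rw [map_add]; rfl)
      map_smul' := fun a y => funext fun j => Subtype.ext (funext fun i => by
        change b.repr (a • y.1 i) j = _
        rw [map_smul]; rfl) }
  rw [e.finrank_eq, Module.finrank_pi_fintype]
  simp [nullity]

/-- A sum over the powers of an element of order `n`, grouped by their orders. -/
theorem Fin.prod_orderOf_pow {G M : Type*} [Group G] [CommMonoid M] {n : ℕ} [NeZero n] {ω : G}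
    (hω : orderOf ω = n) (g : ℕ → M) :
    ∏ t : Fin n, g (orderOf (ω ^ (t : ℕ))) = ∏ d ∈ n.divisors, g d ^ Nat.totient d := by
  have hn : 0 < n := NeZero.pos n
  have h1 : ∀ t : ℕ, orderOf (ω ^ t) = n / n.gcd t := fun t => by
    rw [IsOfFinOrder.orderOf_pow ω t (orderOf_pos_iff.1 (by rw [hω]; exact hn)), hω]
  rw [Fin.prod_univ_eq_prod_range (fun t => g (orderOf (ω ^ t))) n]
  rw [← Finset.prod_fiberwise_of_maps_to (t := n.divisors) (g := fun t => n / n.gcd t)]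
  · refine Finset.prod_congr rfl fun d hd => ?_
    have hdn := Nat.dvd_of_mem_divisors hd
    have h2 : ∀ t ∈ (Finset.range n).filter (fun t => n / n.gcd t = d),
        g (orderOf (ω ^ t)) = g d := by
      intro t ht
      rw [h1, (Finset.mem_filter.1 ht).2]
    rw [Finset.prod_congr rfl h2, Finset.prod_const]
    congr 1
    have h3 := Nat.totient_div_of_dvd (Nat.div_dvd_of_dvd hdn)
    rw [Nat.div_div_self hdn hn.ne'] at h3
    rw [h3]
    congr 1
    refine Finset.filter_congr fun t _ => ?_
    constructor
    · rintro rfl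
      exact (Nat.div_div_self (Nat.gcd_dvd_left n t) hn.ne').symm
    · intro h
      rw [h, Nat.div_div_self hdn hn.ne']
  · intro t _
    exact Nat.mem_divisors.2 ⟨Nat.div_dvd_of_dvd (Nat.gcd_dvd_left _ _), hn.ne'⟩

end nullity

/-! ### Dependence on the power of the signed automorphism -/

namespace SignedForest

variable {X : Type*} (D : SignedForest X)

/-- The size of the orbit of a point. -/
def period (x : X) : ℕ := Function.minimalPeriod D.F x

theorem F_pow_eq_iff (k : ℕ) (x : X) : (D.F ^ k) x = x ↔ D.period x ∣ k := by
  rw [period, ← Function.isPeriodicPt_iff_minimalPeriod_dvd, Function.IsPeriodicPt,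
    Function.IsFixedPt, Equiv.Perm.iterate_eq_pow]

theorem F_pow_period (x : X) : (D.F ^ D.period x) x = x := (D.F_pow_eq_iff _ x).2 dvd_rfl

theorem sgn_period_mul (j : ℕ) (x : X) :
    D.sgn (D.period x * j) x = D.sgn (D.period x) x ^ j :=
  orbitProd_mul_of_fixed _ _ (D.F_pow_period x) j

theorem mem_pos_iff (x : X) : x ∈ D.pos ↔ D.sgn (D.period x) x = 1 := by
  refine ⟨fun h => h _ (D.F_pow_period x), fun h k hk => ?_⟩
  obtain ⟨j, rfl⟩ := (D.F_pow_eq_iff k x).1 hk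
  rw [D.sgn_period_mul, h, one_pow]

theorem sgn_period_of_notMem {x : X} (h : x ∉ D.pos) : D.sgn (D.period x) x = -1 :=
  (Int.units_eq_one_or _).resolve_left fun h' => h ((D.mem_pos_iff x).2 h')

theorem period_F (x : X) : D.period (D.F x) = D.period x := by
  refine Nat.dvd_antisymm ?_ ?_
  · rw [← D.F_pow_eq_iff, D.F_pow_F_iff, D.F_pow_eq_iff]
  · rw [← D.F_pow_eq_iff, ← D.F_pow_F_iff, D.F_pow_eq_iff]

/-- The points of negative sign with period divisible by `d`. -/
def negSet (d : ℕ) : Set X := {x | x ∉ D.pos ∧ d ∣ D.period x}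

/-- The points of negative sign with period congruent to `d / 2` modulo `d`. -/
def halfSet (d : ℕ) : Set X := {x | x ∉ D.pos ∧ d ∣ 2 * D.period x ∧ ¬ d ∣ D.period x}

/-- The support of the eigenfunctions for the primitive `d`-th roots of unity. -/
def rootSet (d : ℕ) : Set X := {x | (x ∈ D.pos ∧ d ∣ D.period x) ∨ x ∈ D.halfSet d}

theorem stable_negSet (d : ℕ) : D.Stable (D.negSet d) := fun x => by
  simp only [negSet, Set.mem_ofPred_eq, D.stable_pos x, D.period_F]

theorem stable_halfSet (d : ℕ) : D.Stable (D.halfSet d) := fun x => by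
  simp only [halfSet, Set.mem_ofPred_eq, D.stable_pos x, D.period_F]

theorem mem_eigenSet_iff {R : Type*} [CommRing R] (Y : Set X) (ζ : Rˣ) (x : X) :
    x ∈ D.eigenSet Y ζ ↔
      x ∈ Y ∧ ζ ^ D.period x * unitSign R (D.sgn (D.period x) x) = 1 := by
  refine and_congr_right fun _ => ⟨fun h => h _ (D.F_pow_period x), fun h k hk => ?_⟩
  obtain ⟨j, rfl⟩ := (D.F_pow_eq_iff k x).1 hk
  rw [D.sgn_period_mul, map_pow, pow_mul, ← mul_pow, h, one_pow]

/-- With `p` the period, the condition is `ζ ^ p = 1` at positive points and `ζ ^ p = -1` at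
negative ones. As `-1 ≠ 1`, the latter means that the order of `ζ` divides `2 p` but not `p`. In
particular only the order of `ζ` matters. -/
theorem eigenSet_univ {K : Type*} [Field K] (h2 : (2 : K) ≠ 0) (ζ : Kˣ) :
    D.eigenSet Set.univ ζ = D.rootSet (orderOf ζ) := by
  ext x
  rw [mem_eigenSet_iff, and_iff_right (Set.mem_univ x)]
  simp only [rootSet, halfSet, Set.mem_ofPred_eq]
  by_cases hx : x ∈ D.pos
  · rw [(D.mem_pos_iff x).1 hx, map_one, mul_one, ← orderOf_dvd_iff_pow_eq_one]
    tauto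
  · have h1 : unitSign K (-1) = -1 := Units.ext (by simp [unitSign])
    rw [D.sgn_period_of_notMem hx, h1, mul_neg, mul_one, orderOf_dvd_iff_pow_eq_one,
      orderOf_dvd_iff_pow_eq_one]
    simp only [hx, false_and, not_false_eq_true, true_and, false_or]
    rw [mul_comm, pow_mul]
    set a := ζ ^ D.period x
    have h3 : (-1 : Kˣ) ≠ 1 := fun h => h2 (by
      have := congrArg Units.val h
      simp only [Units.val_neg, Units.val_one] at this
      linear_combination -this)
    constructor
    · intro h
      have : a = -1 := by rw [← h, neg_neg]
      rw [this]
      exact ⟨by simp, h3⟩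
    · rintro ⟨h4, h5⟩
      have h6 : (a : K) = 1 ∨ (a : K) = -1 := by
        have h7 := congrArg Units.val h4
        rw [Units.val_pow_eq_pow_val, Units.val_one, sq] at h7
        exact mul_self_eq_one_iff.1 h7
      rcases h6 with h6 | h6
      · exact absurd (Units.ext h6) h5
      · refine Units.ext ?_
        rw [Units.val_neg, h6, neg_neg, Units.val_one]

theorem halfSet_one : D.halfSet 1 = ∅ := by
  ext x
  simp [halfSet]

theorem rootSet_one : D.rootSet 1 = D.pos := by
  ext x
  simp [rootSet, halfSet_one]

/-- If `p` is the period of `x`, the stabilizer in the power contributes the exponents `lcm(p, f) /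
p` and its multiples to the sign. This number is odd exactly when the full power of `2` in `f`
divides `p`. -/
theorem compl_pos_pow {s f' : ℕ} (hf' : Odd f') :
    (D.pow (2 ^ s * f')).posᶜ = D.negSet (2 ^ s) := by
  ext x
  rw [Set.mem_compl_iff]
  constructor
  · intro hx
    obtain ⟨k, hk, hs⟩ := (D.pow (2 ^ s * f')).exists_of_notMem_pos hx
    rw [pow_F_pow, F_pow_eq_iff] at hk
    rw [sgn_pow] at hs
    obtain ⟨j, hj⟩ := hk
    rw [hj, sgn_period_mul] at hs
    have hneg : x ∉ D.pos := fun h => by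
      rw [(D.mem_pos_iff x).1 h, one_pow] at hs
      exact absurd hs (by decide)
    refine ⟨hneg, ?_⟩
    have hodd : ¬ 2 ∣ j := by
      rintro ⟨i, rfl⟩
      rw [D.sgn_period_of_notMem hneg, pow_mul] at hs
      norm_num at hs
    have hcop : Nat.Coprime (2 ^ s) j :=
      Nat.Coprime.pow_left s ((Nat.Prime.coprime_iff_not_dvd Nat.prime_two).2 hodd)
    refine hcop.dvd_of_dvd_mul_right ?_
    rw [← hj, mul_assoc]
    exact dvd_mul_right _ _
  · rintro ⟨hneg, c, hc⟩ hx
    have h1 := hx c (by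
      rw [pow_F_pow, F_pow_eq_iff]
      exact ⟨f', by rw [hc]; ring⟩)
    rw [sgn_pow, show 2 ^ s * f' * c = D.period x * f' by rw [hc]; ring, sgn_period_mul,
      D.sgn_period_of_notMem hneg, hf'.neg_one_pow] at h1
    exact absurd h1 (by decide)

variable [Fintype X]

/-- The determinant of `B` on the functions invariant under a power of the signed automorphism. -/
theorem det_quot_pow_pos {f : ℕ} (hf : 0 < f) :
    ((D.pow f).quot (D.pow f).pos).det
      = ∏ d ∈ f.divisors, (D.quot (D.rootSet d)).det ^ Nat.totient d := by
  have : NeZero f := ⟨hf.ne'⟩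
  have h2 : (2 : ℂ) ≠ 0 := two_ne_zero
  obtain ⟨ω, hω⟩ : ∃ ω : ℂˣ, IsPrimitiveRoot ω f := by
    have h := Complex.isPrimitiveRoot_exp f hf.ne'
    refine ⟨(h.isUnit hf.ne').unit, ?_⟩
    rw [← IsPrimitiveRoot.coe_units_iff]
    exact h
  -- Every `f` is invertible in `ℂ`, so the fibration over `ℤ/r` is not needed and `r = 1`.
  have H := D.exists_eigen_equiv (K := ℂ) (r := 1) (n := f) (Nat.cast_ne_zero.2 hf.ne')
    (Nat.coprime_one_left f) hω (Y := Set.univ) (fun _ => by simp) (fun _ => 0)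
    (fun _ _ => Subsingleton.elim _ _) (fun _ _ _ _ _ => rfl)
  rw [one_mul] at H
  obtain ⟨e, he⟩ := H
  have h3 := Matrix.det_eq_prod_of_equiv e he
  rw [eigenSet_univ _ h2, orderOf_one, rootSet_one, Fintype.prod_prod_type] at h3
  simp only [Finset.univ_unique, Finset.prod_singleton] at h3
  have h4 : ∀ t : Fin f, ((D.quot (D.eigenSet Set.univ (ω ^ (t : ℕ)))).det : ℂ)
      = ((D.quot (D.rootSet (orderOf (ω ^ (t : ℕ))))).det : ℂ) := fun t => by
    rw [eigenSet_univ _ h2]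
  rw [Finset.prod_congr rfl fun t _ => h4 t,
    Fin.prod_orderOf_pow hω.eq_orderOf.symm (fun d => ((D.quot (D.rootSet d)).det : ℂ))] at h3
  exact_mod_cast h3

/-- In characteristic 2 signs disappear and only the `f'`-th roots of unity are available. The
factor `2^s` is treated by fibring: the periods on `negSet (2 ^ s)` are divisible by `2^s`, so this
set maps equivariantly to `ℤ/2^s`, giving `2^s` copies of each eigenspace. -/
theorem nullity_compl_pos_pow {s f' : ℕ} (hf' : Odd f') :
    ((D.pow (2 ^ s * f')).quot (D.pow (2 ^ s * f')).posᶜ).nullity (ZMod 2)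
      = ∑ d ∈ f'.divisors, Nat.totient d *
        (2 ^ s * (D.quot (D.negSet (2 ^ s * d))).nullity (ZMod 2)) := by
  have hpos : 0 < f' := hf'.pos
  have : NeZero f' := ⟨hpos.ne'⟩
  have hcop : Nat.Coprime 2 f' := Nat.coprime_two_left.2 hf'
  have hfK : (f' : ZMod 2) ≠ 0 := by
    rw [Ne, ZMod.natCast_eq_zero_iff]
    exact (Nat.Prime.coprime_iff_not_dvd Nat.prime_two).1 hcop
  have : NeZero (f' : ZMod 2) := ⟨hfK⟩
  let K := CyclotomicField f' (ZMod 2)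
  have : FiniteDimensional (ZMod 2) K := IsCyclotomicExtension.finiteDimensional {f'} (ZMod 2) K
  have hfK' : (f' : K) ≠ 0 := by
    have := (algebraMap (ZMod 2) K).injective.ne hfK
    rwa [map_natCast, map_zero] at this
  have h2 : (2 : K) = 0 := by
    have : ((2 : ZMod 2) : ZMod 2) = 0 := rfl
    have := congrArg (algebraMap (ZMod 2) K) this
    rwa [map_ofNat, map_zero] at this
  have hsign : ∀ a : ℤˣ, unitSign K a = 1 := by
    intro a
    rcases Int.units_eq_one_or a with rfl | rfl
    · exact map_one _
    · refine Units.ext ?_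
      simp only [unitSign, Units.coe_map, Units.val_neg, Units.val_one]
      simp only [RingHom.toMonoidHom_eq_coe, MonoidHom.coe_coe, map_neg, map_one]
      linear_combination -h2
  obtain ⟨ω, hω⟩ : ∃ ω : Kˣ, IsPrimitiveRoot ω f' := by
    have h := IsCyclotomicExtension.zeta_spec f' (ZMod 2) K
    refine ⟨(h.isUnit hpos.ne').unit, ?_⟩
    rw [← IsPrimitiveRoot.coe_units_iff]
    exact h
  have hY := D.stable_negSet (2 ^ s)
  -- The fibration `θ` is a coboundary for the constant cochain `1`, written multiplicatively.
  obtain ⟨θ, hθ1, hθ2⟩ := D.isAcyclic.exists_locally_constant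
    (H := Multiplicative (ZMod (2 ^ s))) D.F D.F_adj D.no_inversion (D.negSet (2 ^ s))
    (fun x hx => (hY x).2 hx) (fun _ => Multiplicative.ofAdd 1) (fun _ _ _ _ _ => rfl)
    (fun x hx k hk => by
      rw [orbitProd_const, ← ofAdd_nsmul, nsmul_one,
        (ZMod.natCast_eq_zero_iff k _).2 (hx.2.trans ((D.F_pow_eq_iff k x).1 hk)), ofAdd_zero])
  obtain ⟨e, he⟩ := D.exists_eigen_equiv (K := K) (r := 2 ^ s) (n := f') hfK'
    (Nat.Coprime.pow_left s hcop) hω hY (fun x => (θ x).toAdd)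
    (fun x hx => by rw [hθ1 x hx, toAdd_mul, toAdd_ofAdd, add_comm])
    (fun x hx y hy h => by
      rcases D.B_adj x y h with rfl | h
      · rfl
      · rw [hθ2 x hx y hy h])
  have h3 := Matrix.nullity_eq_sum_of_equiv e he
  have h4 : (D.pow (2 ^ s * f')).eigenSet (D.negSet (2 ^ s)) (1 : Kˣ)
      = (D.pow (2 ^ s * f')).posᶜ := by
    rw [D.compl_pos_pow hf']
    ext x
    rw [mem_eigenSet_iff, hsign, one_pow, one_mul]
    exact and_iff_left rfl
  have h5 : ∀ t : Fin f', D.eigenSet (D.negSet (2 ^ s)) (ω ^ (t : ℕ))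
      = D.negSet (2 ^ s * orderOf (ω ^ (t : ℕ))) := by
    intro t
    ext x
    rw [mem_eigenSet_iff, hsign, mul_one, ← orderOf_dvd_iff_pow_eq_one]
    have hd : orderOf (ω ^ (t : ℕ)) ∣ f' := (orderOf_pow_dvd _).trans hω.eq_orderOf.symm.dvd
    have hc : Nat.Coprime (2 ^ s) (orderOf (ω ^ (t : ℕ))) :=
      Nat.Coprime.pow_left s (hcop.coprime_dvd_right hd)
    refine (and_assoc.trans (and_congr_right fun _ => ⟨fun h => ?_, fun h => ?_⟩))
    · exact hc.mul_dvd_of_dvd_of_dvd h.1 h.2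
    · exact ⟨dvd_of_mul_right_dvd h, dvd_of_mul_left_dvd h⟩
  rw [h4, Fintype.sum_prod_type] at h3
  have h6 : ∀ t : Fin f', (D.quot (D.eigenSet (D.negSet (2 ^ s)) (ω ^ (t : ℕ)))).nullity K
      = (D.quot (D.negSet (2 ^ s * orderOf (ω ^ (t : ℕ))))).nullity K := fun t => by rw [h5]
  simp only [h6] at h3
  have h7 := Fin.prod_orderOf_pow (M := Multiplicative ℕ) hω.eq_orderOf.symm
    (fun d => Multiplicative.ofAdd ((D.quot (D.negSet (2 ^ s * d))).nullity K))
  have h8 : ∑ t : Fin f', (D.quot (D.negSet (2 ^ s * orderOf (ω ^ (t : ℕ))))).nullity K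
      = ∑ d ∈ f'.divisors, Nat.totient d * (D.quot (D.negSet (2 ^ s * d))).nullity K := h7
  rw [h8] at h3
  simp only [Matrix.nullity_extension _ (ZMod 2) K] at h3
  rw [h3, Finset.sum_const, Finset.card_univ, ZMod.card, smul_eq_mul, Finset.mul_sum]
  refine Finset.sum_congr rfl fun d _ => ?_
  ring

end SignedForest

/-! ### Nullity mod 2, divisibility of determinants and a totient identity -/

section nullity

variable {m : Type*} [Fintype m]

theorem Matrix.nullity_add_rank (A : Matrix m m ℤ) (K : Type*) [Field K] :
    A.nullity K + (A.map (Int.castRingHom K)).rank = Fintype.card m := by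
  classical
  rw [nullity, intMulVec_eq_toLin', Matrix.rank, ← Matrix.toLin'_apply', add_comm,
    LinearMap.finrank_range_add_finrank_ker, Module.finrank_fintype_fun_eq_card]

theorem Matrix.nullity_transpose (A : Matrix m m ℤ) (K : Type*) [Field K] :
    A.transpose.nullity K = A.nullity K := by
  have h1 := A.nullity_add_rank K
  have h2 := A.transpose.nullity_add_rank K
  rw [Matrix.transpose_map, Matrix.rank_transpose] at h2
  omega

/-- The cokernel over `ℤ`, of order `|det A|`, surjects onto the cokernel mod 2, of order `2` to the
nullity. -/
theorem Matrix.two_pow_nullity_dvd_det [DecidableEq m] (A : Matrix m m ℤ) :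
    2 ^ A.nullity (ZMod 2) ∣ A.det.natAbs := by
  by_cases hA : A.det = 0
  · simp [hA]
  rw [← A.card_coker hA]
  let R := LinearMap.range (A.intMulVec (ZMod 2) (ZMod 2))
  let φ : (m → ℤ) →ₗ[ℤ] ((m → ZMod 2) ⧸ R) := AddMonoidHom.toIntLinearMap
    (AddMonoidHom.comp (Submodule.mkQ R).toAddMonoidHom
      (AddMonoidHom.mk' (fun (u : m → ℤ) i => (u i : ZMod 2)) fun a b => by
        funext i
        simp))
  have hφ : ∀ u, φ u = Submodule.Quotient.mk fun i => (u i : ZMod 2) := fun u => rfl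
  have hle : LinearMap.range (A.intMulVec ℤ ℤ) ≤ LinearMap.ker φ := by
    rintro _ ⟨u, rfl⟩
    rw [LinearMap.mem_ker, hφ, Submodule.Quotient.mk_eq_zero]
    refine ⟨fun i => (u i : ZMod 2), funext fun i => ?_⟩
    simp [intMulVec_apply]
  have hsurj : Function.Surjective (Submodule.liftQ _ φ hle) := by
    intro c
    induction c using Submodule.Quotient.induction_on with
    | H v =>
      refine ⟨Submodule.Quotient.mk fun i => ((v i).val : ℤ), ?_⟩
      rw [Submodule.liftQ_apply, hφ]
      congr 1
      funext i
      simp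
  have h1 := AddSubgroup.card_dvd_of_surjective
    (Submodule.liftQ _ φ hle).toAddMonoidHom hsurj
  have h2 : Nat.card ((m → ZMod 2) ⧸ R) = 2 ^ A.nullity (ZMod 2) := by
    have h3 : Module.finrank (ZMod 2) ((m → ZMod 2) ⧸ R) = A.nullity (ZMod 2) := by
      have h4 : _ + Module.finrank (ZMod 2) (LinearMap.range (A.intMulVec (ZMod 2) (ZMod 2))) = _ :=
        Submodule.finrank_quotient_add_finrank R
      have h5 := LinearMap.finrank_range_add_finrank_ker (A.intMulVec (ZMod 2) (ZMod 2))
      unfold nullity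
      omega
    rw [Module.natCard_eq_pow_finrank (K := ZMod 2), h3, Nat.card_zmod]
  rwa [h2] at h1

/-- Mod 2 the selected rows vanish outside the selected columns, so a left kernel vector of the
submatrix extends by zero. Transposing does not change nullities. -/
theorem Matrix.nullity_submatrix_le {l : Type*} [Fintype l] (A : Matrix m m ℤ) {i : l → m}
    (hi : Function.Injective i) (h : ∀ a b, b ∉ Set.range i → 2 ∣ A (i a) b) :
    (A.submatrix i i).nullity (ZMod 2) ≤ A.nullity (ZMod 2) := by
  classical
  rw [← nullity_transpose, ← A.nullity_transpose]
  let E : (l → ZMod 2) →ₗ[ZMod 2] (m → ZMod 2) := Function.ExtendByZero.linearMap (ZMod 2) i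
  have hE : ∀ w a, E w (i a) = w a := fun w a => hi.extend_apply w 0 a
  have hE0 : ∀ (w : l → ZMod 2) (b : m), b ∉ Set.range i → E w b = 0 := fun w b hb =>
    Function.extend_apply' w (0 : m → ZMod 2) b hb
  have hsum : ∀ w b, A.transpose.intMulVec (ZMod 2) (ZMod 2) (E w) b = ∑ a, A (i a) b • w a := by
    intro w b
    rw [intMulVec_apply, ← Finset.sum_subset (Finset.subset_univ (Finset.univ.image i)),
      Finset.sum_image fun _ _ _ _ h => hi h]
    · exact Finset.sum_congr rfl fun a _ => by rw [hE, transpose_apply]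
    · intro c _ hc
      rw [hE0 w c (fun ⟨a, ha⟩ => hc (Finset.mem_image.2 ⟨a, Finset.mem_univ _, ha⟩)), smul_zero]
  have hmem : ∀ w : LinearMap.ker ((A.submatrix i i).transpose.intMulVec (ZMod 2) (ZMod 2)),
      E w.1 ∈ LinearMap.ker (A.transpose.intMulVec (ZMod 2) (ZMod 2)) := by
    rintro ⟨w, hw⟩
    rw [LinearMap.mem_ker] at hw ⊢
    funext b
    rw [hsum]
    by_cases hb : b ∈ Set.range i
    · obtain ⟨b, rfl⟩ := hb
      exact congrFun hw b
    · refine Finset.sum_eq_zero fun a _ => ?_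
      obtain ⟨c, hc⟩ := h a b hb
      rw [hc, zsmul_eq_mul, Int.cast_mul, Int.cast_ofNat, show (2 : ZMod 2) = 0 from rfl,
        zero_mul, zero_mul]
  exact LinearMap.finrank_le_finrank_of_injective
    (f := (E.comp (Submodule.subtype _)).codRestrict _ hmem) (by
      intro w w' hww
      have h1 : E w.1 = E w'.1 := congrArg Subtype.val hww
      refine Subtype.ext (funext fun a => ?_)
      rw [← hE w.1 a, ← hE w'.1 a, h1])

theorem Matrix.nullity_eq_add {l₁ l₂ : Type*} [Fintype l₁] [Fintype l₂] (A : Matrix m m ℤ)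
    {i₁ : l₁ → m} {i₂ : l₂ → m} (hi : Function.Bijective (Sum.elim i₁ i₂))
    (h₁ : ∀ a b, A (i₁ a) (i₂ b) = 0) (h₂ : ∀ a b, A (i₂ b) (i₁ a) = 0) (K : Type*) [Field K] :
    A.nullity K = (A.submatrix i₁ i₁).nullity K + (A.submatrix i₂ i₂).nullity K := by
  let e := Equiv.ofBijective _ hi
  have hs : ∀ u : m → K, ∀ b, A.intMulVec K K u b
      = ∑ a, A b (i₁ a) • u (i₁ a) + ∑ a, A b (i₂ a) • u (i₂ a) := by
    intro u b
    rw [intMulVec_apply, ← Equiv.sum_comp e, Fintype.sum_sum_type]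
    rfl
  have hs₁ : ∀ u : m → K, ∀ b, A.intMulVec K K u (i₁ b)
      = (A.submatrix i₁ i₁).intMulVec K K (u ∘ i₁) b := by
    intro u b
    rw [hs, Finset.sum_eq_zero (s := (Finset.univ : Finset l₂)) fun a _ => by rw [h₁, zero_smul],
      add_zero]
    rfl
  have hs₂ : ∀ u : m → K, ∀ b, A.intMulVec K K u (i₂ b)
      = (A.submatrix i₂ i₂).intMulVec K K (u ∘ i₂) b := by
    intro u b
    rw [hs, Finset.sum_eq_zero (s := (Finset.univ : Finset l₁)) fun a _ => by rw [h₂, zero_smul],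
      zero_add]
    rfl
  unfold nullity
  rw [← Module.finrank_prod]
  refine LinearEquiv.finrank_eq
    { toFun := fun u => (⟨u.1 ∘ i₁, by
          rw [LinearMap.mem_ker]
          funext b
          rw [← hs₁, LinearMap.mem_ker.1 u.2]
          rfl⟩, ⟨u.1 ∘ i₂, by
          rw [LinearMap.mem_ker]
          funext b
          rw [← hs₂, LinearMap.mem_ker.1 u.2]
          rfl⟩)
      invFun := fun w => ⟨Sum.elim w.1.1 w.2.1 ∘ e.symm, by
        have hw₁ : (Sum.elim w.1.1 w.2.1 ∘ e.symm) ∘ i₁ = w.1.1 := by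
          funext a
          change Sum.elim w.1.1 w.2.1 (e.symm (e (Sum.inl a))) = _
          rw [e.symm_apply_apply]
          rfl
        have hw₂ : (Sum.elim w.1.1 w.2.1 ∘ e.symm) ∘ i₂ = w.2.1 := by
          funext a
          change Sum.elim w.1.1 w.2.1 (e.symm (e (Sum.inr a))) = _
          rw [e.symm_apply_apply]
          rfl
        rw [LinearMap.mem_ker]
        funext b
        obtain ⟨a | a, rfl⟩ := e.surjective b
        · refine (hs₁ _ a).trans ?_
          rw [hw₁, LinearMap.mem_ker.1 w.1.2]
          rfl
        · refine (hs₂ _ a).trans ?_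
          rw [hw₂, LinearMap.mem_ker.1 w.2.2]
          rfl⟩
      left_inv := fun u => Subtype.ext (funext fun b => by
        obtain ⟨a | a, rfl⟩ := e.surjective b
        · change Sum.elim _ _ (e.symm (e (Sum.inl a))) = _
          rw [e.symm_apply_apply]
          rfl
        · change Sum.elim _ _ (e.symm (e (Sum.inr a))) = _
          rw [e.symm_apply_apply]
          rfl)
      right_inv := fun w => Prod.ext
        (Subtype.ext (funext fun a => by
          change Sum.elim w.1.1 w.2.1 (e.symm (e (Sum.inl a))) = _
          rw [e.symm_apply_apply]
          rfl))
        (Subtype.ext (funext fun a => by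
          change Sum.elim w.1.1 w.2.1 (e.symm (e (Sum.inr a))) = _
          rw [e.symm_apply_apply]
          rfl))
      map_add' := fun _ _ => rfl
      map_smul' := fun _ _ => rfl }

end nullity

theorem Nat.sum_divisors_two_pow_succ_mul {M : Type*} [AddCommMonoid M] (s : ℕ) {n : ℕ}
    (hn : Odd n) (F : ℕ → M) :
    ∑ d ∈ (2 ^ (s + 1) * n).divisors, F d
      = ∑ d ∈ (2 ^ s * n).divisors, F d + ∑ d ∈ n.divisors, F (2 ^ (s + 1) * d) := by
  classical
  have hn0 : n ≠ 0 := hn.pos.ne'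
  have h1 : (2 ^ (s + 1) * n).divisors
      = (2 ^ s * n).divisors ∪ n.divisors.image (fun d => 2 ^ (s + 1) * d) := by
    ext d
    simp only [Nat.mem_divisors, Finset.mem_union, Finset.mem_image, ne_eq, mul_eq_zero,
      pow_eq_zero_iff', OfNat.ofNat_ne_zero, false_and, hn0, or_self, not_false_eq_true, and_true]
    constructor
    · intro h
      obtain ⟨a, b, ha, hb, rfl⟩ := (Nat.dvd_mul).1 h
      obtain ⟨i, hi, rfl⟩ := (Nat.dvd_prime_pow Nat.prime_two).1 ha
      rcases Nat.lt_or_ge i (s + 1) with h' | h'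
      · exact Or.inl (mul_dvd_mul (pow_dvd_pow 2 (by omega)) hb)
      · obtain rfl : i = s + 1 := by omega
        exact Or.inr ⟨b, hb, rfl⟩
    · rintro (h | ⟨b, hb, rfl⟩)
      · exact h.trans (mul_dvd_mul_right (pow_dvd_pow 2 (by omega)) n)
      · exact mul_dvd_mul_left _ hb
  rw [h1, Finset.sum_union, Finset.sum_image]
  · intro a _ b _ hab
    exact Nat.eq_of_mul_eq_mul_left (by positivity) hab
  · rw [Finset.disjoint_left]
    rintro d hd hd'
    obtain ⟨b, hb, rfl⟩ := Finset.mem_image.1 hd'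
    have h2 := Nat.dvd_of_mem_divisors hd
    rw [pow_succ, mul_assoc] at h2
    have h3 := Nat.dvd_of_mul_dvd_mul_left (by positivity) h2
    exact (Nat.not_even_iff_odd.2 hn) (even_iff_two_dvd.2 (dvd_of_mul_right_dvd h3))

/-- Induction on `s`: the new divisors are `2^(s+1) d` with `d ∣ n`, and `φ(2^(s+1) d) = 2^s φ(d)`.
Replacing `m(2^s d)` by `h(2^(s+1) d) + m(2^(s+1) d)` balances the two sides. -/
theorem Nat.sum_totient_two_pow_mul {n : ℕ} (hn : Odd n) (h m : ℕ → ℕ)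
    (h_odd : ∀ d, Odd d → h d = 0) (h_even : ∀ e, h (2 * e) + m (2 * e) = m e) (s : ℕ) :
    ∑ d ∈ (2 ^ s * n).divisors, Nat.totient d * h d
        + ∑ d ∈ n.divisors, Nat.totient d * (2 ^ s * m (2 ^ s * d))
      = ∑ d ∈ (2 ^ s * n).divisors, Nat.totient d * m d := by
  induction s with
  | zero =>
    simp only [pow_zero, one_mul]
    rw [Finset.sum_eq_zero, zero_add]
    intro d hd
    rw [h_odd d (hn.of_dvd_nat (Nat.dvd_of_mem_divisors hd)), mul_zero]
  | succ s ih =>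
    rw [Nat.sum_divisors_two_pow_succ_mul s hn, Nat.sum_divisors_two_pow_succ_mul s hn, ← ih,
      add_assoc, add_assoc, ← Finset.sum_add_distrib, ← Finset.sum_add_distrib]
    congr 1
    refine Finset.sum_congr rfl fun d hd => ?_
    have hd' : Odd d := hn.of_dvd_nat (Nat.dvd_of_mem_divisors hd)
    have h1 : Nat.totient (2 ^ (s + 1) * d) = 2 ^ s * Nat.totient d := by
      rw [Nat.totient_mul (Nat.Coprime.pow_left _ (Nat.coprime_two_left.2 hd')),
        Nat.totient_prime_pow_succ Nat.prime_two]
      simp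
    have h2 := h_even (2 ^ s * d)
    rw [← mul_assoc, ← pow_succ'] at h2
    rw [h1, ← h2]
    ring

/-! ### Construction of the factors `a_d` -/

namespace SignedForest

variable {X : Type*} (D : SignedForest X)

theorem negSet_eq_union (e : ℕ) : D.negSet e = D.halfSet (2 * e) ∪ D.negSet (2 * e) := by
  ext x
  simp only [negSet, halfSet, Set.mem_union, Set.mem_ofPred_eq]
  rw [Nat.mul_dvd_mul_iff_left two_pos]
  have : 2 * e ∣ D.period x → e ∣ D.period x := fun h => dvd_of_mul_left_dvd h
  tauto

theorem halfSet_odd {d : ℕ} (hd : Odd d) : D.halfSet d = ∅ := by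
  ext x
  simp only [halfSet, Set.mem_ofPred_eq, Set.mem_empty_iff_false, iff_false]
  rintro ⟨-, h1, h2⟩
  exact h2 ((Nat.coprime_two_right.2 hd).dvd_of_dvd_mul_left h1)

/-- The period of `x` is an odd multiple `e c`, that of `y` an even multiple `2 e c'`. Hence the
common multiple `2 e c c'` of the periods winds an even number of times around the orbit of `x` and
an odd number around that of `y`. -/
theorem exists_sgn_ne {e : ℕ} {x y : X} (hx : x ∈ D.halfSet (2 * e)) (hy : y ∈ D.negSet (2 * e)) :
    ∃ k, D.sgn k x ≠ D.sgn k y := by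
  obtain ⟨hx0, hx1, hx2⟩ := hx
  obtain ⟨hy0, c', hc'⟩ := hy
  obtain ⟨c, hc⟩ := Nat.dvd_of_mul_dvd_mul_left two_pos hx1
  have hodd : Odd c := by
    rw [← Nat.not_even_iff_odd, even_iff_two_dvd]
    rintro ⟨b, rfl⟩
    exact hx2 ⟨b, by rw [hc]; ring⟩
  refine ⟨D.period y * c, ?_⟩
  rw [sgn_period_mul, D.sgn_period_of_notMem hy0, hodd.neg_one_pow,
    show D.period y * c = D.period x * (2 * c') by rw [hc, hc']; ring, sgn_period_mul,
    D.sgn_period_of_notMem hx0, pow_mul]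
  simp

variable [Fintype X]

theorem rowSum_eq_zero {x : X} {O : D.Orbit} {Y : Set X} (hY : D.Stable Y) (hO : O.out ∈ Y)
    (h : ∀ y ∈ Y, D.B x y = 0) : D.rowSum x O = 0 := by
  classical
  refine Finset.sum_eq_zero fun y hy => h y ((hY.out_mem y).1 ?_)
  rw [(Finset.mem_filter.1 hy).2]
  exact hO

/-- The set `negSet e` is the disjoint union of the other two, and `B` has no entries between them:
signs of iterates agree across nonzero entries, but `exists_sgn_ne` distinguishes the two sets. -/
theorem nullity_halfSet_add (e : ℕ) (K : Type*) [Field K] :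
    (D.quot (D.halfSet (2 * e))).nullity K + (D.quot (D.negSet (2 * e))).nullity K
      = (D.quot (D.negSet e)).nullity K := by
  have hu := D.negSet_eq_union e
  have hsub1 : D.halfSet (2 * e) ⊆ D.negSet e := hu ▸ Set.subset_union_left
  have hsub2 : D.negSet (2 * e) ⊆ D.negSet e := hu ▸ Set.subset_union_right
  have hdisj : ∀ x, x ∈ D.halfSet (2 * e) → x ∉ D.negSet (2 * e) := fun x h h' => h.2.2 h'.2
  symm
  refine Matrix.nullity_eq_add (D.quot (D.negSet e))
    (i₁ := fun O : D.OrbitIn (D.halfSet (2 * e)) => ⟨O.1, hsub1 O.2⟩)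
    (i₂ := fun O : D.OrbitIn (D.negSet (2 * e)) => ⟨O.1, hsub2 O.2⟩) ⟨?_, ?_⟩ ?_ ?_ K
  · rintro (⟨a, ha⟩ | ⟨a, ha⟩) (⟨b, hb⟩ | ⟨b, hb⟩) h
    · obtain rfl : a = b := congrArg Subtype.val h
      rfl
    · obtain rfl : a = b := congrArg Subtype.val h
      exact absurd hb (hdisj _ ha)
    · obtain rfl : a = b := congrArg Subtype.val h
      exact absurd ha (hdisj _ hb)
    · obtain rfl : a = b := congrArg Subtype.val h
      rfl
  · rintro ⟨O, hO⟩
    rw [hu] at hO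
    rcases hO with hO | hO
    · exact ⟨Sum.inl ⟨O, hO⟩, rfl⟩
    · exact ⟨Sum.inr ⟨O, hO⟩, rfl⟩
  · intro a b
    refine D.rowSum_eq_zero (D.stable_negSet (2 * e)) b.2 fun y hy => ?_
    by_contra hB
    obtain ⟨k, hk⟩ := D.exists_sgn_ne a.2 hy
    exact hk (D.sgn_B k _ _ hB)
  · intro a b
    refine D.rowSum_eq_zero (D.stable_halfSet (2 * e)) a.2 fun y hy => ?_
    by_contra hB
    obtain ⟨k, hk⟩ := D.exists_sgn_ne hy b.2
    exact hk (D.sgn_B k _ _ hB).symm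

/-- The row sum weighted by the signs `χ` vanishes, and mod 2 the weights are invisible. -/
theorem two_dvd_rowSum {x : X} (hx : x ∉ D.pos) {O : D.Orbit} (hO : O.out ∈ D.pos) :
    2 ∣ D.rowSum x O := by
  classical
  obtain ⟨χ, hχ⟩ := D.exists_isTwist_pos
  have h1 := hχ.rowSum_pos_eq_zero hx O
  have h2 : D.rowSum x O = D.rowSum x O
      - ∑ y with D.orbit y = O, (if y ∈ D.pos then D.B x y * (χ y : ℤ) else 0) := by
    rw [h1, sub_zero]
  rw [h2, rowSum, ← Finset.sum_sub_distrib]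
  refine Finset.dvd_sum fun y hy => ?_
  have hy' : y ∈ D.pos := (D.stable_pos.out_mem y).1 (by
    rw [(Finset.mem_filter.1 hy).2]; exact hO)
  rw [if_pos hy']
  rcases Int.units_eq_one_or (χ y) with h | h
  · simp [h]
  · rw [h]
    exact ⟨D.B x y, by push_cast; ring⟩

/-- The rows of negative orbits in `rootSet d` have even entries in the columns of positive orbits,
so the nullity mod 2 of the negative block bounds that of the whole matrix from below. -/
theorem two_pow_nullity_halfSet_dvd (d : ℕ) :
    2 ^ (D.quot (D.halfSet d)).nullity (ZMod 2) ∣ (D.quot (D.rootSet d)).det.natAbs := by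
  refine dvd_trans (pow_dvd_pow 2 ?_) (D.quot (D.rootSet d)).two_pow_nullity_dvd_det
  refine Matrix.nullity_submatrix_le (D.quot (D.rootSet d))
    (i := fun O : D.OrbitIn (D.halfSet d) => ⟨O.1, Or.inr O.2⟩) (fun a b h => ?_) fun a b hb => ?_
  · have h' := congrArg Subtype.val h
    exact Subtype.ext h'
  · refine D.two_dvd_rowSum a.2.1 ?_
    rcases b.2 with h | h
    · exact h.1
    · exact absurd ⟨⟨b.1, h⟩, rfl⟩ hb

/-- The number of solutions of `B h = 0` in functions with values in `ℚ/ℤ` that are invariant under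
the `f`-th power of the signed automorphism. -/
def numSolutions (f : ℕ) : ℕ :=
  Nat.card {h : X → AddCircle (1 : ℚ) // D.B.intMulVec ℤ _ h = 0 ∧
    ∀ x, h ((D.F ^ f) x) = (D.sgn f x : ℤ) • h x}

theorem exists_numSolutions_eq [DecidableEq X] (hB : D.B.det ≠ 0) :
    ∃ a : ℕ → ℕ, (∀ d, 0 < d → 0 < a d) ∧
      ∀ f, 0 < f → D.numSolutions f = ∏ d ∈ f.divisors, a d ^ Nat.totient d := by
  -- This determinant occurs with positive exponent `φ(d)` in the nonzero determinant attached to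
  -- the `d`-th power.
  have hne : ∀ d, 0 < d → (D.quot (D.rootSet d)).det ≠ 0 := by
    intro d hd
    have h1 := det_quot_pos_ne_zero (D := D.pow d) hB
    rw [D.det_quot_pow_pos hd, Finset.prod_ne_zero_iff] at h1
    have h2 := h1 d (Nat.mem_divisors_self d hd.ne')
    exact fun h => h2 (by rw [h, zero_pow (Nat.totient_pos.2 hd).ne'])
  choose b hb using D.two_pow_nullity_halfSet_dvd
  -- `b d` is the determinant on `rootSet d` divided by `2^h(d)`; the factor `2^m(d)` comes from the
  -- nullity on `negSet d`.
  refine ⟨fun d => b d * 2 ^ (D.quot (D.negSet d)).nullity (ZMod 2), fun d hd => ?_, fun f hf => ?_⟩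
  · refine Nat.mul_pos (Nat.pos_of_ne_zero fun h => hne d hd ?_) (by positivity)
    rw [← Int.natAbs_eq_zero, hb, h, mul_zero]
  · obtain ⟨s, f', hf', rfl⟩ := Nat.exists_eq_two_pow_mul_odd hf.ne'
    have h1 := card_solutions (D := D.pow (2 ^ s * f')) hB
    refine Eq.trans h1 ?_
    rw [D.det_quot_pow_pos hf, ← Matrix.nullity, D.nullity_compl_pos_pow hf',
      ← Int.natAbsHom_apply, map_prod]
    have h2 := Nat.sum_totient_two_pow_mul hf'
      (fun d => (D.quot (D.halfSet d)).nullity (ZMod 2))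
      (fun d => (D.quot (D.negSet d)).nullity (ZMod 2))
      (fun d hd => by
        rw [D.halfSet_odd hd]
        have : IsEmpty (D.OrbitIn ∅) := ⟨fun O => O.2⟩
        exact Module.finrank_zero_of_subsingleton) (fun e => D.nullity_halfSet_add e (ZMod 2)) s
    have h3 : ∀ d ∈ (2 ^ s * f').divisors,
        Int.natAbsHom ((D.quot (D.rootSet d)).det ^ Nat.totient d)
          = 2 ^ (Nat.totient d * (D.quot (D.halfSet d)).nullity (ZMod 2))
            * b d ^ Nat.totient d := by
      intro d _
      rw [map_pow, Int.natAbsHom_apply, hb, mul_pow, ← pow_mul, mul_comm (Nat.totient d)]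
    rw [Finset.prod_congr rfl h3, Finset.prod_mul_distrib, Finset.prod_pow_eq_pow_sum,
      mul_right_comm, ← pow_add, h2, ← Finset.prod_pow_eq_pow_sum, ← Finset.prod_mul_distrib]
    refine Finset.prod_congr rfl fun d _ => ?_
    rw [mul_pow, ← pow_mul, mul_comm (Nat.totient d), mul_comm]

end SignedForest

/-! ### Oriented forests and their block matrix -/

/-- A finite forest with oriented edges of positive integral length and a set `S` of vertices
meeting every component, with a signed automorphism preserving the orientations. -/
structure OrientedForest (E P : Type*) where
  src : E → P
  tgt : E → P
  len : E → ℕ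
  len_pos : ∀ e, 0 < len e
  S : Set P
  FE : Equiv.Perm E
  FP : Equiv.Perm P
  src_F : ∀ e, src (FE e) = FP (src e)
  tgt_F : ∀ e, tgt (FE e) = FP (tgt e)
  len_F : ∀ e, len (FE e) = len e
  S_F : ∀ p, FP p ∈ S ↔ p ∈ S
  sE : E → ℤˣ
  sP : P → ℤˣ
  sign_src : ∀ e, src e ∉ S → sE e = sP (src e)
  sign_tgt : ∀ e, tgt e ∉ S → sE e = sP (tgt e)
  -- Acyclicity: `e` is the only edge crossing some partition of the points.
  cut : ∀ e, ∃ A : Set P, src e ∈ A ∧ tgt e ∉ A ∧ ∀ e', e' ≠ e → (src e' ∈ A ↔ tgt e' ∈ A)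
  -- Every component meets `S`; this makes the relative boundary map surjective.
  meets : ∀ Q : Set P, S ⊆ Q → (∀ e, src e ∈ Q ↔ tgt e ∈ Q) → ∀ p, p ∈ Q

namespace OrientedForest

variable {E P : Type*} (T : OrientedForest E P)

/-- The vertices outside `S`. -/
abbrev Free : Type _ := {p : P // p ∉ T.S}

open Classical in
/-- The coefficient of a vertex in the boundary of an edge. -/
def inc (w : T.Free) (e : E) : ℤ :=
  (if w.1 = T.tgt e then 1 else 0) - (if w.1 = T.src e then 1 else 0)

theorem inc_eq [DecidableEq P] (w : T.Free) (e : E) : T.inc w e =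
    (if w.1 = T.tgt e then 1 else 0) - (if w.1 = T.src e then 1 else 0) := by
  unfold inc
  congr

/-- The permutation of the vertices outside `S`. -/
def FW : Equiv.Perm T.Free := T.FP.subtypePerm fun p => not_congr (T.S_F p)

theorem inc_F (w : T.Free) (e : E) : T.inc (T.FW w) (T.FE e) = T.inc w e := by
  classical
  have h : ∀ p, ((T.FW w).1 = T.FP p) = (w.1 = p) := fun p => propext T.FP.injective.eq_iff
  unfold inc
  rw [T.src_F, T.tgt_F]
  congr 1 <;> exact if_congr (Iff.of_eq (h _)) rfl rfl

theorem inc_ne_zero {w : T.Free} {e : E} (h : T.inc w e ≠ 0) : T.src e = w ∨ T.tgt e = w := by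
  unfold inc at h
  by_contra! hne
  rw [if_neg hne.2.symm, if_neg hne.1.symm] at h
  exact h rfl

/-- The barycentric subdivision, without the vertices in `S`. -/
def incidence : SimpleGraph (E ⊕ T.Free) where
  Adj
    | .inl e, .inr w => T.src e = w ∨ T.tgt e = w
    | .inr w, .inl e => T.src e = w ∨ T.tgt e = w
    | _, _ => False
  symm := ⟨by rintro (e | w) (e' | w') h <;> exact h⟩
  loopless := ⟨by rintro (e | w) h <;> exact h⟩

/-- Each incidence of an edge `e` with an endpoint is a bridge, because the cut of `e` separates
them once `e` itself is placed on the side of the other endpoint. -/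
theorem incidence_isAcyclic : T.incidence.IsAcyclic := by
  have key : ∀ e w, T.src e = (w : T.Free).1 ∨ T.tgt e = w.1 →
      T.incidence.IsBridge s(.inl e, .inr w) := by
    intro e w hew
    rw [SimpleGraph.isBridge_iff]
    obtain ⟨A, hs, ht, hA⟩ := T.cut e
    intro hr
    rw [SimpleGraph.reachable_iff_reflTransGen] at hr
    have inv : ∀ Q : Set (E ⊕ T.Free),
        (∀ e' w', (T.src e' = (w' : T.Free).1 ∨ T.tgt e' = w'.1) → ¬ (e' = e ∧ w' = w) →
          (Sum.inl e' ∈ Q ↔ Sum.inr w' ∈ Q)) → Sum.inl e ∈ Q → Sum.inr w ∈ Q := by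
      intro Q hQ he
      have : ∀ y, Relation.ReflTransGen
          (T.incidence.deleteEdges {s(.inl e, .inr w)}).Adj (.inl e) y → y ∈ Q := by
        intro y hy
        induction hy with
        | refl => exact he
        | @tail b c _ hbc ih =>
          rw [SimpleGraph.deleteEdges_adj] at hbc
          obtain ⟨hadj, hne⟩ := hbc
          rcases b with e' | w' <;> rcases c with e'' | w''
          · exact absurd hadj id
          · refine (hQ e' w'' hadj ?_).1 ih
            rintro ⟨rfl, rfl⟩
            exact hne rfl
          · refine (hQ e'' w' hadj ?_).2 ih
            rintro ⟨rfl, rfl⟩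
            exact hne Sym2.eq_swap
          · exact absurd hadj id
      exact this _ hr
    rcases hew with hw | hw
    · have := inv {y | Sum.elim (fun e' => e' = e ∨ T.src e' ∉ A) (fun w' : T.Free => w'.1 ∉ A) y}
        (fun e' w' h hne => ?_) (Or.inl rfl)
      · exact this (by rw [← hw]; exact hs)
      · change (e' = e ∨ T.src e' ∉ A) ↔ w'.1 ∉ A
        by_cases hee : e' = e
        · subst hee
          rcases h with h | h
          · exact absurd ⟨rfl, Subtype.ext (h.symm.trans hw)⟩ hne
          · rw [← h]
            simp [ht]
        · rcases h with h | h
          · rw [← h]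
            simp [hee]
          · rw [← h, ← hA e' hee]
            simp [hee]
    · have := inv {y | Sum.elim (fun e' => T.src e' ∈ A) (fun w' : T.Free => w'.1 ∈ A) y}
        (fun e' w' h hne => ?_) hs
      · exact ht (by rw [hw]; exact this)
      · change T.src e' ∈ A ↔ w'.1 ∈ A
        by_cases hee : e' = e
        · subst hee
          rcases h with h | h
          · rw [h]
          · exact absurd ⟨rfl, Subtype.ext (h.symm.trans hw)⟩ hne
        · rcases h with h | h
          · rw [h]
          · rw [← h, hA e' hee]
  rw [SimpleGraph.isAcyclic_iff_forall_adj_isBridge]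
  rintro (e | w) (e' | w') h
  · exact absurd h id
  · exact key _ _ h
  · rw [Sym2.eq_swap]
    exact key _ _ h
  · exact absurd h id

open Classical in
/-- The symmetric matrix whose cokernel is the component group. -/
def matrix : Matrix (E ⊕ T.Free) (E ⊕ T.Free) ℤ :=
  Matrix.fromBlocks (Matrix.diagonal fun e => (T.len e : ℤ)) (Matrix.of T.inc).transpose
    (Matrix.of T.inc) 0

/-- The signed forest attached to an oriented forest. -/
def toSignedForest : SignedForest (E ⊕ T.Free) where
  graph := T.incidence
  isAcyclic := T.incidence_isAcyclic
  F := Equiv.sumCongr T.FE T.FW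
  F_adj := by
    have key : ∀ e (w : T.Free), T.src e = w.1 ∨ T.tgt e = w.1 →
        T.src (T.FE e) = (T.FW w).1 ∨ T.tgt (T.FE e) = (T.FW w).1 := by
      intro e w h
      rw [T.src_F, T.tgt_F]
      exact h.imp (congrArg T.FP) (congrArg T.FP)
    rintro (e | w) (e' | w') h
    · exact h
    · exact key _ _ h
    · exact key _ _ h
    · exact h
  -- Iterates preserve the distinction between edges and vertices, so they cannot exchange two
  -- adjacent points.
  no_inversion k x y h := by
    have hk : ∀ (k : ℕ) e, ∃ e', ((Equiv.sumCongr T.FE T.FW) ^ k : Equiv.Perm _) (Sum.inl e)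
        = Sum.inl e' := by
      intro k e
      induction k with
      | zero => exact ⟨e, rfl⟩
      | succ k ih =>
        obtain ⟨e', he'⟩ := ih
        exact ⟨T.FE e', by rw [pow_succ', Equiv.Perm.mul_apply, he']; rfl⟩
    rintro ⟨h1, h2⟩
    rcases x with e | w <;> rcases y with e' | w'
    · exact h
    · obtain ⟨e', he'⟩ := hk k e
      rw [he'] at h1
      exact absurd h1 Sum.inl_ne_inr
    · obtain ⟨e', he'⟩ := hk k e'
      rw [he'] at h2
      exact absurd h2 Sum.inl_ne_inr
    · exact h
  s := Sum.elim T.sE fun w => T.sP w.1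
  s_adj := by
    have key : ∀ e (w : T.Free), T.src e = w.1 ∨ T.tgt e = w.1 → T.sE e = T.sP w.1 := by
      rintro e w (h | h)
      · rw [← h]
        exact T.sign_src e (h ▸ w.2)
      · rw [← h]
        exact T.sign_tgt e (h ▸ w.2)
    rintro (e | w) (e' | w') h
    · exact absurd h id
    · exact key _ _ h
    · exact (key _ _ h).symm
    · exact absurd h id
  B := T.matrix
  B_F := by
    classical
    rintro (e | w) (e' | w')
    · simp only [matrix, Equiv.sumCongr_apply, Sum.map_inl, Matrix.fromBlocks_apply₁₁,
        Matrix.diagonal_apply, T.FE.injective.eq_iff, T.len_F]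
    · exact T.inc_F _ _
    · exact T.inc_F _ _
    · rfl
  B_adj := by
    classical
    rintro (e | w) (e' | w') h
    · left
      by_contra hne
      refine h ?_
      rw [matrix, Matrix.fromBlocks_apply₁₁]
      exact Matrix.diagonal_apply_ne _ fun h' => hne (congrArg _ h')
    · exact Or.inr (T.inc_ne_zero h)
    · exact Or.inr (T.inc_ne_zero h)
    · exact absurd rfl h

section homology

variable [Fintype E]

/-- The boundary map on chains relative to `S`. -/
def boundary : (E → ℤ) →ₗ[ℤ] (T.Free → ℤ) where
  toFun c w := ∑ e, T.inc w e * c e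
  map_add' a b := funext fun w => by
    simp only [Pi.add_apply, mul_add, Finset.sum_add_distrib]
  map_smul' n a := funext fun w => by
    simp only [Pi.smul_apply, smul_eq_mul, RingHom.id_apply, Finset.mul_sum]
    exact Finset.sum_congr rfl fun _ _ => mul_left_comm _ _ _

theorem boundary_apply (c : E → ℤ) (w : T.Free) : T.boundary c w = ∑ e, T.inc w e * c e := rfl

/-- The points whose class is a boundary include `S`, where the class is zero, and form a set closed
under passing along edges. -/
theorem exists_boundary_eq_single (w : T.Free) [DecidableEq T.Free] :
    ∃ c, T.boundary c = Pi.single w 1 := by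
  classical
  let δ : P → T.Free → ℤ := fun p w => if w.1 = p then 1 else 0
  have h1 : ∀ e, T.boundary (Pi.single e 1) = δ (T.tgt e) - δ (T.src e) := by
    intro e
    funext w
    rw [boundary_apply, Finset.sum_eq_single e]
    · simp [δ, inc]
    · intro e' _ h
      simp [h]
    · simp
  obtain ⟨c, hc⟩ := T.meets {p | ∃ c, T.boundary c = δ p}
    (fun p hp => ⟨0, by
      rw [map_zero]
      funext w
      exact (if_neg fun h : w.1 = p => w.2 (h ▸ hp)).symm⟩)
    (fun e => ⟨fun ⟨c, hc⟩ => ⟨c + Pi.single e 1, by rw [map_add, hc, h1]; abel⟩,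
      fun ⟨c, hc⟩ => ⟨c - Pi.single e 1, by rw [map_sub, hc, h1]; abel⟩⟩) w.1
  refine ⟨c, hc.trans (funext fun w' => ?_)⟩
  simp only [δ, Pi.single_apply, Subtype.ext_iff]

variable [Fintype P]

open Classical in
instance : Fintype T.Free := Fintype.ofFinite _

theorem exists_section : ∃ σ : (T.Free → ℤ) →ₗ[ℤ] (E → ℤ), ∀ y, T.boundary (σ y) = y := by
  classical
  choose c hc using fun w => T.exists_boundary_eq_single w
  refine ⟨∑ w, (LinearMap.proj w).smulRight (c w), fun y => ?_⟩
  rw [LinearMap.sum_apply, map_sum]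
  simp only [LinearMap.smulRight_apply, LinearMap.proj_apply, map_smul, hc]
  funext w
  rw [Finset.sum_apply, Finset.sum_eq_single w]
  · simp
  · intro w' _ h
    simp [h.symm]
  · simp

theorem sum_mul_boundary (φ : T.Free → ℤ) (c : E → ℤ) :
    ∑ w, φ w * T.boundary c w = ∑ e, (∑ w, T.inc w e * φ w) * c e := by
  simp only [boundary_apply, Finset.mul_sum, Finset.sum_mul]
  rw [Finset.sum_comm]
  exact Finset.sum_congr rfl fun _ _ => Finset.sum_congr rfl fun _ _ => by ring

theorem matrix_mulVec_inl (z : E ⊕ T.Free → ℤ) (e : E) :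
    T.matrix.intMulVec ℤ ℤ z (.inl e)
      = T.len e * z (.inl e) + ∑ w, T.inc w e * z (.inr w) := by
  classical
  rw [Matrix.intMulVec_apply, Fintype.sum_sum_type]
  congr 1
  rw [Finset.sum_eq_single e]
  · simp [matrix]
  · intro e' _ h
    simp [matrix, Matrix.diagonal_apply_ne _ h.symm]
  · simp

theorem matrix_mulVec_inr (z : E ⊕ T.Free → ℤ) (w : T.Free) :
    T.matrix.intMulVec ℤ ℤ z (.inr w) = T.boundary (fun e => z (.inl e)) w := by
  rw [Matrix.intMulVec_apply, Fintype.sum_sum_type, boundary_apply]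
  simp [matrix]

/-- For a kernel vector `(c, φ)`, pairing `L c + ∂ᵀ φ = 0` with the cycle `c` leaves a sum of `len ·
c²`, so `c = 0`. Then `∂ᵀ φ = 0`, and `φ = 0` because `∂` is surjective. -/
theorem det_matrix_ne_zero [DecidableEq (E ⊕ T.Free)] : T.matrix.det ≠ 0 := by
  intro h0
  obtain ⟨z, hz, hz0⟩ := Matrix.exists_mulVec_eq_zero_iff.2 h0
  obtain ⟨σ, hσ⟩ := T.exists_section
  have h0 : T.matrix.intMulVec ℤ ℤ z = 0 := hz0
  let c : E → ℤ := fun e => z (.inl e)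
  let φ : T.Free → ℤ := fun w => z (.inr w)
  have h1 : ∀ e, T.len e * c e + ∑ w, T.inc w e * φ w = 0 := fun e => by
    rw [← T.matrix_mulVec_inl z e, h0]; rfl
  have h2 : T.boundary c = 0 := funext fun w => by rw [← T.matrix_mulVec_inr z w, h0]; rfl
  have h3 : ∑ e, (T.len e : ℤ) * (c e * c e) = 0 := by
    have h4 := T.sum_mul_boundary φ c
    rw [h2] at h4
    simp only [Pi.zero_apply, mul_zero, Finset.sum_const_zero] at h4
    have h5 : ∑ e, (T.len e * c e + ∑ w, T.inc w e * φ w) * c e = 0 :=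
      Finset.sum_eq_zero fun e _ => by rw [h1, zero_mul]
    simp only [add_mul, Finset.sum_add_distrib] at h5
    rw [← h4, add_zero] at h5
    rw [← h5]
    exact Finset.sum_congr rfl fun _ _ => by ring
  have hc : ∀ e, c e = 0 := by
    intro e
    have h4 := (Finset.sum_eq_zero_iff_of_nonneg (fun e _ =>
      mul_nonneg (Int.natCast_nonneg (T.len e)) (mul_self_nonneg (c e)))).1 h3 e (Finset.mem_univ e)
    have h5 : (T.len e : ℤ) ≠ 0 := by exact_mod_cast (T.len_pos e).ne'
    exact mul_self_eq_zero.1 ((mul_eq_zero.1 h4).resolve_left h5)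
  have h6 : ∀ e, ∑ w, T.inc w e * φ w = 0 := fun e => by
    have := h1 e
    rwa [hc, mul_zero, zero_add] at this
  have hφ : ∀ w, φ w = 0 := by
    classical
    intro w
    have h7 := T.sum_mul_boundary φ (σ (Pi.single w 1))
    rw [hσ] at h7
    simp only [h6, zero_mul, Finset.sum_const_zero] at h7
    simpa [Pi.single_apply] using h7
  exact hz (funext fun x => by rcases x with e | w; exacts [hc e, hφ w])

end homology

end OrientedForest

/-! ### The component group as an equivariant cokernel -/

namespace SignedForest

variable {X : Type*} (D : SignedForest X)

/-- The action of the signed automorphism on functions. -/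
def act {M : Type*} [AddCommGroup M] (h : X → M) : X → M :=
  fun x => (D.s (D.F.symm x) : ℤ) • h (D.F.symm x)

theorem act_F {M : Type*} [AddCommGroup M] (h : X → M) (x : X) :
    D.act h (D.F x) = (D.s x : ℤ) • h x := by
  rw [act, Equiv.symm_apply_apply]

theorem act_iterate_F_pow {M : Type*} [AddCommGroup M] (h : X → M) (k : ℕ) (x : X) :
    (D.act^[k] h) ((D.F ^ k) x) = (D.sgn k x : ℤ) • h x := by
  induction k with
  | zero => simp [sgn]
  | succ k ih =>
    rw [Function.iterate_succ_apply', pow_succ', Equiv.Perm.mul_apply, act_F, ih, sgn_succ,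
      Units.val_mul, mul_comm, mul_smul]

theorem act_iterate_eq_iff {M : Type*} [AddCommGroup M] (h : X → M) (k : ℕ) :
    D.act^[k] h = h ↔ ∀ x, h ((D.F ^ k) x) = (D.sgn k x : ℤ) • h x := by
  refine ⟨fun H x => ?_, fun H => funext fun x => ?_⟩
  · rw [← D.act_iterate_F_pow, H]
  · obtain ⟨x, rfl⟩ := (D.F ^ k).surjective x
    rw [D.act_iterate_F_pow, H]

variable [Fintype X]

theorem intMulVec_act {R M : Type*} [CommRing R] [AddCommGroup M] [Module R M] (h : X → M) :
    D.B.intMulVec R M (D.act h) = D.act (D.B.intMulVec R M h) := by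
  funext x
  obtain ⟨x, rfl⟩ := D.F.surjective x
  rw [act_F, Matrix.intMulVec_apply, Matrix.intMulVec_apply, ← Equiv.sum_comp D.F, Finset.smul_sum]
  refine Finset.sum_congr rfl fun y _ => ?_
  rw [act_F, D.B_F]
  by_cases h0 : D.B x y = 0
  · simp [h0]
  · have h1 : D.s x = D.s y := by
      rcases D.B_adj x y h0 with rfl | h1
      exacts [rfl, D.s_adj _ _ h1]
    rw [h1, smul_comm]

/-- The invariants of a group isomorphic to the cokernel of `B` are counted by `numSolutions`. -/
theorem card_coker_invariants [DecidableEq X] (hB : D.B.det ≠ 0) {A : Type*} [AddCommGroup A]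
    (Ψ : (X → ℤ) →+ A) (hΨ : Function.Surjective Ψ)
    (hΨ0 : ∀ m, Ψ m = 0 ↔ ∃ z, D.B.intMulVec ℤ ℤ z = m) (G : A → A)
    (hG : ∀ m, Ψ (D.act m) = G (Ψ m)) (f : ℕ) :
    Nat.card {a : A // G^[f] a = a} = D.numSolutions f := by
  obtain ⟨Θ, hΘ, hΘr, hΘ0⟩ := D.B.exists_coker_hom hB
  have hΘa : ∀ m, Θ (D.act m) = D.act (Θ m) := by
    intro m
    obtain ⟨q, hq⟩ := D.B.exists_intMulVec_rat hB fun i => (m i : ℚ)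
    have h1 : D.B.intMulVec ℚ ℚ (D.act q) = fun i => ((D.act m i : ℤ) : ℚ) := by
      rw [intMulVec_act, hq]
      funext i
      simp [act]
    rw [hΘ _ _ h1, hΘ _ _ hq]
    funext i
    simp only [act, AddCircle.coe_zsmul]
  have hΘf : ∀ m, Θ (D.act^[f] m) = D.act^[f] (Θ m) :=
    Function.Semiconj.iterate_right (f := Θ) (ga := D.act) (gb := D.act) hΘa f
  have hGf : ∀ m, Ψ (D.act^[f] m) = G^[f] (Ψ m) :=
    Function.Semiconj.iterate_right (f := Ψ) (ga := D.act) (gb := G) hG f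
  -- `Ψ` and `Θ` are equivariant with the same kernel, so their images have equally many invariants.
  have hker : ∀ m m', Ψ m = Ψ m' ↔ Θ m = Θ m' := fun m m' => by
    rw [← sub_eq_zero, ← map_sub, hΨ0, ← hΘ0, map_sub, sub_eq_zero]
  choose σ hσ using hΨ
  have hσΘ : ∀ m, Θ (σ (Ψ m)) = Θ m := fun m => (hker _ _).1 (hσ _)
  refine Nat.card_congr (Equiv.ofBijective (fun a => ⟨Θ (σ a.1), (hΘr _).2 ⟨_, rfl⟩, ?_⟩)
    ⟨fun a b h => ?_, fun h => ?_⟩)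
  · rw [← act_iterate_eq_iff, ← hΘf, ← hker, hGf, hσ, a.2]
  · have h' : Θ (σ a.1) = Θ (σ b.1) := congrArg Subtype.val h
    rw [← hker, hσ, hσ] at h'
    exact Subtype.ext h'
  · obtain ⟨h, h0, hf⟩ := h
    obtain ⟨m, rfl⟩ := (hΘr h).1 h0
    refine ⟨⟨Ψ m, ?_⟩, Subtype.ext (hσΘ m)⟩
    rw [← hGf, hker, hΘf, act_iterate_eq_iff]
    exact hf

end SignedForest

namespace OrientedForest

variable {E P : Type*} (T : OrientedForest E P) [Fintype E] [Fintype P]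
  {Λ : Type*} [AddCommGroup Λ] (ι : Λ →ₗ[ℤ] (E → ℤ))

/-- The linear form given by a cochain. -/
def cochainForm : (E → ℤ) →ₗ[ℤ] Module.Dual ℤ Λ :=
  LinearMap.mk₂ ℤ (fun y x => ∑ e, y e * ι x e)
    (fun a b x => by simp only [Pi.add_apply, add_mul, Finset.sum_add_distrib])
    (fun n a x => by
      simp only [Pi.smul_apply, smul_eq_mul, Finset.mul_sum]
      exact Finset.sum_congr rfl fun _ _ => by ring)
    (fun a x y => by simp only [map_add, Pi.add_apply, mul_add, Finset.sum_add_distrib])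
    (fun n a x => by
      simp only [map_smul, Pi.smul_apply, smul_eq_mul, Finset.mul_sum]
      exact Finset.sum_congr rfl fun _ _ => by ring)

theorem cochainForm_apply (y : E → ℤ) (x : Λ) : cochainForm ι y x = ∑ e, y e * ι x e := rfl

variable {ι}

/-- With `σ` a section of `∂`, the map `1 - σ ∂` projects chains onto cycles, so every linear form
on cycles extends to chains. -/
theorem cochainForm_surjective (hinj : Function.Injective ι)
    (hι : ∀ c, T.boundary c = 0 ↔ c ∈ LinearMap.range ι) :
    Function.Surjective (cochainForm ι) := by
  classical
  intro φ
  obtain ⟨σ, hσ⟩ := T.exists_section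
  let κ : (E → ℤ) →ₗ[ℤ] Λ := (LinearEquiv.ofInjective ι hinj).symm.toLinearMap ∘ₗ
    LinearMap.codRestrict (LinearMap.range ι) (LinearMap.id - σ ∘ₗ T.boundary) fun c =>
      (hι _).1 (by simp [hσ])
  have hκ : ∀ x, κ (ι x) = x := by
    intro x
    have h0 : T.boundary (ι x) = 0 := (hι _).2 ⟨x, rfl⟩
    apply (LinearEquiv.ofInjective ι hinj).injective
    rw [LinearMap.comp_apply, LinearEquiv.coe_coe, LinearEquiv.apply_symm_apply]
    exact Subtype.ext (by simp [h0])
  refine ⟨fun e => φ (κ (Pi.single e 1)), LinearMap.ext fun x => ?_⟩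
  rw [cochainForm_apply]
  conv_rhs => rw [← hκ x, ← Finset.univ_sum_single (ι x), map_sum, map_sum]
  refine Finset.sum_congr rfl fun e _ => ?_
  have : (Pi.single e (ι x e) : E → ℤ) = ι x e • Pi.single e 1 := by
    rw [← Pi.single_smul, smul_eq_mul, mul_one]
  rw [this, map_smul, map_smul, smul_eq_mul, mul_comm]

/-- A form vanishing on cycles factors through `∂`, and composing it with a section `σ` gives the
vertex function `φ`. -/
theorem cochainForm_eq_zero_iff (hι : ∀ c, T.boundary c = 0 ↔ c ∈ LinearMap.range ι)
    (y : E → ℤ) :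
    cochainForm ι y = 0 ↔ ∃ φ : T.Free → ℤ, ∀ e, y e = ∑ w, T.inc w e * φ w := by
  classical
  constructor
  · intro hy
    have h0 : ∀ c, T.boundary c = 0 → ∑ e, y e * c e = 0 := by
      intro c hc
      obtain ⟨x, rfl⟩ := (hι c).1 hc
      exact LinearMap.congr_fun hy x
    obtain ⟨σ, hσ⟩ := T.exists_section
    let L : (E → ℤ) →ₗ[ℤ] ℤ := Fintype.linearCombination ℤ y
    have hL : ∀ c, L c = ∑ e, y e * c e := fun c => by
      rw [Fintype.linearCombination_apply]
      exact Finset.sum_congr rfl fun _ _ => by rw [smul_eq_mul, mul_comm]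
    refine ⟨fun w => L (σ (Pi.single w 1)), fun e => ?_⟩
    have h1 : L (Pi.single e 1 - σ (T.boundary (Pi.single e 1))) = 0 := by
      rw [hL]
      exact h0 _ (by rw [map_sub, hσ, sub_self])
    have h2 : L (Pi.single e 1) = y e := by
      rw [hL, Finset.sum_eq_single e] <;> simp +contextual
    have h3 : T.boundary (Pi.single e 1) = ∑ w, T.inc w e • Pi.single w (1 : ℤ) := by
      funext w
      rw [boundary_apply, Finset.sum_apply, Finset.sum_eq_single e, Finset.sum_eq_single w] <;>
        simp +contextual
    rw [map_sub, h2, sub_eq_zero] at h1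
    rw [h1, h3, map_sum, map_sum]
    simp only [map_smul, smul_eq_mul]
  · rintro ⟨φ, hφ⟩
    refine LinearMap.ext fun x => ?_
    rw [cochainForm_apply]
    simp only [hφ, ← T.sum_mul_boundary, (hι (ι x)).2 ⟨x, rfl⟩, Pi.zero_apply, mul_zero,
      Finset.sum_const_zero, LinearMap.zero_apply]

/-- A vector `(y, b)` is sent to the class of the form `y - L c` for any chain `c` with `∂ c = b`.
Changing `c` by a cycle changes the form by an element of `Λ`. The kernel consists of the vectors
`(L c + ∂ᵀ φ, ∂ c)`, which is the image of the block matrix. -/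
theorem card_invariants (hinj : Function.Injective ι)
    (hι : ∀ c, T.boundary c = 0 ↔ c ∈ LinearMap.range ι) (p : Λ →ₗ[ℤ] Module.Dual ℤ Λ)
    (hp : ∀ x y, p x y = ∑ e, T.len e * (ι x e * ι y e)) (g : Λ → Λ)
    (hg : ∀ x e, ι (g x) (T.FE e) = T.sE e * ι x e)
    (G : Module.Dual ℤ Λ ⧸ LinearMap.range p → Module.Dual ℤ Λ ⧸ LinearMap.range p)
    (hG : ∀ φ ψ : Module.Dual ℤ Λ, (∀ x, ψ (g x) = φ x) →
      G ((LinearMap.range p).mkQ φ) = (LinearMap.range p).mkQ ψ) (f : ℕ) :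
    Nat.card {a // G^[f] a = a} = T.toSignedForest.numSolutions f := by
  classical
  obtain ⟨σ, hσ⟩ := T.exists_section
  let mulLen : (E → ℤ) →ₗ[ℤ] (E → ℤ) := LinearMap.pi fun e => (T.len e : ℤ) • LinearMap.proj e
  have hmul : ∀ c e, mulLen c e = T.len e * c e := fun c e => rfl
  have hpι : ∀ x, cochainForm ι (mulLen (ι x)) = p x := fun x => LinearMap.ext fun y => by
    rw [hp, cochainForm_apply]
    exact Finset.sum_congr rfl fun e _ => mul_assoc _ _ _
  let mE : (E ⊕ T.Free → ℤ) →ₗ[ℤ] (E → ℤ) := LinearMap.funLeft ℤ ℤ Sum.inl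
  let mW : (E ⊕ T.Free → ℤ) →ₗ[ℤ] (T.Free → ℤ) := LinearMap.funLeft ℤ ℤ Sum.inr
  let Ψ : (E ⊕ T.Free → ℤ) →ₗ[ℤ] (Module.Dual ℤ Λ ⧸ LinearMap.range p) :=
    (LinearMap.range p).mkQ ∘ₗ cochainForm ι ∘ₗ (mE - mulLen ∘ₗ σ ∘ₗ mW)
  have hΨc : ∀ m c, T.boundary c = mW m →
      Ψ m = (LinearMap.range p).mkQ (cochainForm ι (mE m - mulLen c)) := by
    intro m c hc
    obtain ⟨x, hx⟩ := (hι (σ (mW m) - c)).1 (by rw [map_sub, hσ, hc, sub_self])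
    change (LinearMap.range p).mkQ (cochainForm ι (mE m - mulLen (σ (mW m)))) = _
    rw [← sub_eq_zero, ← map_sub, ← map_sub]
    have : mE m - mulLen (σ (mW m)) - (mE m - mulLen c) = - mulLen (ι x) := by
      rw [hx, map_sub]; abel
    rw [this, map_neg, map_neg, hpι, neg_eq_zero, Submodule.mkQ_apply,
      Submodule.Quotient.mk_eq_zero]
    exact ⟨x, rfl⟩
  refine T.toSignedForest.card_coker_invariants T.det_matrix_ne_zero Ψ.toAddMonoidHom
    (fun a => ?_) (fun m => ?_) G (fun m => ?_) f
  · obtain ⟨φ, rfl⟩ := (LinearMap.range p).mkQ_surjective a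
    obtain ⟨y, rfl⟩ := T.cochainForm_surjective hinj hι φ
    refine ⟨Sum.elim y 0, ?_⟩
    refine (hΨc _ 0 (map_zero _)).trans ?_
    rw [map_zero, sub_zero]
    rfl
  · change Ψ m = 0 ↔ ∃ z, T.matrix.intMulVec ℤ ℤ z = m
    constructor
    · intro h
      rw [hΨc m _ (hσ _), Submodule.mkQ_apply, Submodule.Quotient.mk_eq_zero] at h
      obtain ⟨x, hx⟩ := h
      rw [← hpι, eq_comm, ← sub_eq_zero, ← map_sub, T.cochainForm_eq_zero_iff hι] at hx
      obtain ⟨φ, hφ⟩ := hx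
      refine ⟨Sum.elim (σ (mW m) + ι x) φ, funext fun a => ?_⟩
      rcases a with e | w
      · rw [matrix_mulVec_inl]
        have h1 := hφ e
        simp only [Pi.sub_apply, hmul] at h1
        simp only [Sum.elim_inl, Sum.elim_inr, ← h1, Pi.add_apply]
        change _ = mE m e
        ring
      · rw [matrix_mulVec_inr]
        simp only [Sum.elim_inl]
        change T.boundary (σ (mW m) + ι x) w = mW m w
        rw [map_add, hσ, (hι (ι x)).2 ⟨x, rfl⟩, add_zero]
    · rintro ⟨z, rfl⟩
      rw [hΨc _ (fun e => z (.inl e)) (funext fun w => (T.matrix_mulVec_inr z w).symm)]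
      have : cochainForm ι (mE (T.matrix.intMulVec ℤ ℤ z) - mulLen fun e => z (.inl e)) = 0 := by
        rw [T.cochainForm_eq_zero_iff hι]
        refine ⟨fun w => z (.inr w), fun e => ?_⟩
        rw [Pi.sub_apply, hmul]
        change T.matrix.intMulVec ℤ ℤ z (.inl e) - _ = _
        rw [matrix_mulVec_inl, add_sub_cancel_left]
      rw [this, map_zero]
  · change Ψ _ = G (Ψ m)
    -- The section `σ` need not be equivariant. The transported chain is another admissible choice
    -- for the transported boundary, which `hΨc` allows.
    let c : E → ℤ := fun e => T.sE (T.FE.symm e) * σ (mW m) (T.FE.symm e)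
    have hcF : ∀ e, c (T.FE e) = T.sE e * σ (mW m) e := fun e => by
      simp only [c, Equiv.symm_apply_apply]
    have hc : T.boundary c = mW (T.toSignedForest.act m) := by
      funext w
      obtain ⟨w, rfl⟩ := T.FW.surjective w
      change _ = T.toSignedForest.act m (T.toSignedForest.F (.inr w))
      rw [SignedForest.act_F, boundary_apply, ← Equiv.sum_comp T.FE]
      change _ = (T.sP w.1 : ℤ) • mW m w
      rw [← hσ (mW m), boundary_apply, Finset.smul_sum]
      refine Finset.sum_congr rfl fun e _ => ?_
      rw [hcF, T.inc_F, smul_eq_mul]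
      by_cases h0 : T.inc w e = 0
      · simp [h0]
      · have : T.sE e = T.sP w.1 := by
          rcases T.inc_ne_zero h0 with h | h <;> rw [← h]
          exacts [T.sign_src e (h ▸ w.2), T.sign_tgt e (h ▸ w.2)]
        rw [this]
        ring
    rw [hΨc _ c hc, hΨc m _ (hσ _)]
    refine (hG _ _ fun x => ?_).symm
    rw [cochainForm_apply, cochainForm_apply, ← Equiv.sum_comp T.FE]
    refine Finset.sum_congr rfl fun e _ => ?_
    have h1 : mE (T.toSignedForest.act m) (T.FE e) = T.sE e * mE m e :=
      T.toSignedForest.act_F m (.inl e)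
    have h2 : (T.sE e : ℤ) * T.sE e = 1 := by
      rw [← Units.val_mul, Int.units_mul_self, Units.val_one]
    rw [hg, Pi.sub_apply, Pi.sub_apply, hmul, hmul, h1, hcF, T.len_F]
    linear_combination (mE m e - T.len e * σ (mW m) e) * ι x e * h2

end OrientedForest

/-! ### Components meeting `S`, bridges and cell signs -/

namespace BYPair

variable {V : Type*} (P : BYPair V)

/-- The vertices of the components of `T` meeting `S`. -/
def nearS : Set V := {v | ∃ w ∈ P.S.verts, P.graph.Reachable v w}

variable {P}

theorem nearS_iff_of_adj {u v : V} (h : P.graph.Adj u v) : u ∈ P.nearS ↔ v ∈ P.nearS :=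
  ⟨fun ⟨w, hw, hr⟩ => ⟨w, hw, h.symm.reachable.trans hr⟩,
    fun ⟨w, hw, hr⟩ => ⟨w, hw, h.reachable.trans hr⟩⟩

variable (P)

/-- The side of `u` after removing an edge `uv`. -/
def side (u v : V) : Set V := {x | (P.graph.deleteEdges {s(u, v)}).Reachable u x}

theorem left_mem_side (u v : V) : u ∈ P.side u v := SimpleGraph.Reachable.refl _

theorem right_notMem_side {u v : V} (h : P.graph.Adj u v) : v ∉ P.side u v :=
  SimpleGraph.isBridge_iff.1 (SimpleGraph.isAcyclic_iff_forall_adj_isBridge.1 P.isAcyclic h)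

theorem mem_side_iff {u v a b : V} (h : P.graph.Adj a b) (hne : s(a, b) ≠ s(u, v)) :
    a ∈ P.side u v ↔ b ∈ P.side u v := by
  have h1 : (P.graph.deleteEdges {s(u, v)}).Adj a b := SimpleGraph.deleteEdges_adj.2 ⟨h, hne⟩
  exact ⟨fun hr => hr.trans h1.reachable, fun hr => hr.trans h1.symm.reachable⟩

/-- A relative cycle vanishes on the components of `T` that do not meet `S`. -/
theorem homology_eq_zero [Fintype V] {c : V → V → ℤ} (hc : c ∈ P.homology) {u v : V}
    (hu : u ∉ P.nearS) : c u v = 0 := by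
  classical
  obtain ⟨h1, h2, h3⟩ := hc
  by_cases hcell : P.IsCell (.inr s(u, v))
  swap
  · exact h2 u v hcell
  have hadj : P.graph.Adj u v := hcell.1
  -- The total outflow from the side of `u` is zero, as this side contains no vertex of `S`. Inner
  -- edges cancel by antisymmetry, and the bridge `uv` is the only edge leaving, so its coefficient
  -- is zero.
  let K : Finset V := Finset.univ.filter (· ∈ P.side u v)
  have hK : ∀ x, x ∈ K ↔ x ∈ P.side u v := fun x => by simp [K]
  have hsum : ∑ x ∈ K, ∑ w, c x w = 0 := Finset.sum_eq_zero fun x hx => h3 x fun hxS =>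
    hu ⟨x, hxS, ((hK x).1 hx).mono (SimpleGraph.deleteEdges_le _)⟩
  have hsplit : ∀ x, ∑ w, c x w = ∑ w ∈ K, c x w + ∑ w ∈ Kᶜ, c x w := fun x =>
    (Finset.sum_add_sum_compl K _).symm
  have hin : ∑ x ∈ K, ∑ w ∈ K, c x w = 0 := by
    have h4 : ∑ x ∈ K, ∑ w ∈ K, c x w = - ∑ x ∈ K, ∑ w ∈ K, c x w := by
      conv_lhs => rw [Finset.sum_comm]
      simp only [← Finset.sum_neg_distrib, ← h1]
    omega
  simp only [hsplit, Finset.sum_add_distrib, hin, zero_add] at hsum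
  have hout : ∀ x ∈ K, ∀ w ∈ Kᶜ, ¬ (x = u ∧ w = v) → c x w = 0 := by
    intro x hx w hw hne
    by_contra h0
    have hxw : P.IsCell (.inr s(x, w)) := by
      by_contra h5
      exact h0 (h2 x w h5)
    rw [Finset.mem_compl, hK] at hw
    rw [hK] at hx
    by_cases hs : s(x, w) = s(u, v)
    · rcases Sym2.eq_iff.1 hs with h5 | ⟨rfl, rfl⟩
      · exact hne h5
      · exact P.right_notMem_side hadj hx
    · exact hw ((P.mem_side_iff hxw.1 hs).1 hx)
  have huK : u ∈ K := (hK u).2 (P.left_mem_side u v)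
  have hvK : v ∈ Kᶜ := by
    rw [Finset.mem_compl, hK]
    exact P.right_notMem_side hadj
  rw [Finset.sum_eq_single_of_mem u huK fun x hx hxu =>
      Finset.sum_eq_zero fun w hw => hout x hx w hw fun h => hxu h.1,
    Finset.sum_eq_single_of_mem v hvK fun w hw hwv => hout u huK w hw fun h => hwv h.2] at hsum
  exact hsum

open Classical in
/-- The length of an edge. -/
def edgeLen (e : Sym2 V) : ℕ := if h : e ∈ P.graph.edgeSet then P.len ⟨e, h⟩ else 0

theorem edgeLen_of_mem {e : Sym2 V} (h : e ∈ P.graph.edgeSet) : P.edgeLen e = P.len ⟨e, h⟩ :=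
  dif_pos h

theorem edgeLen_pos {e : Sym2 V} (h : e ∈ P.graph.edgeSet) : 0 < P.edgeLen e := by
  rw [P.edgeLen_of_mem h]
  exact P.len_pos _

end BYPair

namespace SignedAut

variable {V : Type*} {P : BYPair V} (g : SignedAut P)

theorem mem_nearS (v : V) : g.F v ∈ P.nearS ↔ v ∈ P.nearS := by
  refine ⟨fun ⟨w, hw, hr⟩ => ⟨g.F.symm w, ?_, ?_⟩, fun ⟨w, hw, hr⟩ =>
    ⟨g.F w, (g.mem_S w).2 hw, g.F.reachable_iff.2 hr⟩⟩
  · rwa [← g.mem_S, RelIso.apply_symm_apply]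
  · rwa [← g.F.reachable_iff, RelIso.apply_symm_apply]

theorem edgeLen_map (e : Sym2 V) : P.edgeLen (e.map g.F) = P.edgeLen e := by
  by_cases h : e ∈ P.graph.edgeSet
  · have h' : e.map g.F ∈ P.graph.edgeSet := (g.F.mapEdgeSet ⟨e, h⟩).2
    rw [P.edgeLen_of_mem h, P.edgeLen_of_mem h', ← g.isometric ⟨e, h⟩]
    rfl
  · have h' : e.map g.F ∉ P.graph.edgeSet := by
      induction e with
      | h u v => exact fun h' => h (g.F.map_adj_iff.1 h')
    rw [BYPair.edgeLen, BYPair.edgeLen, dif_neg h, dif_neg h']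

/-- The permutation of the unordered pairs of vertices. -/
def edgePerm : Equiv.Perm (Sym2 V) where
  toFun := Sym2.map g.F
  invFun := Sym2.map g.F.symm
  left_inv e := by
    induction e with
    | h u v => simp
  right_inv e := by
    induction e with
    | h u v => simp

theorem isCell_map_iff (c : V ⊕ Sym2 V) :
    P.IsCell (Sum.map g.F (Sym2.map g.F) c) ↔ P.IsCell c := by
  obtain v | e := c
  · exact not_congr (g.mem_S v)
  · induction e with
    | h u v => exact g.isCell_map_edge u v

open Classical in
/-- The sign of the component of a cell. -/
def cellSign (c : V ⊕ Sym2 V) : ℤˣ :=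
  if h : P.IsCell c then g.ε (P.cellGraph.connectedComponentMk ⟨c, h⟩) else 1

theorem edgeSign_eq_cellSign (u v : V) : g.edgeSign u v = g.cellSign (.inr s(u, v)) := by
  unfold edgeSign cellSign
  split_ifs <;> rfl

theorem cellSign_eq {v : V} {e : Sym2 V} (hv : v ∉ P.S.verts) (he : P.IsCell (.inr e))
    (hve : v ∈ e) : g.cellSign (.inr e) = g.cellSign (.inl v) := by
  have hv' : P.IsCell (.inl v) := hv
  rw [cellSign, cellSign, dif_pos he, dif_pos hv']
  congr 1
  apply SimpleGraph.ConnectedComponent.sound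
  apply SimpleGraph.Adj.reachable
  rw [BYPair.cellGraph, SimpleGraph.fromRel_adj]
  exact ⟨fun H => Sum.inr_ne_inl (congrArg Subtype.val H), .inr ⟨v, e, rfl, rfl, hve⟩⟩

end SignedAut

/-! ### Invariant orientations and subdivision of even edges -/

namespace BYForest

variable {V : Type*} (T : BYForest V)

/-- An orientation of the edges of odd length invariant under the automorphism. -/
structure IsOrientation (O : V → V → Prop) : Prop where
  map_iff : ∀ u v, O (T.εF.F u) (T.εF.F v) ↔ O u v
  swap_iff : ∀ u v, T.graph.Adj u v → ¬ Even (T.edgeLen s(u, v)) → (O v u ↔ ¬ O u v)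

/-- Number the orbits of ordered pairs and orient towards the larger number of the reversed pair. By
(B) the two orientations of an odd edge lie in different orbits, so there is no tie. -/
theorem exists_isOrientation [Finite V] (hB : T.ParityB) : ∃ O, T.IsOrientation O := by
  let σ : Equiv.Perm (V × V) := Equiv.prodCongr T.εF.F.toEquiv T.εF.F.toEquiv
  have hσ : ∀ u v, σ (u, v) = (T.εF.F u, T.εF.F v) := fun u v => rfl
  let Q := Quotient (Equiv.Perm.SameCycle.setoid σ)
  let q : V × V → Q := Quotient.mk _
  obtain ⟨n, ⟨r⟩⟩ := Finite.exists_equiv_fin Q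
  have hq : ∀ u v, q (T.εF.F u, T.εF.F v) = q (u, v) := fun u v =>
    Quotient.sound (Equiv.Perm.sameCycle_apply_left.2 (Equiv.Perm.SameCycle.refl σ (u, v)))
  refine ⟨fun u v => r (q (u, v)) < r (q (v, u)), fun u v => by rw [hq, hq], fun u v h hodd => ?_⟩
  have hne : q (u, v) ≠ q (v, u) := by
    intro heq
    obtain ⟨k, hk⟩ := Equiv.Perm.SameCycle.exists_nat_pow_eq (f := σ) (Quotient.exact heq)
    have hit : ∀ k : ℕ, (σ ^ k) (u, v) = ((T.εF.F)^[k] u, (T.εF.F)^[k] v) := by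
      intro k
      induction k with
      | zero => rfl
      | succ k ih =>
        rw [pow_succ', Equiv.Perm.mul_apply, ih, hσ, Function.iterate_succ_apply',
          Function.iterate_succ_apply']
    rw [hit, Prod.mk.injEq] at hk
    refine hB k u v h ?_ hk
    rw [← T.edgeLen_of_mem (e := s(u, v)) h]
    exact Nat.not_even_iff_odd.1 hodd
  rw [not_lt]
  exact ⟨le_of_lt, fun hle => lt_of_le_of_ne hle fun h' => hne (r.injective h').symm⟩

/-- The oriented edges of `T ∖ S` in the components meeting `S`; those of odd length are only taken
in the preferred orientation. -/
def dartSet (O : V → V → Prop) : Set (V × V) :=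
  {d | T.IsCell (.inr s(d.1, d.2)) ∧ d.1 ∈ T.nearS ∧ (Even (T.edgeLen s(d.1, d.2)) ∨ O d.1 d.2)}

open Classical in
/-- The end of the first half of an oriented edge of even length, and the end of an oriented edge of
odd length. -/
def dartTgt (d : V × V) : V ⊕ Sym2 V :=
  if Even (T.edgeLen s(d.1, d.2)) then .inr s(d.1, d.2) else .inl d.2

open Classical in
/-- The length of the first half of an edge of even length, and the length of an edge of
odd length. -/
def dartLen (d : V × V) : ℕ :=
  if Even (T.edgeLen s(d.1, d.2)) then T.edgeLen s(d.1, d.2) / 2 else T.edgeLen s(d.1, d.2)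

/-- Vertices and midpoints of edges that are irrelevant for the relative cycles. -/
def basePoints : Set (V ⊕ Sym2 V) :=
  {p | Sum.elim (fun v => v ∈ T.S.verts ∨ v ∉ T.nearS) (fun e => ¬ (T.IsCell (.inr e) ∧
    Even (T.edgeLen e) ∧ ∀ v ∈ e, v ∈ T.nearS)) p}

variable {T} {O : V → V → Prop}

theorem mem_dartSet_or (hO : T.IsOrientation O) {u v : V} (h : T.IsCell (.inr s(u, v))) (hu : u ∈ T.nearS) :
    (u, v) ∈ T.dartSet O ∨ (v, u) ∈ T.dartSet O := by
  have h' : T.IsCell (.inr s(v, u)) := by rwa [Sym2.eq_swap]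
  by_cases he : Even (T.edgeLen s(u, v))
  · exact Or.inl ⟨h, hu, Or.inl he⟩
  · by_cases hd : O u v
    · exact Or.inl ⟨h, hu, Or.inr hd⟩
    · exact Or.inr ⟨h', (BYPair.nearS_iff_of_adj h.1).1 hu, Or.inr ((hO.swap_iff u v h.1 he).2 hd)⟩

/-- The oriented forest obtained by subdividing the edges of even length. -/
def oriented (hO : T.IsOrientation O) : OrientedForest (T.dartSet O) (V ⊕ Sym2 V) where
  src d := .inl d.1.1
  tgt d := T.dartTgt d.1
  len d := T.dartLen d.1
  len_pos := by
    rintro ⟨⟨u, v⟩, h, -⟩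
    have h0 := T.edgeLen_pos (e := s(u, v)) h.1
    unfold dartLen
    split_ifs with he
    · obtain ⟨k, hk⟩ := he
      simp only at hk ⊢
      omega
    · exact h0
  S := T.basePoints
  FE := Equiv.Perm.subtypePerm (Equiv.prodCongr T.εF.F.toEquiv T.εF.F.toEquiv) fun d => by
    have h : T.edgeLen s(T.εF.F d.1, T.εF.F d.2) = T.edgeLen s(d.1, d.2) :=
      T.εF.edgeLen_map s(d.1, d.2)
    change (T.IsCell (.inr s(T.εF.F d.1, T.εF.F d.2)) ∧ T.εF.F d.1 ∈ T.nearS ∧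
      (Even (T.edgeLen s(T.εF.F d.1, T.εF.F d.2)) ∨ O (T.εF.F d.1) (T.εF.F d.2))) ↔ _
    rw [T.εF.isCell_map_edge, T.εF.mem_nearS, h, hO.map_iff]
    rfl
  FP := Equiv.sumCongr T.εF.F.toEquiv T.εF.edgePerm
  src_F _ := rfl
  tgt_F := by
    rintro ⟨⟨u, v⟩, h⟩
    have h : T.edgeLen s(T.εF.F u, T.εF.F v) = T.edgeLen s(u, v) := T.εF.edgeLen_map s(u, v)
    change T.dartTgt (T.εF.F u, T.εF.F v) = _
    unfold dartTgt
    rw [h]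
    split_ifs <;> rfl
  len_F := by
    rintro ⟨⟨u, v⟩, h⟩
    have h : T.edgeLen s(T.εF.F u, T.εF.F v) = T.edgeLen s(u, v) := T.εF.edgeLen_map s(u, v)
    change T.dartLen (T.εF.F u, T.εF.F v) = T.dartLen (u, v)
    unfold dartLen
    rw [h]
  S_F := by
    rintro (v | e)
    · change (T.εF.F v ∈ T.S.verts ∨ T.εF.F v ∉ T.nearS) ↔ (v ∈ T.S.verts ∨ v ∉ T.nearS)
      rw [T.εF.mem_S, T.εF.mem_nearS]
    · change ¬ (T.IsCell (.inr (e.map T.εF.F)) ∧ Even (T.edgeLen (e.map T.εF.F)) ∧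
        ∀ v ∈ e.map T.εF.F, v ∈ T.nearS) ↔ ¬ (T.IsCell (.inr e) ∧ Even (T.edgeLen e) ∧
        ∀ v ∈ e, v ∈ T.nearS)
      have h := T.εF.isCell_map_iff (.inr e)
      rw [Sum.map_inr] at h
      simp only [h, T.εF.edgeLen_map, Sym2.mem_map, forall_exists_index, and_imp,
        forall_apply_eq_imp_iff₂, T.εF.mem_nearS]
  sE d := T.εF.cellSign (.inr s(d.1.1, d.1.2))
  sP := T.εF.cellSign
  sign_src d h := T.εF.cellSign_eq (fun h' => h (Or.inl h')) d.2.1 (Sym2.mem_mk_left _ _)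
  sign_tgt d h := by
    unfold dartTgt at h ⊢
    split_ifs at h ⊢ with he
    · rfl
    · exact T.εF.cellSign_eq (fun h' => h (Or.inl h')) d.2.1 (Sym2.mem_mk_right _ _)
  cut := by
    rintro ⟨⟨u, v⟩, h, hu, hd⟩
    -- The side of `u`, with the midpoints of edges touching it, except the midpoint of `uv`: that
    -- one must be separated from `u`, and stays on the side of `v` with the opposite half.
    refine ⟨{p | Sum.elim (fun x => x ∈ T.side u v)
      (fun e => e ≠ s(u, v) ∧ ∃ x ∈ e, x ∈ T.side u v) p}, T.left_mem_side u v, ?_, ?_⟩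
    · unfold dartTgt
      split_ifs
      · exact fun h' => h'.1 rfl
      · exact T.right_notMem_side h.1
    · rintro ⟨⟨a, b⟩, h', ha, hd'⟩ hne
      have hne' : (a, b) ≠ (u, v) := fun h => hne (Subtype.ext h)
      change a ∈ T.side u v ↔ _
      simp only at h h' hd hd' hu ha
      by_cases hs : s(a, b) = s(u, v)
      · rcases Sym2.eq_iff.1 hs with ⟨rfl, rfl⟩ | ⟨rfl, rfl⟩
        · exact absurd rfl hne'
        · have he : Even (T.edgeLen s(a, b)) := by
            by_contra he
            have hd1 := hd'.resolve_left he
            rw [Sym2.eq_swap] at hd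
            exact (hO.swap_iff a b h'.1 he).1 (hd.resolve_left he) hd1
          simp only [dartTgt, if_pos he]
          exact ⟨fun h1 => absurd h1 (T.right_notMem_side h.1), fun h1 => absurd hs h1.1⟩
      · have h1 := T.mem_side_iff h'.1 hs
        simp only [dartTgt]
        split_ifs
        · refine ⟨fun h2 => ⟨hs, a, Sym2.mem_mk_left _ _, h2⟩, fun ⟨_, x, hx, h2⟩ => ?_⟩
          rcases Sym2.mem_iff.1 hx with rfl | rfl
          exacts [h2, h1.2 h2]
        · exact h1
  meets := by
    intro Q hS hQ
    have hE : ∀ a b, (a, b) ∈ T.dartSet O → (Sum.inl a ∈ Q ↔ T.dartTgt (a, b) ∈ Q) :=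
      fun a b h => hQ ⟨(a, b), h⟩
    -- Membership in `Q` passes along an even edge through its midpoint and along an odd edge
    -- directly, so it spreads along walks from `S`.
    have hadj : ∀ a b, T.graph.Adj a b → b ∈ T.nearS → Sum.inl b ∈ Q → Sum.inl a ∈ Q := by
      intro a b hab hb hbQ
      by_cases hS' : T.S.Adj a b
      · exact hS (Or.inl (T.S.edge_vert hS'))
      have hcell : T.IsCell (.inr s(a, b)) := ⟨hab, hS'⟩
      have hcell' : T.IsCell (.inr s(b, a)) := by rwa [Sym2.eq_swap]
      have ha := (BYPair.nearS_iff_of_adj hab).2 hb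
      by_cases he : Even (T.edgeLen s(a, b))
      · have he' : Even (T.edgeLen s(b, a)) := by rwa [Sym2.eq_swap]
        have h1 := hE a b ⟨hcell, ha, Or.inl he⟩
        have h2 := hE b a ⟨hcell', hb, Or.inl he'⟩
        simp only [dartTgt, if_pos he, if_pos he'] at h1 h2
        rw [h1, Sym2.eq_swap, ← h2]
        exact hbQ
      · have he' : ¬ Even (T.edgeLen s(b, a)) := by rwa [Sym2.eq_swap]
        rcases mem_dartSet_or hO hcell ha with h | h
        · have h1 := hE a b h
          simp only [dartTgt, if_neg he] at h1
          exact h1.2 hbQ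
        · have h1 := hE b a h
          simp only [dartTgt, if_neg he'] at h1
          exact h1.1 hbQ
    have hV : ∀ v, Sum.inl v ∈ Q := by
      intro v
      by_cases hv : v ∈ T.nearS
      · obtain ⟨w, hw, ⟨p⟩⟩ := hv
        induction p with
        | nil => exact hS (Or.inl hw)
        | cons h p ih => exact hadj _ _ h ⟨_, hw, ⟨p⟩⟩ (ih hw)
      · exact hS (Or.inr hv)
    rintro (v | e)
    · exact hV v
    · by_cases he : T.IsCell (.inr e) ∧ Even (T.edgeLen e) ∧ ∀ v ∈ e, v ∈ T.nearS
      · induction e with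
        | h u v =>
          have h1 := hE u v ⟨he.1, he.2.2 _ (Sym2.mem_mk_left _ _), Or.inl he.2.1⟩
          simp only [dartTgt, if_pos he.2.1] at h1
          exact h1.1 (hV u)
      · exact hS he

end BYForest

/-! ### Relative cycles and the pairing on the subdivided forest -/

theorem Sym2.sum_mk_eq {V M : Type*} [Fintype V] [DecidableEq V] [AddCommMonoid M] {a b : V}
    (hab : a ≠ b) (k : V × V → M) :
    (∑ d : V × V, if s(d.1, d.2) = s(a, b) then k d else 0) = k (a, b) + k (b, a) := by
  have hne : (a, b) ≠ (b, a) := fun h => hab (Prod.mk.inj h).1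
  rw [← Finset.sum_filter, ← Finset.sum_pair hne]
  congr 1
  ext ⟨u, v⟩
  simp

namespace BYForest

variable {V : Type*} {T : BYForest V} {O : V → V → Prop}

open Classical in
/-- The extension by zero of a function on the chosen oriented edges. -/
def extendDarts (y : T.dartSet O → ℤ) (d : V × V) : ℤ :=
  if h : d ∈ T.dartSet O then y ⟨d, h⟩ else 0

theorem extendDarts_of_mem (y : T.dartSet O → ℤ) {d : V × V} (h : d ∈ T.dartSet O) :
    extendDarts y d = y ⟨d, h⟩ := dif_pos h

theorem extendDarts_of_notMem (y : T.dartSet O → ℤ) {d : V × V} (h : d ∉ T.dartSet O) :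
    extendDarts y d = 0 := dif_neg h

theorem sum_mul_extendDarts [Fintype V] [Fintype (T.dartSet O)] (y : T.dartSet O → ℤ)
    (k : V × V → ℤ) : ∑ d, k d.1 * y d = ∑ d : V × V, k d * extendDarts y d := by
  classical
  rw [← Finset.sum_subset (Finset.subset_univ (Finset.univ.filter (· ∈ T.dartSet O)))
    fun d _ hd => by
      rw [extendDarts_of_notMem y fun h => hd (by simpa using h), mul_zero]]
  rw [Finset.sum_subtype _ (p := (· ∈ T.dartSet O)) (fun d => by simp)]
  exact Finset.sum_congr rfl fun d _ => by rw [extendDarts_of_mem y d.2]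

open Classical in
/-- The antisymmetric chain with given coefficients. -/
def dartChain (y : T.dartSet O → ℤ) (u v : V) : ℤ :=
  extendDarts y (u, v) - if Even (T.edgeLen s(u, v)) then 0 else extendDarts y (v, u)

theorem swap_notMem_dartSet (hO : T.IsOrientation O) {u v : V} (h : (u, v) ∈ T.dartSet O)
    (he : ¬ Even (T.edgeLen s(u, v))) : (v, u) ∉ T.dartSet O := by
  intro h'
  have he' : ¬ Even (T.edgeLen s(v, u)) := by rwa [Sym2.eq_swap]
  exact (hO.swap_iff u v h.1.1 he).1 (h'.2.2.resolve_left he') (h.2.2.resolve_left he)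

theorem swap_mem_dartSet {u v : V} (h : (u, v) ∈ T.dartSet O)
    (he : Even (T.edgeLen s(u, v))) : (v, u) ∈ T.dartSet O := by
  obtain ⟨h1, h2, -⟩ := h
  have h2' : v ∈ T.nearS := (BYPair.nearS_iff_of_adj h1.1).1 h2
  rw [Sym2.eq_swap] at h1 he
  exact ⟨h1, h2', Or.inl he⟩

variable [Fintype V]

/-- The coefficients of relative cycles. -/
def coeff (T : BYForest V) (O : V → V → Prop) : T.homology →ₗ[ℤ] (T.dartSet O → ℤ) where
  toFun c d := c.1 d.1.1 d.1.2
  map_add' _ _ := rfl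
  map_smul' _ _ := rfl

theorem coeff_apply (c : T.homology) (d : T.dartSet O) : coeff T O c d = c.1 d.1.1 d.1.2 := rfl

/-- No information is lost by discarding the components away from `S`, since relative cycles vanish
there. -/
theorem dartChain_coeff (hO : T.IsOrientation O) (c : T.homology) :
    dartChain (coeff T O c) = c.1 := by
  funext u v
  unfold dartChain
  by_cases hcell : T.IsCell (.inr s(u, v))
  swap
  · have h1 : (u, v) ∉ T.dartSet O := fun h => hcell h.1
    have h2 : (v, u) ∉ T.dartSet O := fun h => hcell (by rw [Sym2.eq_swap]; exact h.1)
    rw [extendDarts_of_notMem _ h1, extendDarts_of_notMem _ h2, ite_self, c.2.2.1 u v hcell,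
      sub_zero]
  by_cases hu : u ∈ T.nearS
  swap
  · have hv : v ∉ T.nearS := fun hv => hu ((BYPair.nearS_iff_of_adj hcell.1).2 hv)
    have h1 : (u, v) ∉ T.dartSet O := fun h => hu h.2.1
    have h2 : (v, u) ∉ T.dartSet O := fun h => hv h.2.1
    rw [extendDarts_of_notMem _ h1, extendDarts_of_notMem _ h2, ite_self,
      T.homology_eq_zero c.2 hu, sub_zero]
  by_cases he : Even (T.edgeLen s(u, v))
  · have h1 : (u, v) ∈ T.dartSet O := ⟨hcell, hu, Or.inl he⟩
    rw [if_pos he, extendDarts_of_mem _ h1, sub_zero, coeff_apply]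
  · have he' : ¬ Even (T.edgeLen s(v, u)) := by rwa [Sym2.eq_swap]
    rw [if_neg he]
    rcases mem_dartSet_or hO hcell hu with h | h
    · rw [extendDarts_of_mem _ h, extendDarts_of_notMem _ (swap_notMem_dartSet hO h he), sub_zero,
        coeff_apply]
    · rw [extendDarts_of_mem _ h, extendDarts_of_notMem _ (swap_notMem_dartSet hO h he'), zero_sub,
        coeff_apply, c.2.1 u v, neg_neg]

theorem coeff_injective (hO : T.IsOrientation O) : Function.Injective (coeff T O) := by
  intro c c' h
  apply Subtype.ext
  rw [← dartChain_coeff hO, ← dartChain_coeff hO, h]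

variable [Fintype (T.dartSet O)]

theorem boundary_oriented_inl (hO : T.IsOrientation O) (y : T.dartSet O → ℤ)
    (v : V) (hv : Sum.inl v ∉ (oriented hO).S) :
    (oriented hO).boundary y ⟨.inl v, hv⟩ = - ∑ w, dartChain y v w := by
  classical
  have h1 : (oriented hO).boundary y ⟨.inl v, hv⟩ = ∑ d : T.dartSet O,
      ((if (Sum.inl v : V ⊕ Sym2 V) = T.dartTgt d.1 then 1 else 0)
        - (if (Sum.inl v : V ⊕ Sym2 V) = Sum.inl d.1.1 then 1 else 0)) * y d := by
    rw [OrientedForest.boundary_apply]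
    refine Finset.sum_congr rfl fun d _ => ?_
    rw [OrientedForest.inc_eq]
    rfl
  rw [h1, sum_mul_extendDarts y fun d => (if (Sum.inl v : V ⊕ Sym2 V) = T.dartTgt d then 1 else 0)
    - (if (Sum.inl v : V ⊕ Sym2 V) = Sum.inl d.1 then 1 else 0)]
  simp only [sub_mul, Finset.sum_sub_distrib, Fintype.sum_prod_type, dartChain]
  rw [neg_sub]
  congr 1
  · refine Finset.sum_congr rfl fun w _ => ?_
    rw [Finset.sum_eq_single v]
    · rw [dartTgt, Sym2.eq_swap]
      split_ifs with h2 h3 h3 <;> simp_all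
    · intro b _ hb
      rw [dartTgt]
      split_ifs with h2 h3 h3 <;> simp_all
    · simp
  · rw [Finset.sum_eq_single v]
    · simp
    · intro b _ hb
      simp [hb.symm]
    · simp

theorem boundary_oriented_inr (hO : T.IsOrientation O) (y : T.dartSet O → ℤ)
    (u v : V) (hv : Sum.inr s(u, v) ∉ (oriented hO).S) :
    (oriented hO).boundary y ⟨.inr s(u, v), hv⟩
      = extendDarts y (u, v) + extendDarts y (v, u) := by
  classical
  have hv' := not_not.1 hv
  have h1 : (oriented hO).boundary y ⟨.inr s(u, v), hv⟩ = ∑ d : T.dartSet O,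
      (if (Sum.inr s(u, v) : V ⊕ Sym2 V) = T.dartTgt d.1 then 1 else 0) * y d := by
    rw [OrientedForest.boundary_apply]
    refine Finset.sum_congr rfl fun d _ => ?_
    rw [OrientedForest.inc_eq]
    congr 1
    have h2 : ¬ (Sum.inr s(u, v) : V ⊕ Sym2 V) = (oriented hO).src d := Sum.inr_ne_inl
    rw [if_neg h2, sub_zero]
    rfl
  rw [h1, sum_mul_extendDarts y
      fun d => if (Sum.inr s(u, v) : V ⊕ Sym2 V) = T.dartTgt d then 1 else 0,
    ← Sym2.sum_mk_eq hv'.1.1.ne]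
  refine Finset.sum_congr rfl fun d _ => ?_
  rw [dartTgt]
  by_cases hd : s(d.1, d.2) = s(u, v)
  · rw [hd, if_pos hv'.2.1]
    simp
  · rw [if_neg hd]
    split_ifs with h2 h3 h3
    · exact absurd (Sum.inr_injective h3).symm hd
    all_goals simp_all

/-- At a midpoint the vanishing boundary says that the coefficients of the two halves are opposite,
which restores antisymmetry; at a vertex it is the vanishing of the net outflow. -/
theorem boundary_eq_zero_iff (hO : T.IsOrientation O) (y : T.dartSet O → ℤ) :
    (oriented hO).boundary y = 0 ↔ y ∈ LinearMap.range (coeff T O) := by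
  constructor
  · intro hy
    have hnot : ∀ u v, ¬ T.IsCell (.inr s(u, v)) → extendDarts y (u, v) = 0 :=
      fun u v h => extendDarts_of_notMem _ fun h' => h h'.1
    refine ⟨⟨dartChain y, fun u v => ?_, fun u v h => ?_, fun v hv => ?_⟩, funext fun d => ?_⟩
    · unfold dartChain
      by_cases he : Even (T.edgeLen s(u, v))
      · have he' : Even (T.edgeLen s(v, u)) := by rwa [Sym2.eq_swap]
        rw [if_pos he, if_pos he', sub_zero, sub_zero]
        by_cases hm : (u, v) ∈ T.dartSet O
        · have h1 : Sum.inr s(u, v) ∉ (oriented hO).S := fun h => h ⟨hm.1, he, fun x hx => by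
            rcases Sym2.mem_iff.1 hx with rfl | rfl
            exacts [hm.2.1, (BYPair.nearS_iff_of_adj hm.1.1).1 hm.2.1]⟩
          have h2 := boundary_oriented_inr hO y u v h1
          rw [hy, Pi.zero_apply] at h2
          omega
        · rw [extendDarts_of_notMem _ hm,
            extendDarts_of_notMem _ fun h => hm (swap_mem_dartSet h he'), neg_zero]
      · have he' : ¬ Even (T.edgeLen s(v, u)) := by rwa [Sym2.eq_swap]
        rw [if_neg he, if_neg he', neg_sub]
    · have h' : ¬ T.IsCell (.inr s(v, u)) := by rwa [Sym2.eq_swap]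
      rw [dartChain, hnot _ _ h, hnot _ _ h', ite_self, sub_zero]
    · by_cases hn : v ∈ T.nearS
      · have h1 : Sum.inl v ∉ (oriented hO).S := fun h => h.elim hv fun h => h hn
        have h2 := boundary_oriented_inl hO y v h1
        rw [hy, Pi.zero_apply] at h2
        omega
      · refine Finset.sum_eq_zero fun w _ => ?_
        rw [dartChain, extendDarts_of_notMem _ fun h => hn h.2.1,
          extendDarts_of_notMem _ fun h => hn ((BYPair.nearS_iff_of_adj h.1.1).1 h.2.1), ite_self,
          sub_zero]
    · obtain ⟨⟨u, v⟩, h⟩ := d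
      change dartChain y u v = _
      rw [dartChain, extendDarts_of_mem _ h]
      split_ifs with he
      · rw [sub_zero]
      · rw [extendDarts_of_notMem _ (swap_notMem_dartSet hO h he), sub_zero]
  · rintro ⟨c, rfl⟩
    funext ⟨p, hp⟩
    rcases p with v | e
    · rw [boundary_oriented_inl, dartChain_coeff hO, c.2.2.2 v fun h => hp (Or.inl h)]
      rfl
    · induction e with
      | h u v =>
        have hp' := not_not.1 hp
        have h1 : (u, v) ∈ T.dartSet O :=
          ⟨hp'.1, hp'.2.2 _ (Sym2.mem_mk_left _ _), Or.inl hp'.2.1⟩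
        rw [boundary_oriented_inr, extendDarts_of_mem _ h1,
          extendDarts_of_mem _ (swap_mem_dartSet h1 hp'.2.1), coeff_apply, coeff_apply,
          c.2.1 u v, Pi.zero_apply, add_neg_cancel]

/-- An even edge of length `2k` is counted twice with length `k`, the opposite signs of its halves
cancelling in the product; an odd edge is counted once. -/
theorem pairing_eq_sum (hO : T.IsOrientation O) (x y : T.homology) :
    T.pairing x y = ∑ d, T.dartLen d.1 * (coeff T O x d * coeff T O y d) := by
  classical
  have h1 : T.pairing x y = ∑ e : T.graph.edgeSet, (T.edgeLen e : ℤ) * BYPair.edgeProd x y e.1 :=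
    Finset.sum_congr rfl fun e _ => by rw [T.edgeLen_of_mem e.2]
  rw [h1, ← Finset.sum_subtype (Finset.univ.filter (· ∈ T.graph.edgeSet)) (fun e => by simp)
    (fun e => (T.edgeLen e : ℤ) * BYPair.edgeProd x y e)]
  let z : T.dartSet O → ℤ := fun d => coeff T O x d * coeff T O y d
  change _ = ∑ d, (T.dartLen d.1 : ℤ) * z d
  rw [sum_mul_extendDarts z fun d => (T.dartLen d : ℤ)]
  have h2 : ∑ d : V × V, (T.dartLen d : ℤ) * extendDarts z d
      = ∑ e : Sym2 V, ∑ d : V × V, if s(d.1, d.2) = e then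
        (T.dartLen d : ℤ) * extendDarts z d else 0 := by
    rw [Finset.sum_comm]
    exact Finset.sum_congr rfl fun d _ => by simp
  rw [h2, Finset.sum_filter]
  refine Finset.sum_congr rfl fun e _ => ?_
  induction e with
  | h u v =>
    split_ifs with he
    · have he' : T.graph.Adj u v := he
      have hprod : BYPair.edgeProd x y s(u, v) = x.1 u v * y.1 u v := rfl
      have hprod' : x.1 v u * y.1 v u = x.1 u v * y.1 u v := by
        rw [x.2.1 u v, y.2.1 u v, neg_mul_neg]
      have hlen : T.dartLen (v, u) = T.dartLen (u, v) := by
        simp only [dartLen, Sym2.eq_swap (a := v)]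
      rw [Sym2.sum_mk_eq he'.ne, hprod, hlen]
      by_cases hm : T.IsCell (.inr s(u, v)) ∧ u ∈ T.nearS
      · obtain ⟨hcell, hu⟩ := hm
        by_cases hev : Even (T.edgeLen s(u, v))
        · have h3 : (u, v) ∈ T.dartSet O := ⟨hcell, hu, Or.inl hev⟩
          rw [extendDarts_of_mem _ h3, extendDarts_of_mem _ (swap_mem_dartSet h3 hev)]
          change _ = (T.dartLen (u, v) : ℤ) * (x.1 u v * y.1 u v)
            + (T.dartLen (u, v) : ℤ) * (x.1 v u * y.1 v u)
          rw [hprod', dartLen, if_pos hev]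
          obtain ⟨k, hk⟩ := hev
          simp only [hk]
          rw [show (k + k) / 2 = k by omega]
          push_cast
          ring
        · have hev' : ¬ Even (T.edgeLen s(v, u)) := by rwa [Sym2.eq_swap]
          rw [dartLen, if_neg hev]
          rcases mem_dartSet_or hO hcell hu with h3 | h3
          · rw [extendDarts_of_mem _ h3, extendDarts_of_notMem _ (swap_notMem_dartSet hO h3 hev),
              mul_zero, add_zero]
            rfl
          · rw [extendDarts_of_mem _ h3, extendDarts_of_notMem _ (swap_notMem_dartSet hO h3 hev'),
              mul_zero, zero_add, ← hprod']
            rfl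
      · have h0 : x.1 u v = 0 := by
          by_cases hcell : T.IsCell (.inr s(u, v))
          · exact T.homology_eq_zero x.2 fun hu => hm ⟨hcell, hu⟩
          · exact x.2.2.1 u v hcell
        rw [extendDarts_of_notMem _ fun h => hm ⟨h.1, h.2.1⟩, extendDarts_of_notMem _ fun h =>
          hm ⟨by rw [Sym2.eq_swap]; exact h.1, (BYPair.nearS_iff_of_adj he').2
            h.2.1⟩, h0]
        simp
    · refine (Finset.sum_eq_zero fun d _ => ?_).symm
      split_ifs with hd
      · rw [extendDarts_of_notMem _ fun h => he (hd ▸ h.1.1), mul_zero]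
      · rfl

end BYForest

/-! ### Tamagawa numbers of the powers -/

namespace BYForest

variable {V : Type*} [Fintype V] (T : BYForest V)

theorem tamagawa_unramified_eq_card (f : ℕ) : (T.unramified f).tamagawa =
    Nat.card {a // (SignedAut.geomComponentRep T.toBYPair T.εF)^[f] a = a} := by
  have h : SignedAut.geomComponentRep T.toBYPair (T.εF ^ f)
      = SignedAut.geomComponentRep T.toBYPair T.εF ^ f := map_pow _ _ _
  refine Nat.card_congr (Equiv.subtypeEquivRight fun a : T.geomComponentGroup => ?_)
  change SignedAut.geomComponentRep T.toBYPair (T.εF ^ f) a = a ↔ _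
  rw [h, Module.End.pow_apply]

theorem exists_tamagawa_eq (hB : T.ParityB) :
    ∃ a : ℕ → ℕ, (∀ d, 0 < d → 0 < a d) ∧
      ∀ f, 0 < f → (T.unramified f).tamagawa = ∏ d ∈ f.divisors, a d ^ Nat.totient d := by
  classical
  obtain ⟨O, hO⟩ := T.exists_isOrientation hB
  obtain ⟨a, ha, h⟩ :=
    (oriented hO).toSignedForest.exists_numSolutions_eq (oriented hO).det_matrix_ne_zero
  refine ⟨a, ha, fun f hf => ?_⟩
  rw [T.tamagawa_unramified_eq_card, ← h f hf]
  refine (oriented hO).card_invariants (coeff_injective hO) (boundary_eq_zero_iff hO) T.pairing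
    (pairing_eq_sum hO) (SignedAut.homologyRep T.toBYPair T.εF) ?_ _ ?_ f
  · rintro x ⟨⟨u, v⟩, h⟩
    change T.εF.chainMap x.1 (T.εF.F u) (T.εF.F v) = T.εF.cellSign (.inr s(u, v)) * x.1 u v
    rw [SignedAut.chainMap_apply_F, SignedAut.edgeSign_eq_cellSign]
  · intro φ ψ hφ
    change (LinearMap.range T.pairing).mkQ ((SignedAut.homologyRep T.toBYPair).dual T.εF φ) = _
    congr 1
    refine LinearMap.ext fun x => ?_
    rw [Representation.dual_apply]
    change φ (SignedAut.homologyRep T.toBYPair T.εF⁻¹ x) = ψ x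
    rw [← hφ, ← Module.End.mul_apply, ← map_mul, mul_inv_cancel, map_one, Module.End.one_apply]

/-- Every class is fixed by the power of exponent `orderOf T.εF`, so being fixed by the `f`-th power
and by the power of exponent the gcd are equivalent. -/
theorem tamagawa_unramified_gcd (f : ℕ) :
    (T.unramified (f.gcd (orderOf T.εF))).tamagawa = (T.unramified f).tamagawa := by
  rw [tamagawa_unramified_eq_card, tamagawa_unramified_eq_card]
  refine Nat.card_congr (Equiv.subtypeEquivRight fun a => ?_)
  have hn : Function.IsPeriodicPt (SignedAut.geomComponentRep T.toBYPair T.εF)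
      (orderOf T.εF) a := by
    change _ = _
    rw [← Module.End.pow_apply, ← map_pow, pow_orderOf_eq_one, map_one, Module.End.one_apply]
  exact ⟨fun h => (Function.IsPeriodicPt.trans_dvd h (Nat.gcd_dvd_left _ _)),
    fun h => Function.IsPeriodicPt.gcd h hn⟩

end BYForest

end

/-- The factors from `exists_tamagawa_eq` are reset to `1` away from the divisors of the order. The
formula survives because it may be applied to the gcd of `f` with the order, whose divisors are
exactly the divisors of `f` that are kept. -/
theorem mainTheorem9 {V : Type*} [Fintype V] (T : BYForest V) (hB : T.ParityB) :
    ∃ a : ℕ → ℕ, (∀ d, 0 < d → 0 < a d) ∧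
      (∀ d, 0 < d → ¬ d ∣ orderOf T.εF → a d = 1) ∧
      ∀ f, 0 < f → (T.unramified f).tamagawa = ∏ d ∈ f.divisors, a d ^ Nat.totient d := by
  classical
  obtain ⟨a, ha, h⟩ := T.exists_tamagawa_eq hB
  refine ⟨fun d => if d ∣ orderOf T.εF then a d else 1, fun d hd => ?_, fun d _ hd => if_neg hd,
    fun f hf => ?_⟩
  · change 0 < ite _ _ _
    split_ifs
    exacts [ha d hd, one_pos]
  · have hg : 0 < f.gcd (orderOf T.εF) := Nat.gcd_pos_of_pos_left _ hf
    rw [← T.tamagawa_unramified_gcd, h _ hg]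
    have hsub : (f.gcd (orderOf T.εF)).divisors ⊆ f.divisors :=
      Nat.divisors_subset_of_dvd hf.ne' (Nat.gcd_dvd_left _ _)
    rw [← Finset.prod_subset hsub fun d hd hd' => ?_]
    · refine Finset.prod_congr rfl fun d hd => ?_
      beta_reduce
      rw [if_pos ((Nat.dvd_of_mem_divisors hd).trans (Nat.gcd_dvd_right _ _))]
    · beta_reduce
      rw [if_neg fun h' => hd' (Nat.mem_divisors.2
        ⟨Nat.dvd_gcd (Nat.dvd_of_mem_divisors hd) h', hg.ne'⟩), one_pow]
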